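/- Let $\Lambda$ be a left noetherian ring and $E\subseteq\Lambda$ a semisimple artinian subring with the same unit. Modules are left modules, complexes are cochain complexes, $\Sigma$ is the suspension, unadorned $\otimes$ and $\mathrm{Hom}$ are over $E$, and $s\bar\Lambda$ is the $E$-$E$-bimodule $\Lambda/E$ placed in degree $-1$; write $s\bar a_{1,p}=s\bar a_1\otimes\cdots\otimes s\bar a_p\in(s\bar\Lambda)^{\otimes p}$. For a complex $X$ of $\Lambda$-modules, let $\mathcal Y(\Lambda,X)=\prod_{p\ge 0}\mathrm{Hom}((s\bar\Lambda)^{\otimes p}\otimes\Lambda,X)$ (product and Hom of graded $E$-modules), with differential $\delta=\delta_{\rm in}+\delta_{\rm ex}$, where for $f$ in the factor indexed by $p$ and of degree $|f|$ one has $\delta_{\rm in}(f)=d_X\circ f$ and $$\delta_{\rm ex}(f)(s\bar a_{1,p+1}\otimes x)=(-1)^{|f|+1}a_1f(s\bar a_{2,p+1}\otimes x)+\sum_{i=1}^{p}(-1)^{|f|+i+1}f(s\bar a_{1,i-1}\otimes s\overline{a_ia_{i+1}}\otimes s\bar a_{i+2,p+1}\otimes x)+(-1)^{|f|+p}f(s\bar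 a_{1,p}\otimes a_{p+1}x).$$ It is a complex of $\Lambda$-modules via right multiplication on the last factor $\Lambda$, and it is functorial in $X$ by composition. Let $\Omega_{\rm nc}(X)=s\bar\Lambda\otimes X$, with differential $s\bar a\otimes x\mapsto -s\bar a\otimes d_X(x)$ and $\Lambda$-action $b\blacktriangleright(s\bar a\otimes x)=s\overline{ba}\otimes x-s\bar b\otimes ax$. Let $\mathcal{SY}(\Lambda,X)$ be the colimit of the sequence $\mathcal Y(\Lambda,X)\to\mathcal Y(\Lambda,\Omega_{\rm nc}(X))\to\mathcal Y(\Lambda,\Omega_{\rm nc}^2(X))\to\cdots$ of complexes of $\Lambda$-modules, whose structure maps send $f$ to the map $s\bar a_{1,n+1}\otimes x\mapsto(-1)^{|f|}s\bar a_1\otimes f(s\bar a_{2,n+1}\otimes x)$. Write $[f;p]$ for the class of $f\in\mathcal Y(\Lambda,\Omega^p_{\rm nc}(X))$. Let $\mathbb B=\bigoplus_{q\ge0}\Lambda\otimes(s\bar\Lambda)^{\otimes q}\otimes\Lambda$ be the normalised $E$-relative bar resolution, with differential $$a_0\otimes s\bar a_{1,n}\otimes a_{n+1}\mapsto a_0a_1\otimes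 s\bar a_{2,n}\otimes a_{n+1}+\sum_{i=1}^{n-1}(-1)^ia_0\otimes s\bar a_{1,i-1}\otimes s\overline{a_ia_{i+1}}\otimes s\bar a_{i+2,n}\otimes a_{n+1}+(-1)^na_0\otimes s\bar a_{1,n-1}\otimes a_na_{n+1},$$ let $\varepsilon\colon\mathbb B\to\Lambda$ be given by the multiplication $\Lambda\otimes\Lambda\to\Lambda$ and zero on the summands with $q\geq 1$, and let $\mathbb B_{\le p}$ be the subcomplex of summands with $q\le p$; thus $\mathbb B_{\le p}\otimes_\Lambda X=\bigoplus_{q\le p}\Lambda\otimes(s\bar\Lambda)^{\otimes q}\otimes X$. Let $$\vartheta_X\colon\operatorname{colim}_p\mathcal Y(\Lambda,\mathbb B_{\le p}\otimes_\Lambda X)\longrightarrow\mathcal Y(\Lambda,X)$$ be the map induced by the composites $\mathcal Y(\Lambda,\varepsilon\otimes_\Lambda\mathrm{Id}_X)\circ\mathcal Y(\Lambda,\mathrm{inc}_p)$, where $\mathrm{inc}_p\colon\mathbb B_{\le p}\otimes_\Lambda X\hookrightarrow\mathbb B\otimes_\Lambda X$ is the inclusion. Then, for every complex $X$ of $\Lambda$-modules: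 1. $\vartheta_X$ is a quasi-isomorphism. 2. The three complexes $\operatorname{colim}_p\mathcal Y(\Lambda,\mathbb B_{\le p}\otimes_\Lambda X)$, $\mathcal Y(\Lambda,X)$ and $\mathcal{SY}(\Lambda,X)$ consist of injective $\Lambda$-modules, and in the homotopy category $\mathbf K(\Lambda\text{-}\mathrm{Inj})$ of complexes of injective $\Lambda$-modules there is an exact triangle $$\operatorname{colim}_p\mathcal Y(\Lambda,\mathbb B_{\le p}\otimes_\Lambda X)\xrightarrow{\ \vartheta_X\ }\mathcal Y(\Lambda,X)\longrightarrow\mathcal{SY}(\Lambda,X)\longrightarrow\Sigma\bigl(\operatorname{colim}_p\mathcal Y(\Lambda,\mathbb B_{\le p}\otimes_\Lambda X)\bigr)$$ whose second map is the canonical map $f\mapsto[f;0]$. 3. $\mathcal{SY}(\Lambda,X)$ is homotopy equivalent, as a complex of $\Lambda$-modules, to the mapping cone $\mathrm{Cone}(\vartheta_X)$. -/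

import Mathlib

open CategoryTheory Limits

universe u

noncomputable section

namespace SingYoneda

open scoped TensorProduct

/-! ### Tensor products over a noncommutative ring -/

section NTensor

variable (R : Type u) [Ring R] (A : Type u) [AddCommGroup A] [Module Rᵐᵒᵖ A]
  (M : Type u) [AddCommGroup M] [Module R M]

/-- The relations `a r ⊗ m = a ⊗ r m`. -/
def balancedRel : Submodule ℤ (A ⊗[ℤ] M) :=
  Submodule.span ℤ {t | ∃ (a : A) (r : R) (m : M),
    t = (MulOpposite.op r • a) ⊗ₜ[ℤ] m - a ⊗ₜ[ℤ] (r • m)}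

/-- The tensor product `A ⊗_R M` of a right `R`-module `A` and a left `R`-module `M`. -/
def NTensor : Type u := (A ⊗[ℤ] M) ⧸ balancedRel R A M

instance : AddCommGroup (NTensor R A M) :=
  inferInstanceAs (AddCommGroup ((A ⊗[ℤ] M) ⧸ balancedRel R A M))

variable {A M}

/-- The elementary tensor `a ⊗ m`. -/
def NTensor.tmul (a : A) (m : M) : NTensor R A M := Submodule.Quotient.mk (a ⊗ₜ[ℤ] m)

variable {R}

lemma NTensor.add_tmul (a b : A) (m : M) :
    NTensor.tmul R (a + b) m = NTensor.tmul R a m + NTensor.tmul R b m := by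
  simp only [NTensor.tmul, TensorProduct.add_tmul]; rfl

lemma NTensor.tmul_add (a : A) (m n : M) :
    NTensor.tmul R a (m + n) = NTensor.tmul R a m + NTensor.tmul R a n := by
  simp only [NTensor.tmul, TensorProduct.tmul_add]; rfl

lemma NTensor.smul_tmul (a : A) (r : R) (m : M) :
    NTensor.tmul R (MulOpposite.op r • a) m = NTensor.tmul R a (r • m) :=
  (Submodule.Quotient.eq _).2 (Submodule.subset_span ⟨a, r, m, rfl⟩)

/-- The elementary tensor as a biadditive map. -/
def NTensor.mk : A →+ M →+ NTensor R A M :=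
  AddMonoidHom.mk' (fun a => AddMonoidHom.mk' (NTensor.tmul R a) (NTensor.tmul_add a))
    (fun a b => by ext m; exact NTensor.add_tmul a b m)

@[simp] lemma NTensor.mk_apply (a : A) (m : M) :
    NTensor.mk (R := R) a m = NTensor.tmul R a m := rfl

lemma NTensor.tmul_sub (a : A) (m n : M) :
    NTensor.tmul R a (m - n) = NTensor.tmul R a m - NTensor.tmul R a n :=
  map_sub (NTensor.mk (R := R) a) m n

lemma NTensor.tmul_neg (a : A) (m : M) :
    NTensor.tmul R a (-m) = -NTensor.tmul R a m :=
  map_neg (NTensor.mk (R := R) a) m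

lemma NTensor.tmul_zero (a : A) : NTensor.tmul R a (0 : M) = 0 :=
  map_zero (NTensor.mk (R := R) a)

lemma NTensor.zero_tmul (m : M) : NTensor.tmul R (0 : A) m = 0 :=
  DFunLike.congr_fun (map_zero (NTensor.mk (R := R) (A := A) (M := M))) m

@[elab_as_elim]
lemma NTensor.induction_on {P : NTensor R A M → Prop} (t : NTensor R A M)
    (h0 : P 0) (ht : ∀ a m, P (NTensor.tmul R a m)) (ha : ∀ s t, P s → P t → P (s + t)) :
    P t := by
  obtain ⟨t, rfl⟩ := Submodule.Quotient.mk_surjective _ t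
  induction t using TensorProduct.induction_on with
  | zero => exact h0
  | tmul a m => exact ht a m
  | add s t hs ht' => exact ha _ _ hs ht'

/-- The universal property of `A ⊗_R M`. -/
def NTensor.lift {P : Type*} [AddCommGroup P] (f : A →+ M →+ P)
    (hf : ∀ a (r : R) m, f (MulOpposite.op r • a) m = f a (r • m)) : NTensor R A M →+ P :=
  ((balancedRel R A M).liftQ
    (TensorProduct.liftAddHom f (by intro r a m; simp)).toIntLinearMap (by
      rw [balancedRel, Submodule.span_le]
      rintro _ ⟨a, r, m, rfl⟩
      simp [hf])).toAddMonoidHom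

@[simp] lemma NTensor.lift_tmul {P : Type*} [AddCommGroup P] (f : A →+ M →+ P)
    (hf : ∀ a (r : R) m, f (MulOpposite.op r • a) m = f a (r • m)) (a : A) (m : M) :
    NTensor.lift f hf (NTensor.tmul R a m) = f a m := by
  change TensorProduct.liftAddHom f (by intro r a m; simp) (a ⊗ₜ[ℤ] m) = f a m
  simp

lemma NTensor.hom_ext {P : Type*} [AddCommGroup P] {f g : NTensor R A M →+ P}
    (h : ∀ a m, f (NTensor.tmul R a m) = g (NTensor.tmul R a m)) : f = g := by
  ext t
  induction t using NTensor.induction_on with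
  | h0 => simp
  | ht a m => exact h a m
  | ha s t hs ht => simp [hs, ht]

/-- The map `A ⊗ g`. -/
def NTensor.map {N : Type u} [AddCommGroup N] [Module R N] (g : M →ₗ[R] N) :
    NTensor R A M →+ NTensor R A N :=
  NTensor.lift ((AddMonoidHom.compHom' g.toAddMonoidHom).comp NTensor.mk) (by
    intro a r m
    simp [NTensor.smul_tmul])

@[simp] lemma NTensor.map_tmul {N : Type u} [AddCommGroup N] [Module R N] (g : M →ₗ[R] N)
    (a : A) (m : M) : NTensor.map g (NTensor.tmul R a m) = NTensor.tmul R a (g m) := by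
  simp [NTensor.map]

end NTensor

variable {Λ : Type u} [Ring Λ] (E : Subring Λ)

/-! ### The right `E`-modules `Λ` and `Λ / E` -/

instance rightModule : Module (↥E)ᵐᵒᵖ Λ :=
  Module.compHom Λ (RingHom.op E.subtype)

lemma rightModule_smul (e : E) (a : Λ) : MulOpposite.op e • a = a * (e : Λ) := rfl

/-- `E` as a right `E`-submodule of `Λ`. -/
def subE : Submodule (↥E)ᵐᵒᵖ Λ where
  carrier := E
  add_mem' := E.add_mem
  zero_mem' := E.zero_mem
  smul_mem' := by
    intro c x hx
    exact E.mul_mem hx c.unop.2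

/-- The quotient `Λ / E`. -/
abbrev LBar : Type u := Λ ⧸ subE E

/-- The class of `a` in `Λ / E`. -/
def bar : Λ →+ LBar E := (subE E).mkQ.toAddMonoidHom

lemma bar_eq_zero (e : E) : bar E (e : Λ) = 0 :=
  (Submodule.Quotient.mk_eq_zero _).2 e.2

lemma bar_mul (a : Λ) (e : E) : bar E (a * e) = MulOpposite.op e • bar E a := rfl

lemma bar_surjective : Function.Surjective (bar E) := Submodule.mkQ_surjective _

/-! ### The Λ-module of `M`-valued relative differential one-forms -/

section Omega

variable (M : Type u) [AddCommGroup M] [Module Λ M]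

/-- The underlying group `(Λ / E) ⊗_E M` of the module of `M`-valued noncommutative one-forms. -/
def OmegaMod : Type u := NTensor E (LBar E) M

instance : AddCommGroup (OmegaMod E M) := inferInstanceAs (AddCommGroup (NTensor E (LBar E) M))

variable {M}

/-- The element `s a ⊗ x`. -/
def form (a : Λ) (x : M) : OmegaMod E M := NTensor.tmul E (bar E a) x

lemma form_add_left (a b : Λ) (x : M) : form E (a + b) x = form E a x + form E b x := by
  simp only [form, map_add]; exact NTensor.add_tmul _ _ _

lemma form_sub_left (a b : Λ) (x : M) : form E (a - b) x = form E a x - form E b x := by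
  rw [eq_sub_iff_add_eq, ← form_add_left, sub_add_cancel]

lemma form_add (a : Λ) (x y : M) : form E a (x + y) = form E a x + form E a y :=
  NTensor.tmul_add _ _ _

lemma form_sub (a : Λ) (x y : M) : form E a (x - y) = form E a x - form E a y :=
  NTensor.tmul_sub _ _ _

lemma form_neg (a : Λ) (x : M) : form E a (-x) = -form E a x :=
  NTensor.tmul_neg _ _

lemma form_coe (e : E) (x : M) : form E (e : Λ) x = 0 := by
  rw [form, bar_eq_zero]; exact NTensor.zero_tmul x

lemma form_one (x : M) : form E (1 : Λ) x = 0 := form_coe E 1 x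

lemma form_mul (a : Λ) (e : E) (x : M) : form E (a * e) x = form E a ((e : Λ) • x) := by
  rw [form, bar_mul]; exact NTensor.smul_tmul _ _ _

/-- `form` as a biadditive map. -/
def formHom : Λ →+ M →+ OmegaMod E M := (NTensor.mk (R := E)).comp (bar E)

@[simp] lemma formHom_apply (a : Λ) (x : M) : formHom E a x = form E a x := rfl

variable {E}

@[elab_as_elim]
lemma OmegaMod.induction_on {P : OmegaMod E M → Prop} (t : OmegaMod E M)
    (h0 : P 0) (ht : ∀ a x, P (form E a x)) (ha : ∀ s t, P s → P t → P (s + t)) : P t := by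
  refine NTensor.induction_on t h0 (fun a x => ?_) ha
  obtain ⟨a, rfl⟩ := bar_surjective E a
  exact ht a x

/-- Additive maps out of `(Λ / E) ⊗_E M`. -/
def OmegaMod.lift {P : Type u} [AddCommGroup P] (f : Λ →+ M →+ P)
    (h0 : ∀ (e : E) x, f e x = 0) (hf : ∀ a (e : E) x, f (a * e) x = f a ((e : Λ) • x)) :
    OmegaMod E M →+ P :=
  NTensor.lift (QuotientAddGroup.lift (subE E).toAddSubgroup f (by
      intro e he
      ext x
      exact h0 ⟨e, he⟩ x)) (by
    intro a e x
    obtain ⟨a, rfl⟩ := bar_surjective E a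
    exact hf a e x)

@[simp] lemma OmegaMod.lift_form {P : Type u} [AddCommGroup P] (f : Λ →+ M →+ P)
    (h0 : ∀ (e : E) x, f e x = 0) (hf : ∀ a (e : E) x, f (a * e) x = f a ((e : Λ) • x))
    (a : Λ) (x : M) : OmegaMod.lift f h0 hf (form E a x) = f a x :=
  NTensor.lift_tmul _ _ _ _

lemma OmegaMod.hom_ext {P : Type*} [AddCommGroup P] {f g : OmegaMod E M →+ P}
    (h : ∀ a x, f (form E a x) = g (form E a x)) : f = g := by
  ext t
  induction t using OmegaMod.induction_on with
  | h0 => simp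
  | ht a x => exact h a x
  | ha s t hs ht => simp [hs, ht]

/-- The action `b ▸ (s a ⊗ x) = s (b a) ⊗ x - s b ⊗ a x`, for fixed `b`. -/
def OmegaMod.act (b : Λ) : OmegaMod E M →+ OmegaMod E M :=
  OmegaMod.lift
    ((formHom E).comp (AddMonoidHom.mulLeft b) -
      AddMonoidHom.mk' (fun a => (formHom E b).comp (DistribSMul.toAddMonoidHom M a))
        (fun a a' => by ext x; simp [add_smul, form_add]))
    (by intro e x; simp [form_mul])
    (by intro a e x; simp [← mul_assoc, form_mul, mul_smul])

lemma OmegaMod.act_form (b a : Λ) (x : M) :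
    OmegaMod.act b (form E a x) = form E (b * a) x - form E b (a • x) := by
  simp [OmegaMod.act]

/-- The left `Λ`-module structure on one-forms. -/
instance : Module Λ (OmegaMod E M) where
  smul b := OmegaMod.act b
  one_smul t := by
    change OmegaMod.act 1 t = t
    induction t using OmegaMod.induction_on with
    | h0 => simp
    | ht a x => simp [OmegaMod.act_form, form_one]
    | ha s t hs ht => simp [hs, ht]
  mul_smul b c t := by
    change OmegaMod.act (b * c) t = OmegaMod.act b (OmegaMod.act c t)
    induction t using OmegaMod.induction_on with
    | h0 => simp
    | ht a x => simp [OmegaMod.act_form, mul_assoc, mul_smul]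
    | ha s t hs ht => simp [hs, ht]
  smul_zero b := map_zero (OmegaMod.act b)
  smul_add b := map_add (OmegaMod.act b)
  add_smul b c t := by
    change OmegaMod.act (b + c) t = OmegaMod.act b t + OmegaMod.act c t
    induction t using OmegaMod.induction_on with
    | h0 => simp
    | ht a x => simp [OmegaMod.act_form, add_mul, form_add_left]; abel
    | ha s t hs ht => simp [hs, ht]; abel
  zero_smul t := by
    change OmegaMod.act 0 t = 0
    have h (x : M) : form E (0 : Λ) x = 0 := form_coe E 0 x
    induction t using OmegaMod.induction_on with
    | h0 => simp
    | ht a x => simp [OmegaMod.act_form, h]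
    | ha s t hs ht => simp [hs, ht]

lemma smul_form (b a : Λ) (x : M) :
    b • form E a x = form E (b * a) x - form E b (a • x) := OmegaMod.act_form b a x

/-- Restricted to `E`, the action is the usual one on the first tensor factor. -/
lemma coe_smul_form (e : E) (a : Λ) (x : M) :
    e • form E a x = form E ((e : Λ) * a) x := by
  change (e : Λ) • form E a x = _
  rw [smul_form, form_coe, sub_zero]

variable {N : Type u} [AddCommGroup N] [Module Λ N]

/-- The additive map `(Λ / E) ⊗ g` for an `E`-linear map `g`. -/
def OmegaMod.mapAdd (g : M →ₗ[E] N) : OmegaMod E M →+ OmegaMod E N := NTensor.map g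

lemma OmegaMod.mapAdd_form (g : M →ₗ[E] N) (a : Λ) (x : M) :
    OmegaMod.mapAdd g (form E a x) = form E a (g x) := NTensor.map_tmul g _ _

/-- The `E`-linear map `(Λ / E) ⊗ g` for an `E`-linear map `g`. -/
def OmegaMod.mapE (g : M →ₗ[E] N) : OmegaMod E M →ₗ[E] OmegaMod E N where
  toFun := OmegaMod.mapAdd g
  map_add' := map_add _
  map_smul' e t := by
    simp only [RingHom.id_apply]
    induction t using OmegaMod.induction_on with
    | h0 => simp
    | ht a x => simp only [coe_smul_form, OmegaMod.mapAdd_form]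
    | ha s t hs ht => rw [smul_add, map_add, map_add, hs, ht, smul_add]

@[simp] lemma OmegaMod.mapE_form (g : M →ₗ[E] N) (a : Λ) (x : M) :
    OmegaMod.mapE g (form E a x) = form E a (g x) := OmegaMod.mapAdd_form g _ _

/-- The `Λ`-linear map `(Λ / E) ⊗ g` for a `Λ`-linear map `g`. -/
def OmegaMod.map (g : M →ₗ[Λ] N) : OmegaMod E M →ₗ[Λ] OmegaMod E N where
  toFun := OmegaMod.mapE (g.restrictScalars E)
  map_add' := map_add _
  map_smul' b t := by
    simp only [RingHom.id_apply]
    induction t using OmegaMod.induction_on with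
    | h0 => simp
    | ht a x => simp [smul_form]
    | ha s t hs ht => simp only [smul_add, map_add, hs, ht]

@[simp] lemma OmegaMod.map_form (g : M →ₗ[Λ] N) (a : Λ) (x : M) :
    OmegaMod.map g (form E a x) = form E a (g x) := OmegaMod.mapE_form _ a x

lemma OmegaMod.linearMap_ext {S : Type*} [Semiring S] [Module S (OmegaMod E M)] {P : Type*}
    [AddCommGroup P] [Module S P] {f g : OmegaMod E M →ₗ[S] P}
    (h : ∀ a x, f (form E a x) = g (form E a x)) : f = g := by
  apply LinearMap.toAddMonoidHom_injective
  exact OmegaMod.hom_ext h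

end Omega

/-- The functor `M ↦ (Λ / E) ⊗_E M` of one-forms on left `Λ`-modules. -/
def Omega : ModuleCat.{u} Λ ⥤ ModuleCat.{u} Λ where
  obj M := ModuleCat.of Λ (OmegaMod E M)
  map g := ModuleCat.ofHom (OmegaMod.map g.hom)
  map_id M := by
    ext1
    exact OmegaMod.linearMap_ext (by intro a x; simp)
  map_comp f g := by
    ext1
    exact OmegaMod.linearMap_ext (by intro a x; simp)

instance : (Omega E).Additive where
  map_add {M N f g} := by
    ext1
    refine OmegaMod.linearMap_ext (fun a x => ?_)
    change OmegaMod.map (f + g).hom (form E a x) =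
      OmegaMod.map f.hom (form E a x) + OmegaMod.map g.hom (form E a x)
    simp [form_add]

/-- The iterates of `Omega`. As a left `E`-module, `(OmegaPow E p).obj M` is
`(Λ / E) ⊗_E ⋯ ⊗_E (Λ / E) ⊗_E M` with `p` factors `Λ / E`. -/
def OmegaPow : ℕ → (ModuleCat.{u} Λ ⥤ ModuleCat.{u} Λ)
  | 0 => 𝟭 _
  | p + 1 => OmegaPow p ⋙ Omega E

instance OmegaPow_additive : ∀ p, (OmegaPow E p).Additive
  | 0 => inferInstanceAs (𝟭 (ModuleCat.{u} Λ)).Additive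
  | p + 1 =>
    have := OmegaPow_additive p
    inferInstanceAs (OmegaPow E p ⋙ Omega E).Additive

/-- The element `s a₁ ⊗ ⋯ ⊗ s a_p ⊗ x`. -/
def word {M : ModuleCat.{u} Λ} : ∀ {p : ℕ}, (Fin p → Λ) → M → (OmegaPow E p).obj M
  | 0, _, x => x
  | _ + 1, a, x => form E (a 0) (word (Fin.tail a) x)

lemma smul_word {M : ModuleCat.{u} Λ} {p : ℕ} (a : Fin (p + 1) → Λ) (x : M) :
    a 0 • word E (Fin.tail a) x =
      ∑ j : Fin p, (-1 : ℤ) ^ (j : ℕ) • word E (Fin.contractNth j.castSucc (· * ·) a) x +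
        (-1 : ℤ) ^ p • word E (Fin.init a) (a (Fin.last p) • x) := by
  induction p with
  | zero =>
    simp
    rfl
  | succ p ih =>
    have h0 : Fin.contractNth (Fin.castSucc (0 : Fin (p + 1))) (· * ·) a =
        Fin.cons (a 0 * a 1) (Fin.tail (Fin.tail a)) := by
      funext k
      refine Fin.cases ?_ (fun k => ?_) k
      · simp [Fin.contractNth]
      · simp [Fin.contractNth, Fin.tail]
    have h1 (j : Fin p) : Fin.contractNth (Fin.castSucc j.succ) (· * ·) a =
        Fin.cons (a 0) (Fin.contractNth j.castSucc (· * ·) (Fin.tail a)) := by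
      funext k
      refine Fin.cases ?_ (fun k => ?_) k
      · simp [Fin.contractNth]
      · simp [Fin.contractNth, Fin.tail]
    have h2 : Fin.init a = Fin.cons (a 0) (Fin.init (Fin.tail a)) := by
      funext k
      refine Fin.cases ?_ (fun k => ?_) k
      · simp [Fin.init]
      · simp [Fin.init, Fin.tail]
    have hw (n : ℕ) (b : Λ) (c : Fin n → Λ) (y : M) :
        word E (Fin.cons b c : Fin (n + 1) → Λ) y = form E b (word E c y) := by
      change form E _ (word E (Fin.tail (Fin.cons b c : Fin (n + 1) → Λ)) y) = _
      simp
    have h3 : a 0 • word E (Fin.tail a) x =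
        (form E (a 0 * a 1) (word E (Fin.tail (Fin.tail a)) x) -
          form E (a 0) ((Fin.tail a) 0 • word E (Fin.tail (Fin.tail a)) x) : OmegaMod E _) :=
      smul_form _ _ _
    have h4 (t : (OmegaPow E p).obj M) : form E (a 0) t = formHom E (a 0) t := rfl
    have h5 (y : OmegaMod E ((OmegaPow E p).obj M)) (t : Fin p → (OmegaPow E p).obj M)
        (v : (OmegaPow E p).obj M) :
        y - form E (a 0) (∑ j : Fin p, (-1 : ℤ) ^ (j : ℕ) • t j + (-1 : ℤ) ^ p • v) =
          (-1 : ℤ) ^ 0 • y + ∑ j : Fin p, (-1 : ℤ) ^ ((j : ℕ) + 1) • form E (a 0) (t j) +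
            (-1 : ℤ) ^ (p + 1) • form E (a 0) v := by
      rw [h4, map_add, map_sum]
      simp only [map_zsmul, formHom_apply, pow_zero, one_smul, pow_succ, mul_neg, mul_one,
        neg_smul, Finset.sum_neg_distrib]
      abel
    rw [h3, ih, Fin.sum_univ_succ, h0, h2]
    simp only [h1, hw]
    exact h5 _ _ _

/-! ### The Yoneda complex `𝒴(Λ, X)` -/

section Yoneda

/-- The external differential without its sign, as an additive map. -/
def extDiffAdd {N M : Type u} [AddCommGroup N] [Module Λ N] [AddCommGroup M] [Module Λ M]
    (f : N →ₗ[E] M) : OmegaMod E N →+ M :=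
  OmegaMod.lift
    (AddMonoidHom.mk' (fun a => (DistribSMul.toAddMonoidHom M a).comp f.toAddMonoidHom -
      f.toAddMonoidHom.comp (DistribSMul.toAddMonoidHom N a))
      (fun a b => by ext x; simp [add_smul]; abel))
    (by
      intro e x
      have h : f ((e : Λ) • x) = (e : Λ) • f x := f.map_smul e x
      simp [h])
    (by
      intro a e x
      have h : f ((e : Λ) • x) = (e : Λ) • f x := f.map_smul e x
      simp [mul_smul, h])

lemma extDiffAdd_form {N M : Type u} [AddCommGroup N] [Module Λ N] [AddCommGroup M]
    [Module Λ M] (f : N →ₗ[E] M) (a : Λ) (x : N) :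
    extDiffAdd E f (form E a x) = a • f x - f (a • x) := by
  rw [extDiffAdd, OmegaMod.lift_form]
  rfl

/-- The external differential without its sign: the map
`s a ⊗ w ↦ a f(w) - f(a ▸ w)` on `(Λ / E) ⊗_E N`. -/
def extDiff {N M : Type u} [AddCommGroup N] [Module Λ N] [AddCommGroup M] [Module Λ M]
    (f : N →ₗ[E] M) : OmegaMod E N →ₗ[E] M where
  toFun := extDiffAdd E f
  map_add' := map_add _
  map_smul' e t := by
    simp only [RingHom.id_apply]
    induction t using OmegaMod.induction_on with
    | h0 => simp
    | ht a x =>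
      have h (y : N) : f ((e : Λ) • y) = (e : Λ) • f y := f.map_smul e y
      rw [coe_smul_form, extDiffAdd_form, extDiffAdd_form]
      simp [mul_smul, h, Subring.smul_def, smul_sub]
    | ha s t hs ht => rw [smul_add, map_add, map_add, hs, ht, smul_add]

@[simp] lemma extDiff_form {N M : Type u} [AddCommGroup N] [Module Λ N] [AddCommGroup M]
    [Module Λ M] (f : N →ₗ[E] M) (a : Λ) (x : N) :
    extDiff E f (form E a x) = a • f x - f (a • x) := extDiffAdd_form E f a x

lemma comp_extDiff {N M M' : Type u} [AddCommGroup N] [Module Λ N] [AddCommGroup M]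
    [Module Λ M] [AddCommGroup M'] [Module Λ M'] (g : M →ₗ[Λ] M') (f : N →ₗ[E] M) :
    g.restrictScalars E ∘ₗ extDiff E f = extDiff E (g.restrictScalars E ∘ₗ f) :=
  OmegaMod.linearMap_ext (by intro a x; simp)

lemma extDiff_comp {N N' M : Type u} [AddCommGroup N] [Module Λ N] [AddCommGroup M]
    [Module Λ M] [AddCommGroup N'] [Module Λ N'] (f : N →ₗ[E] M) (g : N' →ₗ[Λ] N) :
    extDiff E f ∘ₗ (OmegaMod.map g).restrictScalars E =
      extDiff E (f ∘ₗ g.restrictScalars E) :=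
  OmegaMod.linearMap_ext (by intro a x; simp)

lemma extDiff_extDiff {N M : Type u} [AddCommGroup N] [Module Λ N] [AddCommGroup M]
    [Module Λ M] (f : N →ₗ[E] M) : extDiff E (extDiff E f) = 0 := by
  refine OmegaMod.linearMap_ext (fun a t => ?_)
  rw [extDiff_form, LinearMap.zero_apply]
  induction t using OmegaMod.induction_on with
  | h0 => simp
  | ht b x => simp [smul_form, mul_smul, smul_sub]
  | ha s t hs ht =>
    rw [smul_add, map_add, map_add, smul_add, add_sub_add_comm, hs, ht, add_zero]

lemma extDiff_mapE {N M : Type u} [AddCommGroup N] [Module Λ N] [AddCommGroup M]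
    [Module Λ M] (f : N →ₗ[E] M) :
    extDiff E (OmegaMod.mapE f) = -OmegaMod.mapE (extDiff E f) := by
  refine OmegaMod.linearMap_ext (fun a t => ?_)
  rw [extDiff_form, LinearMap.neg_apply, OmegaMod.mapE_form]
  induction t using OmegaMod.induction_on with
  | h0 =>
    have h : form E a (0 : M) = 0 := map_zero (formHom E a)
    simp [h]
  | ht b x => simp [smul_form, form_sub]
  | ha s t hs ht =>
    rw [smul_add, map_add, map_add, map_add, form_add, smul_add, add_sub_add_comm, hs, ht, neg_add]

lemma extDiff_add {N M : Type u} [AddCommGroup N] [Module Λ N] [AddCommGroup M]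
    [Module Λ M] (f g : N →ₗ[E] M) : extDiff E (f + g) = extDiff E f + extDiff E g :=
  OmegaMod.linearMap_ext (by intro a x; simp; abel)

lemma extDiff_zero {N M : Type u} [AddCommGroup N] [Module Λ N] [AddCommGroup M]
    [Module Λ M] : extDiff E (0 : N →ₗ[E] M) = 0 :=
  OmegaMod.linearMap_ext (by intro a x; simp)

lemma extDiff_units_smul {N M : Type u} [AddCommGroup N] [Module Λ N] [AddCommGroup M]
    [Module Λ M] (c : ℤˣ) (f : N →ₗ[E] M) : extDiff E (c • f) = c • extDiff E f := by
  refine OmegaMod.linearMap_ext (fun a x => ?_)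
  obtain rfl | rfl := Int.units_eq_one_or c
  · simp
  · simp; abel

variable (X : CochainComplex (ModuleCat.{u} Λ) ℤ)

/-- The left `E`-module `(Λ / E)^{⊗ p} ⊗_E Λ`. -/
def T (p : ℕ) : ModuleCat.{u} Λ := (OmegaPow E p).obj (ModuleCat.of Λ Λ)

/-- Right multiplication by `b` on `Λ`. -/
def rmul (b : Λ) : ModuleCat.of Λ Λ ⟶ ModuleCat.of Λ Λ :=
  ModuleCat.ofHom (LinearMap.toSpanSingleton Λ Λ b)

/-- Right multiplication by `b` on the last factor of `(Λ / E)^{⊗ p} ⊗_E Λ`. -/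
def rmulT (p : ℕ) (b : Λ) : T E p →ₗ[Λ] T E p := ((OmegaPow E p).map (rmul b)).hom

lemma rmulT_zero_apply (b x : Λ) : rmulT E 0 b (x : Λ) = (x * b : Λ) := rfl

lemma rmulT_one (p : ℕ) : rmulT E p (1 : Λ) = LinearMap.id := by
  have : rmul (1 : Λ) = 𝟙 _ := by ext; simp [rmul]
  simp [rmulT, this]
  rfl

lemma rmulT_mul (p : ℕ) (b c : Λ) : rmulT E p (b * c) = rmulT E p c ∘ₗ rmulT E p b := by
  have : rmul (b * c) = rmul b ≫ rmul c := by ext; simp [rmul]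
  simp [rmulT, this]
  rfl

lemma rmulT_add (p : ℕ) (b c : Λ) : rmulT E p (b + c) = rmulT E p b + rmulT E p c := by
  have : rmul (b + c) = rmul b + rmul c := by ext; simp [rmul]
  simp [rmulT, this, Functor.map_add]
  rfl

lemma rmulT_zero (p : ℕ) : rmulT E p (0 : Λ) = 0 := by
  have : rmul (0 : Λ) = 0 := by ext; simp [rmul]
  simp [rmulT, this]
  rfl

lemma rmulT_succ (p : ℕ) (b : Λ) : rmulT E (p + 1) b = OmegaMod.map (rmulT E p b) := rfl

variable {E} in
/-- The element `s a ⊗ w` of `(Λ / E)^{⊗ (p + 1)} ⊗_E Λ`. -/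
def T.cons {p : ℕ} (a : Λ) (w : T E p) : T E (p + 1) := form E a w

/-- `extDiff` on `(Λ / E)^{⊗ p} ⊗_E Λ`. -/
def extT {p : ℕ} {M : ModuleCat.{u} Λ} (f : T E p →ₗ[E] M) : T E (p + 1) →ₗ[E] M := extDiff E f

lemma extT_cons {p : ℕ} {M : ModuleCat.{u} Λ} (f : T E p →ₗ[E] M) (a : Λ) (w : T E p) :
    extT E f (T.cons a w) = a • f w - f (a • w) := extDiff_form E f a w

/-- The external differential in terms of elementary tensors. -/
lemma extT_word {p : ℕ} {M : ModuleCat.{u} Λ} (f : T E p →ₗ[E] M) (a : Fin (p + 1) → Λ)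
    (x : ModuleCat.of Λ Λ) :
    extT E f (word E a x) = a 0 • f (word E (Fin.tail a) x) -
      (∑ j : Fin p, (-1 : ℤ) ^ (j : ℕ) • f (word E (Fin.contractNth j.castSucc (· * ·) a) x) +
        (-1 : ℤ) ^ p • f (word E (Fin.init a) (a (Fin.last p) • x))) := by
  refine (extT_cons E f (a 0) (word E (Fin.tail a) x)).trans ?_
  have h := congrArg f (smul_word E a x)
  refine congrArg (a 0 • f (word E (Fin.tail a) x) - ·) (h.trans ?_)
  refine (map_add f _ _).trans ?_
  exact congrArg₂ (· + ·) ((map_sum f _ _).trans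
    (Finset.sum_congr rfl fun j _ => map_zsmul f _ _)) (map_zsmul f _ _)

lemma comp_extT {p : ℕ} {M M' : ModuleCat.{u} Λ} (g : M →ₗ[Λ] M') (f : T E p →ₗ[E] M) :
    g.restrictScalars E ∘ₗ extT E f = extT E (g.restrictScalars E ∘ₗ f) := comp_extDiff E g f

lemma extT_comp {p : ℕ} {M : ModuleCat.{u} Λ} (f : T E p →ₗ[E] M) (b : Λ) :
    extT E f ∘ₗ (rmulT E (p + 1) b).restrictScalars E =
      extT E (f ∘ₗ (rmulT E p b).restrictScalars E) := extDiff_comp E f (rmulT E p b)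

lemma extT_extT {p : ℕ} {M : ModuleCat.{u} Λ} (f : T E p →ₗ[E] M) : extT E (extT E f) = 0 :=
  extDiff_extDiff E f

lemma extT_add {p : ℕ} {M : ModuleCat.{u} Λ} (f g : T E p →ₗ[E] M) :
    extT E (f + g) = extT E f + extT E g := extDiff_add E f g

lemma extT_units_smul {p : ℕ} {M : ModuleCat.{u} Λ} (c : ℤˣ) (f : T E p →ₗ[E] M) :
    extT E (c • f) = c • extT E f := extDiff_units_smul E c f

lemma comp_units_smul {N M M' : Type u} [AddCommGroup N] [Module E N] [AddCommGroup M]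
    [Module E M] [AddCommGroup M'] [Module E M'] (c : ℤˣ) (g : N →ₗ[E] M) (g' : M →ₗ[E] M') :
    g' ∘ₗ (c • g) = c • (g' ∘ₗ g) := by
  obtain rfl | rfl := Int.units_eq_one_or c <;> ext <;> simp

lemma units_smul_comp {N M M' : Type u} [AddCommGroup N] [Module E N] [AddCommGroup M]
    [Module E M] [AddCommGroup M'] [Module E M'] (c : ℤˣ) (g : N →ₗ[E] M) (g' : M →ₗ[E] M') :
    (c • g') ∘ₗ g = c • (g' ∘ₗ g) := by
  obtain rfl | rfl := Int.units_eq_one_or c <;> ext <;> simp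

lemma d_comp_d_comp {i j k : ℤ} {N : Type u} [AddCommGroup N] [Module E N] (g : N →ₗ[E] X.X i) :
    (X.d j k).hom.restrictScalars E ∘ₗ (X.d i j).hom.restrictScalars E ∘ₗ g = 0 := by
  ext x
  exact DFunLike.congr_fun (congrArg ModuleCat.Hom.hom (X.d_comp_d i j k)) (g x)

/-- The degree `n` part of `𝒴(Λ, X)`, namely
`∏_p Hom_E((s Λ / E)^{⊗ p} ⊗_E Λ, X)` in degree `n`: since `(s Λ / E)^{⊗ p} ⊗_E Λ` sits in
degree `-p`, the factor of filtration-degree `p` is `Hom_E((Λ / E)^{⊗ p} ⊗_E Λ, X^m)` with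
`m + p = n`. -/
def YDeg (n : ℤ) : Type u :=
  ∀ i : {i : ℕ × ℤ // i.2 + i.1 = n}, T E i.1.1 →ₗ[E] X.X i.1.2

instance (n : ℤ) : AddCommGroup (YDeg E X n) :=
  inferInstanceAs (AddCommGroup (∀ i : {i : ℕ × ℤ // i.2 + i.1 = n}, T E i.1.1 →ₗ[E] X.X i.1.2))

variable {E X}

/-- The component of `f` of filtration-degree `p`, with values in `X^m`. -/
def YDeg.v {n : ℤ} (f : YDeg E X n) (p : ℕ) (m : ℤ) (hm : m + p = n) : T E p →ₗ[E] X.X m :=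
  f ⟨(p, m), hm⟩

/-- The element of `𝒴(Λ, X)^n` with prescribed components. -/
def YDeg.mk {n : ℤ} (f : ∀ (p : ℕ) (m : ℤ), m + p = n → (T E p →ₗ[E] X.X m)) : YDeg E X n :=
  fun i => f i.1.1 i.1.2 i.2

@[simp] lemma YDeg.mk_v {n : ℤ} (f : ∀ (p : ℕ) (m : ℤ), m + p = n → (T E p →ₗ[E] X.X m)) (p m hm) :
    (YDeg.mk f).v p m hm = f p m hm := rfl

@[ext] lemma YDeg.ext {n : ℤ} {f g : YDeg E X n} (h : ∀ p m hm, f.v p m hm = g.v p m hm) :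
    f = g :=
  funext fun i => h i.1.1 i.1.2 i.2

@[simp] lemma YDeg.add_v {n : ℤ} (f g : YDeg E X n) (p m hm) :
    (f + g).v p m hm = f.v p m hm + g.v p m hm := rfl

@[simp] lemma YDeg.zero_v {n : ℤ} (p m hm) : (0 : YDeg E X n).v p m hm = 0 := rfl

/-- The left `Λ`-action on `𝒴(Λ, X)` coming from the right `Λ`-action on `Λ`. -/
instance (n : ℤ) : Module Λ (YDeg E X n) where
  smul b f := YDeg.mk fun p m hm => f.v p m hm ∘ₗ (rmulT E p b).restrictScalars E
  one_smul f := by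
    ext p m hm x
    change f.v p m hm (rmulT E p 1 x) = _
    rw [rmulT_one]; rfl
  mul_smul b c f := by
    ext p m hm x
    change f.v p m hm (rmulT E p (b * c) x) = f.v p m hm (rmulT E p c (rmulT E p b x))
    rw [rmulT_mul]; rfl
  smul_zero b := rfl
  smul_add b f g := rfl
  add_smul b c f := by
    ext p m hm x
    change f.v p m hm (rmulT E p (b + c) x) =
      f.v p m hm (rmulT E p b x) + f.v p m hm (rmulT E p c x)
    rw [rmulT_add, ← map_add]; rfl
  zero_smul f := by
    ext p m hm x
    change f.v p m hm (rmulT E p 0 x) = 0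
    rw [rmulT_zero]; exact map_zero _

@[simp] lemma YDeg.smul_v {n : ℤ} (b : Λ) (f : YDeg E X n) (p m hm) :
    (b • f).v p m hm = f.v p m hm ∘ₗ (rmulT E p b).restrictScalars E := rfl

/-- The external part of the differential on `𝒴(Λ, X)`, with values in degree `n + 1`:
`δ_ex(f)(s a ⊗ w) = (-1)^{n+1} (a f(w) - f(a ▸ w))`. -/
def YDeg.dEx {n : ℤ} (f : YDeg E X n) : ∀ (p : ℕ) (m : ℤ), m + p = n + 1 → (T E p →ₗ[E] X.X m)
  | 0, _, _ => 0
  | p + 1, m, hm => (n + 1).negOnePow • extT E (f.v p m (by push_cast at hm; lia))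

/-- The internal part `f ↦ d_X ∘ f` of the differential on `𝒴(Λ, X)`. The differential of the
stalk complex `Λ` vanishes. -/
def YDeg.dIn {n : ℤ} (f : YDeg E X n) (p : ℕ) (m : ℤ) (hm : m + p = n + 1) : T E p →ₗ[E] X.X m :=
  (X.d (m - 1) m).hom.restrictScalars E ∘ₗ f.v p (m - 1) (by lia)

lemma YDeg.dIn_eq {n : ℤ} (f : YDeg E X n) (p : ℕ) (m : ℤ) (hm : m + p = n + 1) (k : ℤ)
    (hk : k + p = n) : f.dIn p m hm = (X.d k m).hom.restrictScalars E ∘ₗ f.v p k hk := by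
  obtain rfl : k = m - 1 := by lia
  rfl

lemma YDeg.dEx_zero {n : ℤ} (f : YDeg E X n) (m hm) : f.dEx 0 m hm = 0 := rfl

lemma YDeg.dEx_succ {n : ℤ} (f : YDeg E X n) (p : ℕ) (m hm) (hm' : m + p = n) :
    f.dEx (p + 1) m hm = (n + 1).negOnePow • extT E (f.v p m hm') := rfl

/-- The differential `δ = δ_in + δ_ex` of `𝒴(Λ, X)`. -/
def yonedaD (n : ℤ) : YDeg E X n →ₗ[Λ] YDeg E X (n + 1) where
  toFun f := YDeg.mk fun p m hm => f.dIn p m hm + f.dEx p m hm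
  map_add' f g := by
    refine YDeg.ext fun p m hm => ?_
    cases p with
    | zero => simp [YDeg.dIn, YDeg.dEx, LinearMap.comp_add]
    | succ p =>
      simp [YDeg.dIn, YDeg.dEx, extT_add, LinearMap.comp_add]; abel
  map_smul' b f := by
    refine YDeg.ext fun p m hm => ?_
    cases p with
    | zero => rfl
    | succ p =>
      simp only [RingHom.id_apply, YDeg.smul_v, LinearMap.add_comp, YDeg.mk_v]
      congr 1
      simp only [YDeg.dEx, YDeg.smul_v, units_smul_comp, extT_comp]

@[simp] lemma yonedaD_v {n : ℤ} (f : YDeg E X n) (p m hm) :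
    (yonedaD n f).v p m hm = f.dIn p m hm + f.dEx p m hm := rfl

lemma yonedaD_yonedaD {n : ℤ} (f : YDeg E X n) : yonedaD (n + 1) (yonedaD n f) = 0 := by
  refine YDeg.ext fun p m hm => ?_
  rw [YDeg.zero_v, yonedaD_v]
  cases p with
  | zero => simp only [YDeg.dIn, YDeg.dEx, yonedaD_v, add_zero, d_comp_d_comp]
  | succ p =>
    cases p with
    | zero =>
      simp only [YDeg.dIn, YDeg.dEx, yonedaD_v, LinearMap.comp_add, d_comp_d_comp, zero_add,
        add_zero, comp_units_smul, comp_extT]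
      rw [Int.negOnePow_succ (n + 1), Units.neg_smul, add_neg_cancel]
    | succ p =>
      simp only [YDeg.dIn, YDeg.dEx, yonedaD_v, LinearMap.comp_add, d_comp_d_comp, zero_add,
        comp_units_smul, extT_add, comp_extT, extT_units_smul, extT_extT, smul_zero, add_zero]
      rw [Int.negOnePow_succ (n + 1), Units.neg_smul, add_neg_cancel]

variable (E X)

/-- The complex `𝒴(Λ, X)` of left `Λ`-modules. -/
def yonedaObj : CochainComplex (ModuleCat.{u} Λ) ℤ :=
  CochainComplex.of (fun n => ModuleCat.of Λ (YDeg E X n)) (fun n => ModuleCat.ofHom (yonedaD n))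
    (fun n => by ext1; ext1 f; exact yonedaD_yonedaD f)

lemma yonedaObj_d (n : ℤ) : (yonedaObj E X).d n (n + 1) = ModuleCat.ofHom (yonedaD n) :=
  CochainComplex.of_d (fun n => ModuleCat.of Λ (YDeg E X n))
    (fun n => ModuleCat.ofHom (yonedaD n)) n

variable {X} {X' : CochainComplex (ModuleCat.{u} Λ) ℤ}

/-- Postcomposition with a cochain map on `𝒴(Λ, -)^n`. -/
def yonedaMapDeg (g : X ⟶ X') (n : ℤ) : YDeg E X n →ₗ[Λ] YDeg E X' n where
  toFun f := YDeg.mk fun p m hm => (g.f m).hom.restrictScalars E ∘ₗ f.v p m hm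
  map_add' f f' := by
    refine YDeg.ext fun p m hm => ?_
    simp [LinearMap.comp_add]
  map_smul' b f := rfl

@[simp] lemma yonedaMapDeg_v (g : X ⟶ X') (n : ℤ) (f : YDeg E X n) (p m hm) :
    (yonedaMapDeg E g n f).v p m hm = (g.f m).hom.restrictScalars E ∘ₗ f.v p m hm := rfl

lemma yonedaMapDeg_d (g : X ⟶ X') (n : ℤ) (f : YDeg E X n) :
    yonedaD n (yonedaMapDeg E g n f) = yonedaMapDeg E g (n + 1) (yonedaD n f) := by
  refine YDeg.ext fun p m hm => ?_
  have h : (X'.d (m - 1) m).hom ∘ₗ (g.f (m - 1)).hom = (g.f m).hom ∘ₗ (X.d (m - 1) m).hom :=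
    congrArg ModuleCat.Hom.hom (g.comm (m - 1) m)
  rw [yonedaD_v, yonedaMapDeg_v, yonedaD_v, LinearMap.comp_add]
  congr 1
  · ext x
    exact DFunLike.congr_fun h _
  · cases p with
    | zero => exact (LinearMap.comp_zero _).symm
    | succ p => simp only [YDeg.dEx, yonedaMapDeg_v, comp_units_smul, comp_extT]

/-- The functor `𝒴(Λ, -)` from complexes of left `Λ`-modules to complexes of left `Λ`-modules. -/
def yonedaFun : CochainComplex (ModuleCat.{u} Λ) ℤ ⥤ CochainComplex (ModuleCat.{u} Λ) ℤ where
  obj X := yonedaObj E X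
  map g := CochainComplex.ofHom (fun n => ModuleCat.ofHom (yonedaMapDeg E g n))
    (fun n => by rw [yonedaObj_d, yonedaObj_d]; ext1; ext1 f; exact yonedaMapDeg_d E g n f)
  map_id X := by
    ext n f
    rfl
  map_comp g g' := by
    ext n f
    rfl

/-! ### The singular Yoneda complex `𝒮𝒴(Λ, X)` -/

variable (X)

/-- The complex `Ω_nc(X) = s(Λ / E) ⊗_E X`, with `s a ⊗ x` in degree `|x| - 1`, with
differential `s a ⊗ x ↦ - s a ⊗ d x`. -/
def omegaCx : CochainComplex (ModuleCat.{u} Λ) ℤ where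
  X n := (Omega E).obj (X.X (n + 1))
  d i j := -(Omega E).map (X.d (i + 1) (j + 1))
  shape i j h := by
    rw [X.shape _ _ (by simpa using h), Functor.map_zero, neg_zero]
  d_comp_d' i j k _ _ := by
    rw [Preadditive.neg_comp_neg, ← Functor.map_comp, X.d_comp_d, Functor.map_zero]

/-- The iterates `Ω_nc^p(X)`. -/
def omegaCxPow : ℕ → CochainComplex (ModuleCat.{u} Λ) ℤ
  | 0 => X
  | p + 1 => omegaCx E (omegaCxPow p)

/-- The map `s a ⊗ w ↦ s a ⊗ f(w)`. -/
def thetaT {p : ℕ} {M : ModuleCat.{u} Λ} (f : T E p →ₗ[E] M) :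
    T E (p + 1) →ₗ[E] (Omega E).obj M := OmegaMod.mapE f

lemma thetaT_cons {p : ℕ} {M : ModuleCat.{u} Λ} (f : T E p →ₗ[E] M) (a : Λ) (w : T E p) :
    thetaT E f (T.cons a w) = form E a (f w) := OmegaMod.mapE_form f a w

lemma T.hom_ext {p : ℕ} {M : ModuleCat.{u} Λ} {f g : T E (p + 1) →ₗ[E] M}
    (h : ∀ a w, f (T.cons a w) = g (T.cons a w)) : f = g := OmegaMod.linearMap_ext h

lemma comp_thetaT {p : ℕ} {M M' : ModuleCat.{u} Λ} (g : M ⟶ M') (f : T E p →ₗ[E] M) :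
    (-(Omega E).map g).hom.restrictScalars E ∘ₗ thetaT E f =
      -thetaT E (g.hom.restrictScalars E ∘ₗ f) := by
  refine T.hom_ext E fun a w => ?_
  change -(OmegaMod.map g.hom (thetaT E f (T.cons a w))) = -(thetaT E _ (T.cons a w))
  rw [thetaT_cons, thetaT_cons, OmegaMod.map_form]
  rfl

lemma thetaT_comp {p : ℕ} {M : ModuleCat.{u} Λ} (f : T E p →ₗ[E] M) (b : Λ) :
    thetaT E f ∘ₗ (rmulT E (p + 1) b).restrictScalars E =
      thetaT E (f ∘ₗ (rmulT E p b).restrictScalars E) := by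
  refine T.hom_ext E fun a w => ?_
  have h : rmulT E (p + 1) b (T.cons a w) = T.cons a (rmulT E p b w) :=
    OmegaMod.map_form (rmulT E p b) a w
  change thetaT E f (rmulT E (p + 1) b (T.cons a w)) = _
  rw [h, thetaT_cons, thetaT_cons]
  rfl

lemma extT_thetaT {p : ℕ} {M : ModuleCat.{u} Λ} (f : T E p →ₗ[E] M) :
    extT E (thetaT E f) = -thetaT E (extT E f) := extDiff_mapE E f

lemma thetaT_add {p : ℕ} {M : ModuleCat.{u} Λ} (f g : T E p →ₗ[E] M) :
    thetaT E (f + g) = thetaT E f + thetaT E g := by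
  refine T.hom_ext E fun a w => ?_
  rw [LinearMap.add_apply, thetaT_cons, thetaT_cons, thetaT_cons]
  exact form_add _ _ _ _

lemma thetaT_units_smul {p : ℕ} {M : ModuleCat.{u} Λ} (c : ℤˣ) (f : T E p →ₗ[E] M) :
    thetaT E (c • f) = c • thetaT E f := by
  obtain rfl | rfl := Int.units_eq_one_or c
  · simp
  · refine T.hom_ext E fun a w => ?_
    rw [Units.neg_smul, one_smul, Units.neg_smul, one_smul, LinearMap.neg_apply, thetaT_cons,
      thetaT_cons]
    exact form_neg _ _ _

variable {X}

/-- The map `s a ⊗ w ↦ s a ⊗ f(w)` with values in `Ω_nc(X)`. -/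
def thetaX {p : ℕ} {m : ℤ} (f : T E p →ₗ[E] X.X (m + 1)) :
    T E (p + 1) →ₗ[E] (omegaCx E X).X m := thetaT E f

lemma thetaX_cons {p : ℕ} {m : ℤ} (f : T E p →ₗ[E] X.X (m + 1)) (a : Λ) (w : T E p) :
    thetaX E f (T.cons a w) = form E a (f w) := thetaT_cons E f a w

lemma d_comp_thetaX {p : ℕ} {m m' : ℤ} (f : T E p →ₗ[E] X.X (m + 1)) :
    ((omegaCx E X).d m m').hom.restrictScalars E ∘ₗ thetaX E f =
      -thetaX E ((X.d (m + 1) (m' + 1)).hom.restrictScalars E ∘ₗ f) := comp_thetaT E _ f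

lemma thetaX_comp {p : ℕ} {m : ℤ} (f : T E p →ₗ[E] X.X (m + 1)) (b : Λ) :
    thetaX E f ∘ₗ (rmulT E (p + 1) b).restrictScalars E =
      thetaX E (f ∘ₗ (rmulT E p b).restrictScalars E) := thetaT_comp E f b

lemma extT_thetaX {p : ℕ} {m : ℤ} (f : T E p →ₗ[E] X.X (m + 1)) :
    extT E (thetaX E f) = -thetaX E (extT E f) := extT_thetaT E f

lemma thetaX_add {p : ℕ} {m : ℤ} (f g : T E p →ₗ[E] X.X (m + 1)) :
    thetaX E (f + g) = thetaX E f + thetaX E g := thetaT_add E f g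

lemma thetaX_units_smul {p : ℕ} {m : ℤ} (c : ℤˣ) (f : T E p →ₗ[E] X.X (m + 1)) :
    thetaX E (c • f) = c • thetaX E f := thetaT_units_smul E c f

lemma thetaX_zero {p : ℕ} {m : ℤ} : thetaX E (0 : T E p →ₗ[E] X.X (m + 1)) = 0 := by
  simpa using thetaX_add E (0 : T E p →ₗ[E] X.X (m + 1)) 0

lemma extT_zero {p : ℕ} {M : ModuleCat.{u} Λ} : extT E (0 : T E p →ₗ[E] M) = 0 :=
  extDiff_zero E

/-- The components of `θ_X ⊙ f` in `𝒴(Λ, Ω_nc(X))`: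
`(θ_X ⊙ f)(s a ⊗ w) = (-1)^{|f|} s a ⊗ f(w)`. -/
def thetaV {n : ℤ} (f : YDeg E X n) :
    ∀ (p : ℕ) (m : ℤ), m + p = n → (T E p →ₗ[E] (omegaCx E X).X m)
  | 0, _, _ => 0
  | p + 1, m, hm => n.negOnePow • thetaX E (f.v p (m + 1) (by push_cast at hm; lia))

/-- The map `f ↦ θ_X ⊙ f` in degree `n`. -/
def thetaDeg (n : ℤ) : YDeg E X n →ₗ[Λ] YDeg E (omegaCx E X) n where
  toFun f := YDeg.mk (thetaV E f)
  map_add' f g := by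
    refine YDeg.ext fun p m hm => ?_
    cases p with
    | zero => exact (add_zero _).symm
    | succ p => simp only [YDeg.mk_v, YDeg.add_v, thetaV, thetaX_add, smul_add]
  map_smul' b f := by
    refine YDeg.ext fun p m hm => ?_
    cases p with
    | zero => rfl
    | succ p =>
      simp only [YDeg.mk_v, YDeg.smul_v, thetaV, RingHom.id_apply, units_smul_comp, thetaX_comp]

@[simp] lemma thetaDeg_v {n : ℤ} (f : YDeg E X n) (p m hm) :
    (thetaDeg E n f).v p m hm = thetaV E f p m hm := rfl

lemma thetaDeg_d (n : ℤ) (f : YDeg E X n) :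
    yonedaD n (thetaDeg E n f) = thetaDeg E (n + 1) (yonedaD n f) := by
  refine YDeg.ext fun p m hm => ?_
  rw [yonedaD_v, thetaDeg_v]
  cases p with
  | zero =>
    simp only [YDeg.dIn, YDeg.dEx, thetaDeg_v, thetaV, LinearMap.comp_zero, add_zero]
  | succ p =>
    have hm' : m - 1 + 1 + p = n := by push_cast at hm; lia
    have h1 : (thetaDeg E n f).dIn (p + 1) m hm =
        -(n.negOnePow • thetaX E (f.dIn p (m + 1) (by push_cast at hm; lia))) := by
      rw [YDeg.dIn_eq f p (m + 1) _ (m - 1 + 1) hm', YDeg.dIn, thetaDeg_v, thetaV, comp_units_smul,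
        d_comp_thetaX, smul_neg]
    rw [h1]
    simp only [thetaV, yonedaD_v, thetaX_add, smul_add, Int.negOnePow_succ n, Units.neg_smul]
    congr 1
    cases p with
    | zero =>
      simp only [YDeg.dEx, thetaDeg_v, thetaV, extT_zero, thetaX_zero, smul_zero, neg_zero]
    | succ p =>
      simp only [YDeg.dEx, thetaDeg_v, thetaV, extT_units_smul, extT_thetaX, thetaX_units_smul,
        smul_neg]
      rw [Int.negOnePow_succ, Units.neg_smul, Units.neg_smul, smul_neg, neg_neg]

variable (X)

/-- The cochain map `𝒴(Λ, X) ⟶ 𝒴(Λ, Ω_nc(X))`, `f ↦ θ_X ⊙ f`. -/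
def theta : (yonedaFun E).obj X ⟶ (yonedaFun E).obj (omegaCx E X) :=
  CochainComplex.ofHom (fun n => ModuleCat.ofHom (thetaDeg E n))
    (fun n => by
      erw [yonedaObj_d, yonedaObj_d]; ext1; ext1 f; exact thetaDeg_d E n f)

/-- The sequence `𝒴(Λ, X) ⟶ 𝒴(Λ, Ω_nc(X)) ⟶ 𝒴(Λ, Ω_nc^2(X)) ⟶ ⋯`. -/
def singularSeq : ℕ ⥤ CochainComplex (ModuleCat.{u} Λ) ℤ :=
  Functor.ofSequence (X := fun p => (yonedaFun E).obj (omegaCxPow E X p))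
    (fun p => theta E (omegaCxPow E X p))

/-- The complex `𝒮𝒴(Λ, X)` of left `Λ`-modules. -/
def singularYoneda : CochainComplex (ModuleCat.{u} Λ) ℤ := colimit (singularSeq E X)

/-- The canonical map `𝒴(Λ, X) ⟶ 𝒮𝒴(Λ, X)`, `f ↦ [f; 0]`. -/
def toSingular : (yonedaFun E).obj X ⟶ singularYoneda E X := colimit.ι (singularSeq E X) 0

end Yoneda

/-! ### The relative bar resolution and its truncations -/

section Ind

variable (M : Type u) [AddCommGroup M] [Module Λ M]

/-- The left `Λ`-module `Λ ⊗_E M`. -/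
def IndMod : Type u := NTensor E Λ M

instance : AddCommGroup (IndMod E M) := inferInstanceAs (AddCommGroup (NTensor E Λ M))

variable {M}

/-- The element `a ⊗ x`. -/
def ind (a : Λ) (x : M) : IndMod E M := NTensor.tmul E a x

/-- `ind` as a biadditive map. -/
def indHom : Λ →+ M →+ IndMod E M := NTensor.mk (R := E)

@[simp] lemma indHom_apply (a : Λ) (x : M) : indHom E a x = ind E a x := rfl

lemma ind_add_left (a b : Λ) (x : M) : ind E (a + b) x = ind E a x + ind E b x :=
  NTensor.add_tmul _ _ _

lemma ind_add (a : Λ) (x y : M) : ind E a (x + y) = ind E a x + ind E a y :=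
  NTensor.tmul_add _ _ _

lemma ind_sub (a : Λ) (x y : M) : ind E a (x - y) = ind E a x - ind E a y :=
  NTensor.tmul_sub _ _ _

lemma ind_zero (a : Λ) : ind E a (0 : M) = 0 := NTensor.tmul_zero _

lemma zero_ind (x : M) : ind E (0 : Λ) x = 0 := NTensor.zero_tmul _

lemma ind_mul (a : Λ) (e : E) (x : M) : ind E (a * e) x = ind E a ((e : Λ) • x) :=
  NTensor.smul_tmul _ _ _

variable {E}

@[elab_as_elim]
lemma IndMod.induction_on {P : IndMod E M → Prop} (t : IndMod E M)
    (h0 : P 0) (ht : ∀ a x, P (ind E a x)) (ha : ∀ s t, P s → P t → P (s + t)) : P t :=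
  NTensor.induction_on t h0 ht ha

/-- Additive maps out of `Λ ⊗_E M`. -/
def IndMod.lift {P : Type u} [AddCommGroup P] (f : Λ →+ M →+ P)
    (hf : ∀ a (e : E) x, f (a * e) x = f a ((e : Λ) • x)) : IndMod E M →+ P :=
  NTensor.lift f hf

@[simp] lemma IndMod.lift_ind {P : Type u} [AddCommGroup P] (f : Λ →+ M →+ P)
    (hf : ∀ a (e : E) x, f (a * e) x = f a ((e : Λ) • x)) (a : Λ) (x : M) :
    IndMod.lift f hf (ind E a x) = f a x := NTensor.lift_tmul _ _ _ _

/-- Left multiplication by `b` on `Λ ⊗_E M`. -/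
def IndMod.act (b : Λ) : IndMod E M →+ IndMod E M :=
  IndMod.lift ((indHom E).comp (AddMonoidHom.mulLeft b))
    (by intro a e x; simp [← mul_assoc, ind_mul])

lemma IndMod.act_ind (b a : Λ) (x : M) : IndMod.act b (ind E a x) = ind E (b * a) x :=
  IndMod.lift_ind _ _ _ _

instance : Module Λ (IndMod E M) where
  smul b := IndMod.act b
  one_smul t := by
    change IndMod.act 1 t = t
    induction t using IndMod.induction_on with
    | h0 => simp
    | ht a x => simp [IndMod.act_ind]
    | ha s t hs ht => simp [hs, ht]
  mul_smul b c t := by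
    change IndMod.act (b * c) t = IndMod.act b (IndMod.act c t)
    induction t using IndMod.induction_on with
    | h0 => simp
    | ht a x => simp [IndMod.act_ind, mul_assoc]
    | ha s t hs ht => simp [hs, ht]
  smul_zero b := map_zero (IndMod.act b)
  smul_add b := map_add (IndMod.act b)
  add_smul b c t := by
    change IndMod.act (b + c) t = IndMod.act b t + IndMod.act c t
    induction t using IndMod.induction_on with
    | h0 => simp
    | ht a x => simp [IndMod.act_ind, add_mul, ind_add_left]
    | ha s t hs ht => simp [hs, ht]; abel
  zero_smul t := by
    change IndMod.act 0 t = 0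
    induction t using IndMod.induction_on with
    | h0 => simp
    | ht a x => simp [IndMod.act_ind, zero_ind]
    | ha s t hs ht => simp [hs, ht]

lemma smul_ind (b a : Λ) (x : M) : b • ind E a x = ind E (b * a) x := IndMod.act_ind b a x

/-- `Λ`-linear maps out of `Λ ⊗_E M`. -/
def IndMod.liftL {P : Type u} [AddCommGroup P] [Module Λ P] (f : Λ →+ M →+ P)
    (hf : ∀ a (e : E) x, f (a * e) x = f a ((e : Λ) • x))
    (hl : ∀ b a x, f (b * a) x = b • f a x) : IndMod E M →ₗ[Λ] P where
  toFun := IndMod.lift f hf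
  map_add' := map_add _
  map_smul' b t := by
    simp only [RingHom.id_apply]
    induction t using IndMod.induction_on with
    | h0 => simp
    | ht a x => simp [smul_ind, hl]
    | ha s t hs ht => rw [smul_add, map_add, map_add, hs, ht, smul_add]

@[simp] lemma IndMod.liftL_ind {P : Type u} [AddCommGroup P] [Module Λ P] (f : Λ →+ M →+ P)
    (hf : ∀ a (e : E) x, f (a * e) x = f a ((e : Λ) • x))
    (hl : ∀ b a x, f (b * a) x = b • f a x) (a : Λ) (x : M) :
    IndMod.liftL f hf hl (ind E a x) = f a x := IndMod.lift_ind f hf a x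

lemma IndMod.linearMap_ext {P : Type*} [AddCommGroup P] [Module Λ P] {f g : IndMod E M →ₗ[Λ] P}
    (h : ∀ a x, f (ind E a x) = g (ind E a x)) : f = g := by
  ext t
  induction t using IndMod.induction_on with
  | h0 => simp
  | ht a x => exact h a x
  | ha s t hs ht => simp [hs, ht]

variable {N : Type u} [AddCommGroup N] [Module Λ N]

/-- The map `Λ ⊗ g`. -/
def IndMod.map (g : M →ₗ[Λ] N) : IndMod E M →ₗ[Λ] IndMod E N :=
  IndMod.liftL ((AddMonoidHom.compHom' g.toAddMonoidHom).comp (indHom E))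
    (by intro a e x; simp [ind_mul]) (by intro b a x; simp [smul_ind])

@[simp] lemma IndMod.map_ind (g : M →ₗ[Λ] N) (a : Λ) (x : M) :
    IndMod.map g (ind E a x) = ind E a (g x) := by simp [IndMod.map]

/-- The map `a ⊗ x ↦ a x`. -/
def IndMod.eps : IndMod E M →ₗ[Λ] M :=
  IndMod.liftL (AddMonoidHom.mk' (fun a => DistribSMul.toAddMonoidHom M a)
      (fun a b => by ext x; simp [add_smul]))
    (by intro a e x; simp [mul_smul]) (by intro b a x; simp [mul_smul])

@[simp] lemma IndMod.eps_ind (a : Λ) (x : M) : IndMod.eps (ind E a x) = a • x := by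
  simp [IndMod.eps]

/-- The map `s b ⊗ w ↦ a b ⊗ w - a ⊗ b w`, for fixed `a`. -/
def IndMod.extAux (a : Λ) : OmegaMod E M →+ IndMod E M :=
  OmegaMod.lift
    ((indHom E).comp (AddMonoidHom.mulLeft a) -
      AddMonoidHom.mk' (fun b => (indHom E a).comp (DistribSMul.toAddMonoidHom M b))
        (fun b b' => by ext x; simp [add_smul, ind_add]))
    (by intro e x; simp [ind_mul])
    (by intro b e x; simp [← mul_assoc, ind_mul, mul_smul])

lemma IndMod.extAux_form (a b : Λ) (x : M) :
    IndMod.extAux a (form E b x) = ind E (a * b) x - ind E a (b • x) := by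
  simp [IndMod.extAux]

/-- The external differential of the bar resolution,
`a ⊗ (s b ⊗ w) ↦ a b ⊗ w - a ⊗ (b ▸ w)`. -/
def IndMod.ext : IndMod E (OmegaMod E M) →ₗ[Λ] IndMod E M :=
  IndMod.liftL (AddMonoidHom.mk' IndMod.extAux (fun a a' => OmegaMod.hom_ext (by
      intro b x; simp [IndMod.extAux_form, add_mul, ind_add_left]; abel)))
    (by
      intro a e t
      have h (s : OmegaMod E M) :
          IndMod.extAux (a * e) s = IndMod.extAux a ((e : Λ) • s) := by
        induction s using OmegaMod.induction_on with
        | h0 => simp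
        | ht b x =>
          simp [IndMod.extAux_form, smul_form, form_coe, mul_assoc, ind_mul, mul_smul]
        | ha s t hs ht => rw [map_add, smul_add, map_add, hs, ht]
      exact h t)
    (by
      intro b a t
      have h (s : OmegaMod E M) : IndMod.extAux (b * a) s = b • IndMod.extAux a s := by
        induction s using OmegaMod.induction_on with
        | h0 => simp
        | ht c x => simp [IndMod.extAux_form, smul_ind, smul_sub, mul_assoc]
        | ha s t hs ht => rw [map_add, map_add, smul_add, hs, ht]
      exact h t)

lemma IndMod.ext_ind (a b : Λ) (x : M) :
    IndMod.ext (ind E a (form E b x)) = ind E (a * b) x - ind E a (b • x) :=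
  (IndMod.liftL_ind _ _ _ _ _).trans (IndMod.extAux_form a b x)

lemma IndMod.linearMap_ext₂ {P : Type*} [AddCommGroup P] [Module Λ P]
    {f g : IndMod E (OmegaMod E M) →ₗ[Λ] P}
    (h : ∀ a b x, f (ind E a (form E b x)) = g (ind E a (form E b x))) : f = g := by
  refine IndMod.linearMap_ext fun a t => ?_
  induction t using OmegaMod.induction_on with
  | h0 => simp [ind_zero]
  | ht b x => exact h a b x
  | ha s t hs ht => rw [ind_add, map_add, map_add, hs, ht]

lemma IndMod.ext_ext : IndMod.ext ∘ₗ IndMod.ext (E := E) (M := OmegaMod E M) = 0 := by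
  refine IndMod.linearMap_ext₂ fun a b t => ?_
  induction t using OmegaMod.induction_on with
  | h0 =>
    have h : form E b (0 : OmegaMod E M) = 0 := map_zero (formHom E b)
    simp [h, ind_zero]
  | ht c x =>
    simp [IndMod.ext_ind, smul_form, ind_sub, mul_assoc, mul_smul]
  | ha s t hs ht => rw [form_add, ind_add, map_add, map_add, hs, ht]

lemma IndMod.eps_ext : IndMod.eps ∘ₗ IndMod.ext (E := E) (M := M) = 0 :=
  IndMod.linearMap_ext₂ fun a b x => by simp [IndMod.ext_ind, mul_smul]

lemma IndMod.eps_map (g : M →ₗ[Λ] N) :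
    IndMod.eps ∘ₗ IndMod.map g = g ∘ₗ IndMod.eps (E := E) :=
  IndMod.linearMap_ext fun a x => by simp

lemma IndMod.ext_map (g : M →ₗ[Λ] N) :
    IndMod.ext ∘ₗ IndMod.map (OmegaMod.map g) = IndMod.map g ∘ₗ IndMod.ext (E := E) :=
  IndMod.linearMap_ext₂ fun a b x => by simp [IndMod.ext_ind]

end Ind

/-- The functor `M ↦ Λ ⊗_E M` on left `Λ`-modules. -/
def Ind : ModuleCat.{u} Λ ⥤ ModuleCat.{u} Λ where
  obj M := ModuleCat.of Λ (IndMod E M)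
  map g := ModuleCat.ofHom (IndMod.map g.hom)
  map_id M := by
    ext1
    exact IndMod.linearMap_ext (by intro a x; simp)
  map_comp f g := by
    ext1
    exact IndMod.linearMap_ext (by intro a x; simp)

instance : (Ind E).Additive where
  map_add {M N f g} := by
    ext1
    refine IndMod.linearMap_ext (fun a x => ?_)
    change IndMod.map (f + g).hom (ind E a x) =
      IndMod.map f.hom (ind E a x) + IndMod.map g.hom (ind E a x)
    simp [ind_add]

/-- `(BarPow E q).obj M` is `Λ ⊗_E (Λ / E)^{⊗ q} ⊗_E M`, which is canonically
`(Λ ⊗_E (Λ / E)^{⊗ q} ⊗_E Λ) ⊗_Λ M`. -/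
def BarPow (q : ℕ) : ModuleCat.{u} Λ ⥤ ModuleCat.{u} Λ := OmegaPow E q ⋙ Ind E

instance (q : ℕ) : (BarPow E q).Additive := inferInstanceAs (OmegaPow E q ⋙ Ind E).Additive

/-- The external differential `d_ex ⊗_Λ M`. -/
def barExt (q : ℕ) : BarPow E (q + 1) ⟶ BarPow E q where
  app M := ModuleCat.ofHom (IndMod.ext (E := E) (M := (OmegaPow E q).obj M))
  naturality M N g := by
    ext1
    exact IndMod.ext_map ((OmegaPow E q).map g).hom

/-- The external differential in terms of elementary tensors. -/
lemma barExt_word {q : ℕ} {M : ModuleCat.{u} Λ} (b : Λ) (a : Fin (q + 1) → Λ) (x : M) :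
    ((barExt E q).app M).hom (ind E b (word E a x)) =
      (ind E (b * a 0) (word E (Fin.tail a) x) -
        (∑ j : Fin q,
            (-1 : ℤ) ^ (j : ℕ) • ind E b (word E (Fin.contractNth j.castSucc (· * ·) a) x) +
          (-1 : ℤ) ^ q • ind E b (word E (Fin.init a) (a (Fin.last q) • x))) : IndMod E _) := by
  refine (IndMod.ext_ind b (a 0) (word E (Fin.tail a) x)).trans ?_
  have h := congrArg (indHom E b) (smul_word E a x)
  refine congrArg (ind E (b * a 0) (word E (Fin.tail a) x) - ·) (h.trans ?_)
  rw [map_add, map_sum]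
  simp only [map_zsmul, indHom_apply]

lemma barExt_comp (q : ℕ) (M : ModuleCat.{u} Λ) :
    (barExt E (q + 1)).app M ≫ (barExt E q).app M = 0 := by
  ext1
  exact IndMod.ext_ext

/-- The multiplication map `Λ ⊗_E M ⟶ M`. -/
def barMul : BarPow E 0 ⟶ 𝟭 (ModuleCat.{u} Λ) where
  app M := ModuleCat.ofHom (IndMod.eps (E := E) (M := M))
  naturality M N g := by
    ext1
    exact IndMod.eps_map g.hom

lemma barExt_barMul (M : ModuleCat.{u} Λ) : (barExt E 0).app M ≫ (barMul E).app M = 0 := by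
  ext1
  exact IndMod.eps_ext

section Bar

open scoped DirectSum

variable (X : CochainComplex (ModuleCat.{u} Λ) ℤ) (P : ℕ∞)

/-- The degree `n` part of `𝔹_{≤ P} ⊗_Λ X`, namely
`⨁_{q ≤ P} Λ ⊗_E (s Λ / E)^{⊗ q} ⊗_E X` in degree `n`: since `(s Λ / E)^{⊗ q}` sits in
degree `-q`, the summand indexed by `q` is `Λ ⊗_E (Λ / E)^{⊗ q} ⊗_E X^m` with `m = n + q`. -/
def BarDeg (n : ℤ) : ModuleCat.{u} Λ :=
  ModuleCat.of Λ (⨁ i : {i : ℕ × ℤ // n + i.1 = i.2 ∧ (i.1 : ℕ∞) ≤ P},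
    (BarPow E i.1.1).obj (X.X i.1.2))

variable {X P}

/-- The inclusion of the summand `Λ ⊗_E (Λ / E)^{⊗ q} ⊗_E X^m`. -/
def barIn {n : ℤ} (q : ℕ) (m : ℤ) (h : n + q = m) (hq : (q : ℕ∞) ≤ P) :
    (BarPow E q).obj (X.X m) ⟶ BarDeg E X P n :=
  ModuleCat.ofHom (DirectSum.lof Λ {i : ℕ × ℤ // n + i.1 = i.2 ∧ (i.1 : ℕ∞) ≤ P}
    (fun i => (BarPow E i.1.1).obj (X.X i.1.2)) ⟨(q, m), h, hq⟩)

/-- The morphism out of `(𝔹_{≤ P} ⊗_Λ X)^n` given by its restrictions to the summands. -/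
def barDesc {n : ℤ} {M : ModuleCat.{u} Λ}
    (f : ∀ (q : ℕ) (m : ℤ), n + q = m → (q : ℕ∞) ≤ P → ((BarPow E q).obj (X.X m) ⟶ M)) :
    BarDeg E X P n ⟶ M :=
  ModuleCat.ofHom (DirectSum.toModule Λ _ _ (fun i => (f i.1.1 i.1.2 i.2.1 i.2.2).hom))

lemma barIn_desc {n : ℤ} {M : ModuleCat.{u} Λ}
    (f : ∀ (q : ℕ) (m : ℤ), n + q = m → (q : ℕ∞) ≤ P → ((BarPow E q).obj (X.X m) ⟶ M))
    (q m h hq) : barIn E q m h hq ≫ barDesc E f = f q m h hq := by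
  ext1
  refine LinearMap.ext fun x => ?_
  exact DirectSum.toModule_lof Λ (φ := fun i : {i : ℕ × ℤ // n + i.1 = i.2 ∧ (i.1 : ℕ∞) ≤ P} =>
    (f i.1.1 i.1.2 i.2.1 i.2.2).hom) ⟨(q, m), h, hq⟩ x

lemma barIn_desc_assoc {n : ℤ} {M M' : ModuleCat.{u} Λ}
    (f : ∀ (q : ℕ) (m : ℤ), n + q = m → (q : ℕ∞) ≤ P → ((BarPow E q).obj (X.X m) ⟶ M))
    (q m h hq) (g : M ⟶ M') : barIn E q m h hq ≫ barDesc E f ≫ g = f q m h hq ≫ g := by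
  rw [← Category.assoc, barIn_desc]

lemma bar_hom_ext {n : ℤ} {M : ModuleCat.{u} Λ} {f g : BarDeg E X P n ⟶ M}
    (h : ∀ q m h hq, barIn E q m h hq ≫ f = barIn E q m h hq ≫ g) : f = g := by
  ext1
  refine DirectSum.linearMap_ext Λ fun i => ?_
  exact congrArg ModuleCat.Hom.hom (h i.1.1 i.1.2 i.2.1 i.2.2)

/-- The external part of the differential on the summand indexed by `(q, m)`. -/
def barDEx {n : ℤ} : ∀ (q : ℕ) (m : ℤ), n + q = m → (q : ℕ∞) ≤ P →
    ((BarPow E q).obj (X.X m) ⟶ BarDeg E X P (n + 1))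
  | 0, _, _, _ => 0
  | q + 1, m, h, hq => (barExt E q).app (X.X m) ≫ barIn E q m (by push_cast at h; lia)
      (le_trans (by exact_mod_cast Nat.le_succ q) hq)

/-- The differential of `𝔹_{≤ P} ⊗_Λ X`:
`d(b ⊗ x) = d_ex(b) ⊗ x + (-1)^{|b|} b ⊗ d_X(x)`. -/
def barD (n : ℤ) : BarDeg E X P n ⟶ BarDeg E X P (n + 1) :=
  barDesc E fun q m h hq =>
    (q : ℤ).negOnePow • ((BarPow E q).map (X.d m (m + 1)) ≫ barIn E q (m + 1) (by lia) hq) +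
      barDEx E q m h hq

lemma barD_barD (n : ℤ) : barD E (X := X) (P := P) n ≫ barD E (n + 1) = 0 := by
  refine bar_hom_ext E fun q m h hq => ?_
  rw [comp_zero, barD, barIn_desc_assoc, Preadditive.add_comp, Linear.units_smul_comp,
    Category.assoc, barD, barIn_desc]
  have h0 : (BarPow E q).map (X.d m (m + 1)) ≫ (BarPow E q).map (X.d (m + 1) (m + 1 + 1)) = 0 := by
    rw [← Functor.map_comp, X.d_comp_d, Functor.map_zero]
  rw [Preadditive.comp_add, Linear.comp_units_smul, ← Category.assoc, h0, zero_comp, smul_zero,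
    zero_add]
  cases q with
  | zero => simp only [barDEx, comp_zero, zero_comp, smul_zero, add_zero]
  | succ q =>
    have h1 := (barExt E q).naturality (X.d m (m + 1))
    simp only [barDEx, Category.assoc, barIn_desc, Preadditive.comp_add, Linear.comp_units_smul]
    rw [← Category.assoc, h1, Category.assoc, ← add_assoc]
    have h2 : ((q + 1 : ℕ) : ℤ).negOnePow = -(q : ℤ).negOnePow := by
      push_cast
      exact Int.negOnePow_succ _
    rw [h2, Units.neg_smul, neg_add_cancel, zero_add]
    cases q with
    | zero => exact comp_zero
    | succ q =>
      change (barExt E (q + 1)).app _ ≫ (barExt E q).app _ ≫ _ = 0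
      rw [← Category.assoc, barExt_comp, zero_comp]

variable (X P)

/-- The complex `𝔹_{≤ P} ⊗_Λ X` of left `Λ`-modules; for `P = ⊤` this is `𝔹 ⊗_Λ X`. -/
def barCx : CochainComplex (ModuleCat.{u} Λ) ℤ :=
  CochainComplex.of (fun n => BarDeg E X P n) (fun n => barD E n) (fun n => barD_barD E n)

lemma barCx_d (n : ℤ) : (barCx E X P).d n (n + 1) = barD E n :=
  CochainComplex.of_d (fun n => BarDeg E X P n) (fun n => barD E n) n

variable {P}

variable {X} in
/-- The inclusion `(𝔹_{≤ P} ⊗_Λ X)^n ⊆ (𝔹_{≤ Q} ⊗_Λ X)^n` for `P ≤ Q`. -/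
def barIncDeg {Q : ℕ∞} (hPQ : P ≤ Q) (n : ℤ) : BarDeg E X P n ⟶ BarDeg E X Q n :=
  barDesc E fun q m h hq => barIn E q m h (hq.trans hPQ)

lemma barIncDeg_d {Q : ℕ∞} (hPQ : P ≤ Q) (n : ℤ) :
    barIncDeg E (X := X) hPQ n ≫ barD E n = barD E n ≫ barIncDeg E hPQ (n + 1) := by
  refine bar_hom_ext E fun q m h hq => ?_
  rw [barIncDeg, barIncDeg, barIn_desc_assoc, barD, barD, barIn_desc, barIn_desc_assoc,
    Preadditive.add_comp, Linear.units_smul_comp, Category.assoc, barIn_desc]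
  congr 1
  cases q with
  | zero => simp only [barDEx, zero_comp]
  | succ q => simp only [barDEx, Category.assoc, barIn_desc]

/-- The inclusion `𝔹_{≤ P} ⊗_Λ X ⊆ 𝔹_{≤ Q} ⊗_Λ X` for `P ≤ Q`. -/
def barInc {Q : ℕ∞} (hPQ : P ≤ Q) : barCx E X P ⟶ barCx E X Q :=
  CochainComplex.ofHom (fun n => barIncDeg E hPQ n)
    (fun n => by rw [barCx_d, barCx_d]; exact barIncDeg_d E X hPQ n)

lemma barInc_comp {Q R : ℕ∞} (hPQ : P ≤ Q) (hQR : Q ≤ R) :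
    barInc E X hPQ ≫ barInc E X hQR = barInc E X (hPQ.trans hQR) := by
  ext1 n
  change barIncDeg E (X := X) hPQ n ≫ barIncDeg E hQR n = barIncDeg E (hPQ.trans hQR) n
  refine bar_hom_ext E fun q m h hq => ?_
  rw [barIncDeg, barIncDeg, barIncDeg, barIn_desc_assoc, barIn_desc, barIn_desc]

/-- The components of the augmentation `ε ⊗_Λ X`, which is `a ⊗ x ↦ a x` on `Λ ⊗_E X` and
vanishes on the other summands. -/
def barEpsV (n : ℤ) : ∀ (q : ℕ) (m : ℤ), n + q = m → ((BarPow E q).obj (X.X m) ⟶ X.X n)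
  | 0, m, h => (barMul E).app (X.X m) ≫ (X.XIsoOfEq (by simpa using h.symm)).hom
  | _ + 1, _, _ => 0

/-- The map `ε ⊗_Λ X` in degree `n`. -/
def barEpsDeg (n : ℤ) : BarDeg E X ⊤ n ⟶ X.X n :=
  barDesc E fun q m h _ => barEpsV E X n q m h

lemma barEpsDeg_d (n : ℤ) :
    barEpsDeg E X n ≫ X.d n (n + 1) = barD E n ≫ barEpsDeg E X (n + 1) := by
  refine bar_hom_ext E fun q m h hq => ?_
  rw [barEpsDeg, barEpsDeg, barIn_desc_assoc, barD, barIn_desc_assoc, Preadditive.add_comp,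
    Linear.units_smul_comp, Category.assoc, barIn_desc]
  cases q with
  | zero =>
    obtain rfl : m = n := by simpa using h.symm
    have h1 := (barMul E).naturality (X.d m (m + 1))
    simp only [barEpsV, barDEx, zero_comp, add_zero]
    rw [← Category.assoc ((BarPow E 0).map _), h1]
    simp [HomologicalComplex.XIsoOfEq]
  | succ q =>
    cases q with
    | zero =>
      simp only [barEpsV, barDEx, comp_zero, zero_comp, smul_zero, zero_add, Category.assoc,
        barIn_desc]
      rw [← Category.assoc, barExt_barMul, zero_comp]
    | succ q =>
      simp only [barEpsV, barDEx, comp_zero, zero_comp, smul_zero, zero_add, Category.assoc,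
        barIn_desc]

/-- The map `ε ⊗_Λ X : 𝔹 ⊗_Λ X ⟶ X`. -/
def barEps : barCx E X ⊤ ⟶ X :=
  CochainComplex.ofHom (fun n => barEpsDeg E X n)
    (fun n => by rw [barCx_d]; exact barEpsDeg_d E X n)

/-- The sequence `𝒴(Λ, 𝔹_{≤ 0} ⊗_Λ X) ⟶ 𝒴(Λ, 𝔹_{≤ 1} ⊗_Λ X) ⟶ ⋯`. -/
def yonedaBarSeq : ℕ ⥤ CochainComplex (ModuleCat.{u} Λ) ℤ :=
  Functor.ofSequence (X := fun p : ℕ => (yonedaFun E).obj (barCx E X p))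
    (fun p => (yonedaFun E).map (barInc E X (by exact_mod_cast Nat.le_succ p)))

/-- The complex `colim_p 𝒴(Λ, 𝔹_{≤ p} ⊗_Λ X)`. -/
def colimYonedaBar : CochainComplex (ModuleCat.{u} Λ) ℤ := colimit (yonedaBarSeq E X)

/-- The composite of `𝒴(Λ, inc) : 𝒴(Λ, 𝔹_{≤ p} ⊗_Λ X) ⟶ 𝒴(Λ, 𝔹 ⊗_Λ X)` and
`𝒴(Λ, ε ⊗_Λ X) : 𝒴(Λ, 𝔹 ⊗_Λ X) ⟶ 𝒴(Λ, X)`. -/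
def varthetaApp (p : ℕ) : (yonedaFun E).obj (barCx E X p) ⟶ (yonedaFun E).obj X :=
  (yonedaFun E).map (barInc E X (le_top : (p : ℕ∞) ≤ ⊤)) ≫ (yonedaFun E).map (barEps E X)

lemma varthetaApp_comp (p : ℕ) (h : (p : ℕ∞) ≤ (p + 1 : ℕ)) :
    (yonedaFun E).map (barInc E X h) ≫ varthetaApp E X (p + 1) = varthetaApp E X p := by
  rw [varthetaApp, ← Functor.map_comp_assoc, barInc_comp]
  rfl

/-- The map `ϑ_X : colim_p 𝒴(Λ, 𝔹_{≤ p} ⊗_Λ X) ⟶ 𝒴(Λ, X)`, induced by the maps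
`𝒴(Λ, ε ⊗_Λ X) ∘ 𝒴(Λ, inc)`. -/
def vartheta : colimYonedaBar E X ⟶ (yonedaFun E).obj X :=
  colimit.desc (yonedaBarSeq E X)
    { pt := (yonedaFun E).obj X
      ι := NatTrans.ofSequence (fun p => varthetaApp E X p) (fun p => by
        erw [Functor.ofSequence_map_homOfLE_succ]
        exact (varthetaApp_comp E X p _).trans (Category.comp_id _).symm) }

end Bar

/-! ### The homotopy category of complexes of injective modules -/

section KInj

/-- The complex `K` has injective components. -/
def IsInjComplex (K : CochainComplex (ModuleCat.{u} Λ) ℤ) : Prop := ∀ n, Injective (K.X n)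

variable (Λ) in
/-- The homotopy category `𝐊(Λ-Inj)` of complexes of injective left `Λ`-modules. -/
abbrev KInj : Type (u + 1) :=
  HomotopyCategory (InjectiveObject (ModuleCat.{u} Λ)) (ComplexShape.up ℤ)

/-- A complex with injective components, as a complex in the category of injective modules. -/
def toInj (K : CochainComplex (ModuleCat.{u} Λ) ℤ) (hK : IsInjComplex K) :
    CochainComplex (InjectiveObject (ModuleCat.{u} Λ)) ℤ :=
  HomologicalComplex.liftObjectProperty (isInjective (ModuleCat.{u} Λ)) K hK

/-- A cochain map between complexes with injective components, as a morphism of complexes in the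
category of injective modules. -/
def toInjMap {K L : CochainComplex (ModuleCat.{u} Λ) ℤ} (f : K ⟶ L) (hK : IsInjComplex K)
    (hL : IsInjComplex L) : toInj K hK ⟶ toInj L hL where
  f n := ObjectProperty.homMk (f.f n)
  comm' i j _ := by
    ext1
    exact f.comm i j

/-- The quotient functor from complexes of injective modules to `𝐊(Λ-Inj)`. -/
abbrev quotKInj : CochainComplex (InjectiveObject (ModuleCat.{u} Λ)) ℤ ⥤ KInj Λ :=
  HomotopyCategory.quotient _ _

end KInj

end SingYoneda
end

/-!
The idea is that `𝒴(Λ, -)` turns `Ω_nc(M)` into the cone of the multiplication map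
`ε : Λ ⊗_E M ⟶ M`. The sequence `0 ⟶ Ω_nc(M) ⟶ Λ ⊗_E M ⟶ M ⟶ 0` is exact over `Λ`, but in general
it splits over `E` only, by `σ : a ⊗ x ↦ s a ⊗ x` and `η : x ↦ 1 ⊗ x`. Postcomposition with a graded
`E`-linear map `g` makes sense on `𝒴(Λ, -)`, and its differential is the expected one plus a
term which is the composite of `θ` and of the failure `s a ⊗ x ↦ a g(x) - g(a x)` of `g` to be
`Λ`-linear (`δ_YE`). For `σ` and `η` these failures are again `Λ`-linear, and it follows that
`θ_M` on `𝒴(Λ, M)` together with `-σ` on `𝒴(Λ, Λ ⊗_E M)` is a homotopy equivalence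
`Cone(𝒴(Λ, ε)) ⟶ 𝒴(Λ, Ω_nc(M))` (`isIso_quotient_map_coneIndEps`).

The complex `𝔹_{≤ p + 1} ⊗_Λ X` is an extension of `Λ ⊗_E Ω_nc^{p + 1}(X)` by `𝔹_{≤ p} ⊗_Λ X` which
splits in each degree (`barSplitting`). Hence the cone of `𝒴(Λ, 𝔹_{≤ p + 1} ⊗_Λ X) ⟶ 𝒴(Λ, X)` is the
cone of a map from `𝒴(Λ, Λ ⊗_E Ω_nc^{p + 1}(X))` to the cone of `𝒴(Λ, 𝔹_{≤ p} ⊗_Λ X) ⟶ 𝒴(Λ, X)`.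
By induction on `p` one obtains homotopy equivalences
`Cone(𝒴(Λ, 𝔹_{≤ p} ⊗_Λ X) ⟶ 𝒴(Λ, X)) ⟶ 𝒴(Λ, Ω_nc^{p + 1}(X))` which commute strictly with the
inclusions of the bar filtration on the left and with `θ` on the right (`coneEquiv`,
`coneInc_coneEquiv_succ`), and which restrict to `θ_X` on `𝒴(Λ, X)` for `p = 0`.

In the colimit they give a map `Cone(ϑ_X) ⟶ 𝒮𝒴(Λ, X)` which restricts to `f ↦ [f; 0]` on
`𝒴(Λ, X)` (`coneToSingular`). The inverses and homotopies are not compatible with the transition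
maps, but the colimit is a homotopy equivalence all the same
(`IsSeqColimCx.isIso_quotient_map`): since `E` is semisimple the modules in question are injective
(`yoneda_injective`), the cocycles of a contractible complex of injectives are injective, and over
a left noetherian ring a sequential colimit of injectives is injective; so the cone of the colimit
map, which is the colimit of the contractible cones of the maps at the finite stages, is an acyclic
complex with injective cocycles, hence contractible. This gives the homotopy equivalence and the
exact triangle.

Finally `𝒮𝒴(Λ, X)` is acyclic (`acyclic_singularYoneda`): precomposition with
`s a₁ ⊗ ⋯ ⊗ s a_p ⊗ x ↦ s a₁ ⊗ ⋯ ⊗ s a_p ⊗ s x ⊗ 1` contracts `𝒴(Λ, X)` up to a term involving only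
the component of filtration-degree `0`. This component of `θ(f)` vanishes, so that `θ` sends cocycles
to coboundaries. Hence the cone of `ϑ_X` is acyclic, and `ϑ_X` is a quasi-isomorphism.
-/

noncomputable section

namespace SingYoneda

/-! ### Sequential colimits of modules -/

section SeqColim

variable {R : Type u} [Ring R]

/-- The cocone `c` on a sequence of modules is a colimit, in terms of elements: every element
comes from some stage, and an element which dies in `c.pt` dies at some later stage. -/
structure IsSeqColim {F : ℕ ⥤ ModuleCat.{u} R} (c : Cocone F) : Prop where
  exists_rep (x : c.pt) : ∃ (p : ℕ) (y : F.obj p), c.ι.app p y = x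
  exists_zero (p : ℕ) (y : F.obj p) (hy : c.ι.app p y = 0) :
    ∃ (q : ℕ) (h : p ≤ q), F.map (homOfLE h) y = 0

lemma IsSeqColim.of_isColimit {F : ℕ ⥤ ModuleCat.{u} R} {c : Cocone F} (hc : IsColimit c) :
    IsSeqColim c where
  exists_rep x :=
    have := preservesFilteredColimitsOfSize_shrink.{0, u, 0, u} (forget (ModuleCat.{u} R))
    Concrete.isColimit_exists_rep F hc x
  exists_zero p y hy := by
    have := preservesFilteredColimitsOfSize_shrink.{0, u, 0, u} (forget (ModuleCat.{u} R))
    obtain ⟨k, f, g, h⟩ := (Concrete.isColimit_rep_eq_iff_exists F (i := p) (j := p) hc y 0).1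
      (by rw [hy]; exact (map_zero _).symm)
    refine ⟨k, leOfHom f, ?_⟩
    rw [Subsingleton.elim (homOfLE (leOfHom f)) f, h]
    exact map_zero _

lemma seq_map_map (F : ℕ ⥤ ModuleCat.{u} R) {p q r : ℕ} (h : p ≤ q) (h' : q ≤ r) (y : F.obj p) :
    F.map (homOfLE h') (F.map (homOfLE h) y) = F.map (homOfLE (h.trans h')) y := by
  rw [← ConcreteCategory.comp_apply, ← F.map_comp]; rfl

lemma seq_ι_map {F : ℕ ⥤ ModuleCat.{u} R} (c : Cocone F) {p q : ℕ} (h : p ≤ q) (y : F.obj p) :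
    c.ι.app q (F.map (homOfLE h) y) = c.ι.app p y := by
  rw [← ConcreteCategory.comp_apply, c.w]

/-- Finitely many elements of a sequential colimit come from a common stage. -/
lemma IsSeqColim.exists_rep_finite {F : ℕ ⥤ ModuleCat.{u} R} {c : Cocone F} (hc : IsSeqColim c)
    {k : Type*} [Finite k] (x : k → c.pt) :
    ∃ (p : ℕ) (y : k → F.obj p), ∀ i, c.ι.app p (y i) = x i := by
  have := Fintype.ofFinite k
  choose p y hy using fun i => hc.exists_rep (x i)
  refine ⟨Finset.univ.sup p, fun i => F.map (homOfLE (Finset.le_sup (Finset.mem_univ i))) (y i),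
    fun i => ?_⟩
  rw [seq_ι_map, hy]

/-- Finitely many elements which die in a sequential colimit die at a common stage. -/
lemma IsSeqColim.exists_zero_finset {F : ℕ ⥤ ModuleCat.{u} R} {c : Cocone F} (hc : IsSeqColim c)
    {p : ℕ} (s : Finset (F.obj p)) (hs : ∀ y ∈ s, c.ι.app p y = 0) :
    ∃ (q : ℕ) (h : p ≤ q), ∀ y ∈ s, F.map (homOfLE h) y = 0 := by
  classical
  induction s using Finset.induction_on with
  | empty => exact ⟨p, le_rfl, by simp⟩
  | insert a s _ ih =>
    obtain ⟨q, h, hq⟩ := ih fun y hy => hs y (Finset.mem_insert_of_mem hy)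
    obtain ⟨r, h', hr⟩ := hc.exists_zero p a (hs a (Finset.mem_insert_self _ _))
    refine ⟨max q r, h.trans (le_max_left _ _), fun y hy => ?_⟩
    obtain rfl | hy := Finset.mem_insert.1 hy
    · rw [← seq_map_map F h' (le_max_right q r), hr]
      exact map_zero _
    · rw [← seq_map_map F h (le_max_left q r), hq y hy]
      exact map_zero _

/-- Over a noetherian ring, a sequential colimit of injective modules is injective: a map from a
left ideal to the colimit factors through some stage, since the ideal is finitely presented. -/
lemma IsSeqColim.injective [IsNoetherianRing R] {F : ℕ ⥤ ModuleCat.{u} R} {c : Cocone F}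
    (hc : IsSeqColim c) (hF : ∀ p, Module.Injective R (F.obj p)) : Module.Injective R c.pt := by
  refine Module.Baer.injective fun I g => ?_
  obtain ⟨k, π, hπ⟩ := Module.Finite.exists_fin' R I
  obtain ⟨p, y, hy⟩ := hc.exists_rep_finite (fun i : Fin k => g (π (Pi.single i 1)))
  let π' : (Fin k → R) →ₗ[R] F.obj p := (Pi.basisFun R (Fin k)).constr ℕ y
  have hπ' : (c.ι.app p).hom ∘ₗ π' = g ∘ₗ π := by
    refine (Pi.basisFun R (Fin k)).ext fun i => ?_
    simp only [LinearMap.comp_apply, π', Module.Basis.constr_basis]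
    rw [Pi.basisFun_apply]
    exact hy i
  obtain ⟨s, hs⟩ := (isNoetherian_def.1 inferInstance (LinearMap.ker π) : (LinearMap.ker π).FG)
  classical
  obtain ⟨q, h, hq⟩ := hc.exists_zero_finset (s.image π') (by
    intro y hy
    obtain ⟨z, hz, rfl⟩ := Finset.mem_image.1 hy
    have hz' : π z = 0 := by
      rw [← LinearMap.mem_ker, ← hs]
      exact Submodule.subset_span hz
    have := DFunLike.congr_fun hπ' z
    rw [LinearMap.comp_apply, LinearMap.comp_apply, hz', map_zero] at this
    exact this)
  have hker : LinearMap.ker π ≤ LinearMap.ker ((F.map (homOfLE h)).hom ∘ₗ π') := by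
    rw [← hs, Submodule.span_le]
    intro z hz
    exact hq _ (Finset.mem_image_of_mem _ hz)
  let g' : I →ₗ[R] F.obj q :=
    (LinearMap.ker π).liftQ _ hker ∘ₗ (π.quotKerEquivOfSurjective hπ).symm.toLinearMap
  have hg' (z : Fin k → R) : g' (π z) = F.map (homOfLE h) (π' z) := by
    have : (π.quotKerEquivOfSurjective hπ).symm (π z) = Submodule.Quotient.mk z := by
      rw [LinearEquiv.symm_apply_eq]
      rfl
    simp only [g', LinearMap.comp_apply, LinearEquiv.coe_coe, this,  Submodule.liftQ_apply]
  obtain ⟨G, hG⟩ := Module.Baer.of_injective (hF q) I g'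
  refine ⟨(c.ι.app q).hom ∘ₗ G, fun x hx => ?_⟩
  obtain ⟨z, hz⟩ := hπ ⟨x, hx⟩
  rw [LinearMap.comp_apply, hG x hx, ← hz, hg']
  exact (seq_ι_map c h (π' z)).trans (DFunLike.congr_fun hπ' z)

end SeqColim

/-! ### Contractible complexes of modules -/

section Contractible

variable {R : Type u} [Ring R] (K : CochainComplex (ModuleCat.{u} R) ℤ)

/-- The module of cocycles of degree `n`. -/
def cocycles (n : ℤ) : Submodule R (K.X n) := LinearMap.ker (K.d n (n + 1)).hom

variable {K}

lemma mem_cocycles {n : ℤ} {x : K.X n} : x ∈ cocycles K n ↔ K.d n (n + 1) x = 0 := Iff.rfl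

lemma d_mem_cocycles {n m : ℤ} (x : K.X n) : K.d n m x ∈ cocycles K m := by
  rw [mem_cocycles, ← ConcreteCategory.comp_apply, K.d_comp_d]
  rfl

/-- An acyclic complex of modules whose modules of cocycles are injective is contractible. -/
lemma contractible_of_injective_cocycles (hex : ∀ (n : ℤ), ∀ x ∈ cocycles K (n + 1),
      ∃ y, K.d n (n + 1) y = x) (hinj : ∀ n, Module.Injective R (cocycles K n)) :
    Nonempty (Homotopy (𝟙 K) 0) := by
  choose r hr using fun n => Module.Injective.out (self := hinj n) (cocycles K n).subtype
    Subtype.val_injective LinearMap.id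
  -- The bijection `K^n / Z^n ≃ Z^{n+1}` induced by the differential.
  have hd (n : ℤ) : ∀ x, (K.d n (n + 1)).hom x ∈ cocycles K (n + 1) := d_mem_cocycles
  choose s hs using fun n (z : cocycles K (n + 1)) => hex n z.1 z.2
  have hrz (n : ℤ) (z : K.X n) (hz : z ∈ cocycles K n) : (r n z : K.X n) = z :=
    congrArg Subtype.val (hr n ⟨z, hz⟩)
  have huniq (n : ℤ) (y y' : K.X n) (h : K.d n (n + 1) y = K.d n (n + 1) y') :
      y - r n y = y' - r n y' := by
    have h0 : y - y' ∈ cocycles K n := by rw [mem_cocycles, map_sub, h, sub_self]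
    have := hrz n _ h0
    rw [map_sub, Submodule.coe_sub] at this
    rw [sub_eq_sub_iff_sub_eq_sub, ← this]
  let t (n : ℤ) : cocycles K (n + 1) →ₗ[R] K.X n :=
    { toFun := fun z => s n z - r n (s n z)
      map_add' := fun z z' => by
        rw [huniq n _ (s n z + s n z') (by rw [map_add, hs, hs, hs]; rfl), map_add,
          Submodule.coe_add]
        abel
      map_smul' := fun a z => by
        rw [huniq n _ (a • s n z) (by rw [map_smul, hs, hs]; rfl), map_smul,
          Submodule.coe_smul, ← smul_sub]
        rfl }
  have ht (n m : ℤ) (h : n + 1 = m) : ∃ t : cocycles K m →ₗ[R] K.X n,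
      (∀ z, K.d n m (t z) = z) ∧ ∀ x, t ⟨K.d n m x, d_mem_cocycles x⟩ = x - r n x := by
    subst h
    refine ⟨t n, fun z => ?_, fun x => huniq n _ _ (hs n _)⟩
    change K.d n (n + 1) (s n z - r n (s n z)) = z
    rw [map_sub, hs, mem_cocycles.1 (r n (s n z)).2, sub_zero]
  choose t ht ht' using ht
  refine ⟨(CochainComplex.HomComplex.Cochain.equivHomotopy (𝟙 K) 0).symm
    ⟨CochainComplex.HomComplex.Cochain.mk fun p q hpq =>
      ModuleCat.ofHom (t q p (by lia) ∘ₗ r p), ?_⟩⟩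
  ext p x
  rw [CochainComplex.HomComplex.Cochain.add_v,
    CochainComplex.HomComplex.δ_v (-1) 0 (by lia) _ p p (by lia) (p - 1) (p + 1) rfl rfl]
  simp only [CochainComplex.HomComplex.Cochain.ofHom_v, Int.negOnePow_zero, one_smul,
    CochainComplex.HomComplex.Cochain.mk_v]
  change x = K.d (p - 1) p (t (p - 1) p _ (r p x)) + t p (p + 1) _ (r (p + 1) (K.d p (p + 1) x)) + 0
  rw [ht, show r (p + 1) (K.d p (p + 1) x) = ⟨K.d p (p + 1) x, d_mem_cocycles x⟩ from
    Subtype.ext (hrz _ _ (d_mem_cocycles x)), ht']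
  abel

/-- In a contractible complex every cocycle is a coboundary, in a linear way. -/
lemma exists_linear_primitive (h : Homotopy (𝟙 K) 0) (m n : ℤ) (hmn : m + 1 = n) :
    ∃ s : K.X n →ₗ[R] K.X m, ∀ x ∈ cocycles K n, K.d m n (s x) = x := by
  refine ⟨(h.hom n m).hom, fun x hx => ?_⟩
  have h1 := h.comm n
  rw [dNext_eq _ (show (ComplexShape.up ℤ).Rel n (n + 1) from rfl),
    prevD_eq _ (show (ComplexShape.up ℤ).Rel m n from hmn)] at h1
  have h2 := ConcreteCategory.congr_hom h1 x
  change x = h.hom (n + 1) n (K.d n (n + 1) x) + K.d m n (h.hom n m x) + 0 at h2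
  rw [mem_cocycles.1 hx, map_zero, zero_add, add_zero] at h2
  exact h2.symm

lemma injective_of_retract {M N : Type u} [AddCommGroup M] [Module R M] [AddCommGroup N]
    [Module R N] (i : N →ₗ[R] M) (r : M →ₗ[R] N) (h : ∀ x, r (i x) = x)
    (hM : Module.Injective R M) : Module.Injective R N := by
  refine Module.Baer.injective fun I g => ?_
  obtain ⟨G, hG⟩ := Module.Baer.of_injective hM I (i ∘ₗ g)
  refine ⟨r ∘ₗ G, fun x hx => ?_⟩
  rw [LinearMap.comp_apply, hG x hx, LinearMap.comp_apply, h]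

/-- The cocycles of a contractible complex of injective modules are injective. -/
lemma injective_cocycles (h : Homotopy (𝟙 K) 0) (n : ℤ) (hK : Module.Injective R (K.X n)) :
    Module.Injective R (cocycles K n) := by
  obtain ⟨s, hs⟩ := exists_linear_primitive h (n - 1) n (by lia)
  exact injective_of_retract (cocycles K n).subtype
    (((K.d (n - 1) n).hom ∘ₗ s).codRestrict (cocycles K n) fun x => d_mem_cocycles _)
    (fun x => Subtype.ext (hs x x.2)) hK

end Contractible

/-! ### Sequential colimits of complexes -/

section SeqColimCx

variable {R : Type u} [Ring R]

/-- The cocone `c` on a sequence of complexes of modules is a colimit in each degree. -/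
def IsSeqColimCx {F : ℕ ⥤ CochainComplex (ModuleCat.{u} R) ℤ} (c : Cocone F) : Prop :=
  ∀ n, IsSeqColim ((HomologicalComplex.eval _ _ n).mapCocone c)

variable {F G : ℕ ⥤ CochainComplex (ModuleCat.{u} R) ℤ} {c : Cocone F} {d : Cocone G}

lemma IsSeqColimCx.of_isColimit (hc : IsColimit c) : IsSeqColimCx c :=
  fun n => .of_isColimit (isColimitOfPreserves (HomologicalComplex.eval _ _ n) hc)

lemma IsSeqColimCx.exists_rep (hc : IsSeqColimCx c) {n : ℤ} (x : c.pt.X n) :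
    ∃ (p : ℕ) (y : (F.obj p).X n), (c.ι.app p).f n y = x := (hc n).exists_rep x

lemma IsSeqColimCx.exists_zero (hc : IsSeqColimCx c) {n : ℤ} {p : ℕ} (y : (F.obj p).X n)
    (hy : (c.ι.app p).f n y = 0) : ∃ (q : ℕ) (h : p ≤ q), (F.map (homOfLE h)).f n y = 0 :=
  (hc n).exists_zero p y hy

lemma seqCx_map_map {p q r : ℕ} (h : p ≤ q) (h' : q ≤ r) {n : ℤ} (y : (F.obj p).X n) :
    (F.map (homOfLE h')).f n ((F.map (homOfLE h)).f n y) = (F.map (homOfLE (h.trans h'))).f n y :=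
  seq_map_map (F ⋙ HomologicalComplex.eval _ _ n) h h' y

lemma seqCx_ι_map (c : Cocone F) {p q : ℕ} (h : p ≤ q) {n : ℤ} (y : (F.obj p).X n) :
    (c.ι.app q).f n ((F.map (homOfLE h)).f n y) = (c.ι.app p).f n y :=
  seq_ι_map ((HomologicalComplex.eval _ _ n).mapCocone c) h y

lemma hom_f_d {K L : CochainComplex (ModuleCat.{u} R) ℤ} (f : K ⟶ L) {m n : ℤ} (x : K.X m) :
    f.f n (K.d m n x) = L.d m n (f.f m x) := by
  rw [← ConcreteCategory.comp_apply, ← f.comm, ConcreteCategory.comp_apply]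

/-- A cocycle of a sequential colimit comes from a cocycle at some stage. -/
lemma IsSeqColimCx.exists_cocycle (hc : IsSeqColimCx c) {n : ℤ} (x : c.pt.X n)
    (hx : x ∈ cocycles c.pt n) : ∃ (p : ℕ) (y : (F.obj p).X n), y ∈ cocycles (F.obj p) n ∧
      (c.ι.app p).f n y = x := by
  obtain ⟨p, y, rfl⟩ := hc.exists_rep x
  obtain ⟨q, h, hq⟩ := hc.exists_zero ((F.obj p).d n (n + 1) y) (by rw [hom_f_d]; exact hx)
  exact ⟨q, (F.map (homOfLE h)).f n y, by rw [mem_cocycles, ← hom_f_d, hq], seqCx_ι_map c h y⟩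

/-- The map induced on cocycles by a morphism of complexes. -/
def cocyclesMap {K L : CochainComplex (ModuleCat.{u} R) ℤ} (f : K ⟶ L) (n : ℤ) :
    cocycles K n →ₗ[R] cocycles L n :=
  (f.f n).hom.restrict fun x hx => by
    change L.d n (n + 1) (f.f n x) = 0
    rw [← hom_f_d, mem_cocycles.1 hx, map_zero]

variable (F) in
/-- The sequence of cocycles of a sequence of complexes. -/
def cocyclesSeq (n : ℤ) : ℕ ⥤ ModuleCat.{u} R where
  obj p := ModuleCat.of R (cocycles (F.obj p) n)
  map f := ModuleCat.ofHom (cocyclesMap (F.map f) n)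
  map_id p := by
    ext1
    refine LinearMap.ext fun x => Subtype.ext ?_
    exact ConcreteCategory.congr_hom
      (congrArg (fun f => HomologicalComplex.Hom.f f n) (F.map_id p)) x.1
  map_comp f g := by
    ext1
    refine LinearMap.ext fun x => Subtype.ext ?_
    exact ConcreteCategory.congr_hom
      (congrArg (fun f => HomologicalComplex.Hom.f f n) (F.map_comp f g)) x.1

variable (c) in
/-- The cocycles of a cocone, as a cocone on the sequence of cocycles. -/
def cocyclesCocone (n : ℤ) : Cocone (cocyclesSeq F n) where
  pt := ModuleCat.of R (cocycles c.pt n)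
  ι :=
    { app := fun p => ModuleCat.ofHom (cocyclesMap (c.ι.app p) n)
      naturality := fun p q f => by
        ext1
        refine LinearMap.ext fun x => Subtype.ext ?_
        exact ConcreteCategory.congr_hom
          (congrArg (fun f => HomologicalComplex.Hom.f f n) (c.ι.naturality f)) x.1 }

/-- Cocycles commute with sequential colimits. -/
lemma IsSeqColimCx.cocycles (hc : IsSeqColimCx c) (n : ℤ) : IsSeqColim (cocyclesCocone c n) where
  exists_rep x := by
    obtain ⟨p, y, hy, h⟩ := hc.exists_cocycle x.1 x.2
    exact ⟨p, ⟨y, hy⟩, Subtype.ext h⟩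
  exists_zero p y hy := by
    obtain ⟨q, h, hq⟩ := hc.exists_zero y.1 (congrArg Subtype.val hy)
    exact ⟨q, h, Subtype.ext hq⟩

/-- Over a noetherian ring, a sequential colimit of contractible complexes of injective modules
is contractible, although the contractions need not be compatible with the transition maps. -/
lemma IsSeqColimCx.contractible [IsNoetherianRing R] (hc : IsSeqColimCx c)
    (hF : ∀ p n, Module.Injective R ((F.obj p).X n))
    (h : ∀ p, Nonempty (Homotopy (𝟙 (F.obj p)) 0)) : Nonempty (Homotopy (𝟙 c.pt) 0) := by
  refine contractible_of_injective_cocycles (fun n x hx => ?_) fun n =>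
    (hc.cocycles n).injective fun p => injective_cocycles (h p).some n (hF p n)
  obtain ⟨p, y, hy, rfl⟩ := hc.exists_cocycle x hx
  obtain ⟨s, hs⟩ := exists_linear_primitive (h p).some n (n + 1) rfl
  exact ⟨(c.ι.app p).f n (s y), by rw [← hom_f_d, hs y hy]⟩

lemma IsSeqColimCx.injective [IsNoetherianRing R] (hc : IsSeqColimCx c) (n : ℤ)
    (hF : ∀ p, Module.Injective R ((F.obj p).X n)) : Module.Injective R (c.pt.X n) :=
  (hc n).injective hF

open CochainComplex in
/-- The sequence of mapping cones of a morphism of sequences of complexes. -/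
def coneSeq (φ : F ⟶ G) : ℕ ⥤ CochainComplex (ModuleCat.{u} R) ℤ where
  obj p := mappingCone (φ.app p)
  map f := mappingCone.map _ _ (F.map f) (G.map f) (φ.naturality f).symm
  map_id p := by
    rw [← mappingCone.map_id]
    congr 1 <;> simp
  map_comp f g := by
    rw [← mappingCone.map_comp]
    congr 1 <;> simp

open CochainComplex in
/-- The cocone on the sequence of mapping cones induced by a morphism of cocones. -/
def coneCocone (φ : F ⟶ G) (c : Cocone F) (d : Cocone G) (ψ : c.pt ⟶ d.pt)
    (h : ∀ p, φ.app p ≫ d.ι.app p = c.ι.app p ≫ ψ) : Cocone (coneSeq φ) where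
  pt := mappingCone ψ
  ι :=
    { app := fun p => mappingCone.map _ _ (c.ι.app p) (d.ι.app p) (h p)
      naturality := fun p q f => by
        refine (mappingCone.map_comp (φ.app p) (φ.app q) ψ _ _ (φ.naturality f).symm _ _
          (h q)).symm.trans ?_
        refine Eq.trans ?_ (Category.comp_id _).symm
        congr 1 <;> simp }

section Elements

open CochainComplex CochainComplex.mappingCone

variable {K L K' L' : CochainComplex (ModuleCat.{u} R) ℤ} (φ : K ⟶ L) (φ' : K' ⟶ L')

/-- The element of the mapping cone with given components. -/
def coneMk {n m : ℤ} (h : n + 1 = m) (x : K.X m) (y : L.X n) : (mappingCone φ).X n :=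
  (inl φ).v m n (by lia) x + (inr φ).f n y

lemma coneMk_surjective {n m : ℤ} (h : n + 1 = m) (z : (mappingCone φ).X n) :
    ∃ x y, z = coneMk φ h x y := by
  refine ⟨(fst φ).1.v n m h z, (snd φ).v n n (add_zero n) z, ?_⟩
  exact ConcreteCategory.congr_hom (id_X φ n m h).symm z

lemma coneMk_eq_zero {n m : ℤ} (h : n + 1 = m) {x : K.X m} {y : L.X n}
    (h0 : coneMk φ h x y = 0) : x = 0 ∧ y = 0 := by
  constructor
  · have h1 := congrArg ((fst φ).1.v n m h) h0
    rw [coneMk, map_add, ← ConcreteCategory.comp_apply, ← ConcreteCategory.comp_apply,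
      inl_v_fst_v, inr_f_fst_v, map_zero] at h1
    simpa using h1
  · have h1 := congrArg ((snd φ).v n n (add_zero n)) h0
    rw [coneMk, map_add, ← ConcreteCategory.comp_apply, ← ConcreteCategory.comp_apply,
      inl_v_snd_v, inr_f_snd_v, map_zero] at h1
    simpa using h1

lemma coneMk_zero {n m : ℤ} (h : n + 1 = m) : coneMk φ h (0 : K.X m) (0 : L.X n) = 0 := by
  simp [coneMk]

lemma map_coneMk (a : K ⟶ K') (b : L ⟶ L') (comm : φ ≫ b = a ≫ φ') {n m : ℤ} (h : n + 1 = m)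
    (x : K.X m) (y : L.X n) :
    (mappingCone.map φ φ' a b comm).f n (coneMk φ h x y) =
      coneMk φ' h (a.f m x) (b.f n y) := by
  rw [coneMk, coneMk, map_add, ← ConcreteCategory.comp_apply, ← ConcreteCategory.comp_apply]
  simp [mappingCone.map]

end Elements

/-- Mapping cones commute with sequential colimits. -/
lemma IsSeqColimCx.cone (hc : IsSeqColimCx c) (hd : IsSeqColimCx d) (φ : F ⟶ G)
    (ψ : c.pt ⟶ d.pt) (h : ∀ p, φ.app p ≫ d.ι.app p = c.ι.app p ≫ ψ) :
    IsSeqColimCx (coneCocone φ c d ψ h) := fun n => by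
  refine ⟨fun z => ?_, fun p z hz => ?_⟩
  · obtain ⟨x, y, rfl⟩ := coneMk_surjective ψ (rfl : n + 1 = _) z
    obtain ⟨p, x, rfl⟩ := hc.exists_rep x
    obtain ⟨q, y, rfl⟩ := hd.exists_rep y
    refine ⟨max p q, coneMk (φ.app _) rfl ((F.map (homOfLE (le_max_left p q))).f _ x)
      ((G.map (homOfLE (le_max_right p q))).f _ y), ?_⟩
    refine (map_coneMk _ _ _ _ (h _) _ _ _).trans ?_
    rw [seqCx_ι_map, seqCx_ι_map]
  · obtain ⟨x, y, rfl⟩ := coneMk_surjective (φ.app p) (rfl : n + 1 = _) z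
    have hz' := (map_coneMk _ _ _ _ (h _) rfl x y).symm.trans hz
    obtain ⟨hx, hy⟩ := coneMk_eq_zero _ _ hz'
    obtain ⟨q, hq, hx⟩ := hc.exists_zero x hx
    obtain ⟨r, hr, hy⟩ := hd.exists_zero y hy
    refine ⟨max q r, hq.trans (le_max_left _ _), ?_⟩
    refine (map_coneMk _ _ _ _ (φ.naturality _).symm _ _ _).trans ?_
    rw [← seqCx_map_map hq (le_max_left q r), hx, ← seqCx_map_map hr (le_max_right q r), hy,
      map_zero, map_zero, coneMk_zero]
    rfl

end SeqColimCx

/-! ### Homotopy equivalences and mapping cones -/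

section Equivalences

variable {C : Type*} [Category C] [Preadditive C] [HasZeroObject C] [HasBinaryBiproducts C]

/-- A morphism of complexes is a homotopy equivalence if and only if its cone is contractible. -/
lemma isIso_quotient_map_iff_contractible {K L : CochainComplex C ℤ} (φ : K ⟶ L) :
    IsIso ((HomotopyCategory.quotient C (ComplexShape.up ℤ)).map φ) ↔
      Nonempty (Homotopy (𝟙 (CochainComplex.mappingCone φ)) 0) := by
  rw [← HomotopyCategory.isZero_quotient_obj_iff]
  exact (Pretriangulated.Triangle.isZero₃_iff_isIso₁ _
    (HomotopyCategory.mappingCone_triangleh_distinguished φ)).symm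

end Equivalences

section InjectiveCone

variable {R : Type u} [Ring R]

lemma injective_cone {K L : CochainComplex (ModuleCat.{u} R) ℤ} (φ : K ⟶ L)
    (hK : ∀ n, Module.Injective R (K.X n)) (hL : ∀ n, Module.Injective R (L.X n)) (n : ℤ) :
    Module.Injective R ((CochainComplex.mappingCone φ).X n) := by
  have h1 : Injective (K.X (n + 1)) := (Module.injective_iff_injective_object R _).1 (hK _)
  have h2 : Injective (L.X n) := (Module.injective_iff_injective_object R _).1 (hL _)
  refine (Module.injective_iff_injective_object R _).2 ?_
  exact Injective.of_iso (HomologicalComplex.homotopyCofiber.XIsoBiprod φ n (n + 1) rfl).symm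
    inferInstance

/-- Over a noetherian ring, a sequential colimit of homotopy equivalences between complexes of
injective modules is a homotopy equivalence. -/
lemma IsSeqColimCx.isIso_quotient_map [IsNoetherianRing R]
    {F G : ℕ ⥤ CochainComplex (ModuleCat.{u} R) ℤ} {c : Cocone F} {d : Cocone G}
    (hc : IsSeqColimCx c) (hd : IsSeqColimCx d) (φ : F ⟶ G) (ψ : c.pt ⟶ d.pt)
    (h : ∀ p, φ.app p ≫ d.ι.app p = c.ι.app p ≫ ψ)
    (hF : ∀ p n, Module.Injective R ((F.obj p).X n))
    (hG : ∀ p n, Module.Injective R ((G.obj p).X n))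
    (hφ : ∀ p, IsIso ((HomotopyCategory.quotient _ (ComplexShape.up ℤ)).map (φ.app p))) :
    IsIso ((HomotopyCategory.quotient _ (ComplexShape.up ℤ)).map ψ) := by
  rw [isIso_quotient_map_iff_contractible]
  exact (hc.cone hd φ ψ h).contractible (fun p => injective_cone _ (hF p) (hG p))
    fun p => (isIso_quotient_map_iff_contractible _).1 (hφ p)

end InjectiveCone

/-! ### Injectivity of the terms of the Yoneda complex -/

section YonedaInjective

variable {Λ : Type u} [Ring Λ] (E : Subring Λ) (V : Type u) [AddCommGroup V] [Module E V]

/-- The factor `Hom_E((Λ / E)^{⊗ k} ⊗_E Λ, V)` of the Yoneda complex, for an `E`-module `V`. -/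
def HomT (k : ℕ) : Type u := T E k →ₗ[E] V

instance (k : ℕ) : AddCommGroup (HomT E V k) := inferInstanceAs (AddCommGroup (T E k →ₗ[E] V))

/-- The left `Λ`-action on `Hom_E((Λ / E)^{⊗ k} ⊗_E Λ, V)` coming from the right `Λ`-action
on `Λ`. -/
instance (k : ℕ) : Module Λ (HomT E V k) where
  smul b f := LinearMap.comp (show T E k →ₗ[E] V from f) ((rmulT E k b).restrictScalars E)
  one_smul f := by
    refine LinearMap.ext fun x => ?_
    change (show T E k →ₗ[E] V from f) (rmulT E k 1 x) = _
    rw [rmulT_one]; rfl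
  mul_smul b c f := by
    refine LinearMap.ext fun x => ?_
    change (show T E k →ₗ[E] V from f) (rmulT E k (b * c) x) =
      (show T E k →ₗ[E] V from f) (rmulT E k c (rmulT E k b x))
    rw [rmulT_mul]; rfl
  smul_zero b := rfl
  smul_add b f g := rfl
  add_smul b c f := by
    refine LinearMap.ext fun x => ?_
    change (show T E k →ₗ[E] V from f) (rmulT E k (b + c) x) =
      (show T E k →ₗ[E] V from f) (rmulT E k b x) + (show T E k →ₗ[E] V from f) (rmulT E k c x)
    rw [rmulT_add, ← map_add]; rfl
  zero_smul f := by
    refine LinearMap.ext fun x => ?_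
    change (show T E k →ₗ[E] V from f) (rmulT E k 0 x) = 0
    rw [rmulT_zero]; exact map_zero _

variable {E V} in
/-- An element of `HomT` as a linear map. -/
def HomT.lin {k : ℕ} (f : HomT E V k) : T E k →ₗ[E] V := f

/-- The `E`-module `Hom_E(Λ / E, V)`, as the group of `E`-linear maps `Λ → V` vanishing
on `E`. -/
def BarHom : Type u := {φ : Λ →ₗ[E] V // ∀ e : E, φ (e : Λ) = 0}

variable {E V} in
/-- An element of `Hom_E(Λ / E, V)` as a linear map on `Λ`. -/
def BarHom.lin (φ : BarHom E V) : Λ →ₗ[E] V := φ.1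

variable {E V} in
lemma BarHom.lin_coe (φ : BarHom E V) (e : E) : φ.lin (e : Λ) = 0 := φ.2 e

variable {E V} in
@[ext] lemma BarHom.ext {φ ψ : BarHom E V} (h : ∀ a, φ.lin a = ψ.lin a) : φ = ψ :=
  Subtype.ext (LinearMap.ext h)

instance : AddCommGroup (BarHom E V) :=
  inferInstanceAs (AddCommGroup ({ carrier := {φ | ∀ e : E, φ (e : Λ) = 0}
                                   add_mem' := fun {a b} ha hb e => by
                                    rw [LinearMap.add_apply, ha, hb, add_zero]
                                   zero_mem' := fun e => rfl
                                   neg_mem' := fun {a} ha e => by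
                                    rw [LinearMap.neg_apply, ha, neg_zero] } :
    AddSubgroup (Λ →ₗ[E] V)))

variable {E V} in
lemma BarHom.add_lin (φ ψ : BarHom E V) (a : Λ) : (φ + ψ).lin a = φ.lin a + ψ.lin a := rfl

/-- The left `E`-action on `Hom_E(Λ / E, V)` coming from the right `E`-action on `Λ`. -/
instance : Module E (BarHom E V) where
  smul e φ := ⟨{ toFun := fun a => φ.lin (a * e)
                 map_add' := fun a b => by rw [add_mul, map_add]
                 map_smul' := fun e' a => by
                  rw [Subring.smul_def, smul_eq_mul, mul_assoc]
                  exact φ.lin.map_smul e' (a * e) }, fun e' => φ.lin_coe (e' * e)⟩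
  one_smul φ := BarHom.ext fun a => congrArg φ.lin (mul_one a)
  mul_smul e e' φ := BarHom.ext fun a => congrArg φ.lin (mul_assoc a e e').symm
  smul_zero e := BarHom.ext fun a => rfl
  smul_add e φ ψ := BarHom.ext fun a => rfl
  add_smul e e' φ := BarHom.ext fun a => (congrArg φ.lin (mul_add a e e')).trans (map_add φ.lin _ _)
  zero_smul φ := BarHom.ext fun a => (congrArg φ.lin (mul_zero a)).trans (map_zero φ.lin)

variable {E V} in
lemma BarHom.smul_lin (e : E) (φ : BarHom E V) (a : Λ) : (e • φ).lin a = φ.lin (a * e) := rfl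

variable {M : Type u} [AddCommGroup M] [Module Λ M]

variable {E V} in
/-- The map `s a ⊗ x ↦ G(x)(a)`. -/
def uncurryAdd (G : M →ₗ[E] BarHom E V) : OmegaMod E M →+ V :=
  OmegaMod.lift (AddMonoidHom.mk' (fun a => AddMonoidHom.mk' (fun x => (G x).lin a)
      (fun x y => by rw [map_add, BarHom.add_lin]))
      (fun a b => AddMonoidHom.ext fun x => map_add (G x).lin a b))
    (fun e x => (G x).lin_coe e) (fun a e x => by
      change (G x).lin (a * e) = (G (e • x)).lin a
      rw [map_smul, BarHom.smul_lin])

variable {E V} in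
lemma uncurryAdd_form (G : M →ₗ[E] BarHom E V) (a : Λ) (x : M) :
    uncurryAdd G (form E a x) = (G x).lin a := OmegaMod.lift_form _ _ _ _ _

variable {E V} in
/-- The element `a ↦ F(s a ⊗ x)` of `Hom_E(Λ / E, V)`. -/
def curryVal (F : OmegaMod E M →ₗ[E] V) (x : M) : BarHom E V :=
  ⟨{ toFun := fun a => F (form E a x)
     map_add' := fun a b => by rw [form_add_left, map_add]
     map_smul' := fun e a => by
      rw [Subring.smul_def, smul_eq_mul, ← coe_smul_form, map_smul, RingHom.id_apply] },
    fun e => by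
      change F (form E (e : Λ) x) = 0
      rw [form_coe, map_zero]⟩

variable {E V} in
lemma curryVal_lin (F : OmegaMod E M →ₗ[E] V) (x : M) (a : Λ) :
    (curryVal F x).lin a = F (form E a x) := rfl

variable {E V} in
/-- The `E`-linear map `x ↦ (a ↦ F(s a ⊗ x))`. -/
def curryLin (F : OmegaMod E M →ₗ[E] V) : M →ₗ[E] BarHom E V where
  toFun := curryVal F
  map_add' x y := BarHom.ext fun a => by
    rw [BarHom.add_lin, curryVal_lin, curryVal_lin, curryVal_lin, form_add, map_add]
  map_smul' e x := BarHom.ext fun a => by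
    rw [RingHom.id_apply, BarHom.smul_lin, curryVal_lin, curryVal_lin, form_mul]
    rfl

variable {E V} in
/-- The `E`-linear map `s a ⊗ x ↦ G(x)(a)`. -/
def uncurryLin (G : M →ₗ[E] BarHom E V) : OmegaMod E M →ₗ[E] V where
  toFun := uncurryAdd G
  map_add' := map_add _
  map_smul' e t := by
    rw [RingHom.id_apply]
    induction t using OmegaMod.induction_on with
    | h0 => simp
    | ht a x =>
      rw [coe_smul_form, uncurryAdd_form, uncurryAdd_form]
      exact (G x).lin.map_smul e a
    | ha s t hs ht => rw [smul_add, map_add, map_add, hs, ht, smul_add]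

variable {E V} in
lemma uncurryLin_form (G : M →ₗ[E] BarHom E V) (a : Λ) (x : M) :
    uncurryLin G (form E a x) = (G x).lin a := uncurryAdd_form G a x

/-- The bijection `Hom_E(Λ / E ⊗_E M, V) ≃ Hom_E(M, Hom_E(Λ / E, V))`. -/
def curryForm : (OmegaMod E M →ₗ[E] V) ≃+ (M →ₗ[E] BarHom E V) where
  toFun := curryLin
  invFun := uncurryLin
  left_inv F := OmegaMod.linearMap_ext fun a x => uncurryLin_form (curryLin F) a x
  right_inv G := LinearMap.ext fun x => BarHom.ext fun a => uncurryLin_form G a x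
  map_add' _ _ := rfl

lemma curryForm_apply_lin (F : OmegaMod E M →ₗ[E] V) (x : M) (a : Λ) :
    (curryForm E V F x).lin a = F (form E a x) := rfl

lemma curryForm_comp (F : OmegaMod E M →ₗ[E] V) (g : M →ₗ[Λ] M) :
    curryForm E V (F ∘ₗ (OmegaMod.map g).restrictScalars E) =
      curryForm E V F ∘ₗ g.restrictScalars E :=
  LinearMap.ext fun x => BarHom.ext fun a => by
    rw [curryForm_apply_lin, LinearMap.comp_apply, LinearMap.comp_apply, curryForm_apply_lin]
    exact congrArg F (OmegaMod.map_form g a x)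

/-- The `Λ`-linear bijection
`Hom_E((Λ / E)^{⊗ (k + 1)} ⊗_E Λ, V) ≃ Hom_E((Λ / E)^{⊗ k} ⊗_E Λ, Hom_E(Λ / E, V))`. -/
def HomT.curry (k : ℕ) : HomT E V (k + 1) ≃ₗ[Λ] HomT E (BarHom E V) k :=
  { curryForm E V (M := T E k) with
    map_smul' := fun b f => curryForm_comp E V f.lin (rmulT E k b) }

variable {E V} in
/-- An element of `HomT E V 0` as a linear map on `Λ`. -/
def HomT.lin₀ (f : HomT E V 0) : Λ →ₗ[E] V := f

variable {E V} in
lemma HomT.smul_lin₀ (b : Λ) (f : HomT E V 0) (x : Λ) : (b • f).lin₀ x = f.lin₀ (x * b) := rfl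

/-- Since `E` is semisimple, the coinduced module `Hom_E(Λ, V)` is injective. -/
lemma HomT.injective_zero [IsSemisimpleRing E] : Module.Injective Λ (HomT E V 0) := by
  refine Module.Baer.injective fun I g => ?_
  have hV : Module.Injective E V := Module.injective_of_isSemisimpleRing E V
  let g₀ : I →ₗ[E] V :=
    { toFun := fun x => (g x).lin₀ 1
      map_add' := fun x y => by rw [map_add]; rfl
      map_smul' := fun e x => by
        change (g ((e : Λ) • x)).lin₀ 1 = e • (g x).lin₀ 1
        rw [map_smul, HomT.smul_lin₀, ← map_smul, one_mul, Subring.smul_def, smul_eq_mul, mul_one] }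
  obtain ⟨G₀, hG₀⟩ := hV.out (I.subtype.restrictScalars E) Subtype.val_injective g₀
  let G' (b : Λ) : Λ →ₗ[E] V :=
    { toFun := fun x => G₀ (x * b)
      map_add' := fun x y => by rw [add_mul, map_add]
      map_smul' := fun e x => by rw [smul_mul_assoc, map_smul, RingHom.id_apply] }
  let G : Λ →ₗ[Λ] HomT E V 0 :=
    { toFun := G'
      map_add' := fun b c => LinearMap.ext fun x : Λ =>
        (congrArg G₀ (mul_add x b c)).trans (map_add G₀ _ _)
      map_smul' := fun c b => LinearMap.ext fun x : Λ => congrArg G₀ (mul_assoc x c b).symm }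
  refine ⟨G, fun b hb => LinearMap.ext fun x : Λ => ?_⟩
  change G₀ (x * b) = (g ⟨b, hb⟩).lin₀ x
  refine (hG₀ (x • ⟨b, hb⟩)).trans ?_
  change (g (x • ⟨b, hb⟩)).lin₀ 1 = _
  rw [map_smul, HomT.smul_lin₀, one_mul]

/-- The factors of the Yoneda complex are injective. -/
lemma HomT.injective [IsSemisimpleRing E] (k : ℕ) : ∀ (V : Type u) [AddCommGroup V] [Module E V],
    Module.Injective Λ (HomT E V k) := by
  induction k with
  | zero => exact fun V => HomT.injective_zero E V
  | succ k ih =>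
    intro V _ _
    exact injective_of_retract (HomT.curry E V k).toLinearMap (HomT.curry E V k).symm.toLinearMap
      (fun x => (HomT.curry E V k).symm_apply_apply x) (ih (BarHom E V))

/-- The Yoneda complex consists of injective modules. -/
lemma yoneda_injective [IsSemisimpleRing E] (X : CochainComplex (ModuleCat.{u} Λ) ℤ) (n : ℤ) :
    Module.Injective Λ (((yonedaFun E).obj X).X n) := by
  have h (i : {i : ℕ × ℤ // i.2 + i.1 = n}) : Module.Injective Λ (HomT E (X.X i.1.2) i.1.1) :=
    HomT.injective E _ _
  have := Module.Injective.pi Λ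
    (fun i : {i : ℕ × ℤ // i.2 + i.1 = n} => HomT E (X.X i.1.2) i.1.1)
  let e : ((yonedaFun E).obj X).X n ≃ₗ[Λ]
      ∀ i : {i : ℕ × ℤ // i.2 + i.1 = n}, HomT E (X.X i.1.2) i.1.1 :=
    { toFun := fun f => f
      invFun := fun f => f
      map_add' := fun f g => rfl
      map_smul' := fun b f => rfl
      left_inv := fun f => rfl
      right_inv := fun f => rfl }
  exact injective_of_retract e.toLinearMap e.symm.toLinearMap e.symm_apply_apply this

end YonedaInjective

/-! ### Graded linear maps and the Yoneda complex -/

section Graded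

open CochainComplex CochainComplex.HomComplex

variable {Λ : Type u} [Ring Λ] (E : Subring Λ)

/-- Graded `E`-linear maps of degree `e` between complexes of `Λ`-modules. -/
def EFam (X X' : CochainComplex (ModuleCat.{u} Λ) ℤ) (e : ℤ) : Type u :=
  ∀ i : {i : ℤ × ℤ // i.1 + e = i.2}, X.X i.1.1 →ₗ[E] X'.X i.1.2

variable {E} {X X' X'' : CochainComplex (ModuleCat.{u} Λ) ℤ} {e e' e'' : ℤ}

instance : AddCommGroup (EFam E X X' e) :=
  inferInstanceAs (AddCommGroup (∀ i : {i : ℤ × ℤ // i.1 + e = i.2}, X.X i.1.1 →ₗ[E] X'.X i.1.2))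

/-- The component from degree `m` to degree `m'`. -/
def EFam.v (g : EFam E X X' e) (m m' : ℤ) (h : m + e = m') : X.X m →ₗ[E] X'.X m' := g ⟨(m, m'), h⟩

/-- The graded map with prescribed components. -/
def EFam.mk (g : ∀ m m' : ℤ, m + e = m' → (X.X m →ₗ[E] X'.X m')) : EFam E X X' e :=
  fun i => g i.1.1 i.1.2 i.2

lemma EFam.mk_v (g : ∀ m m' : ℤ, m + e = m' → (X.X m →ₗ[E] X'.X m')) (m m' h) :
    (EFam.mk g).v m m' h = g m m' h := rfl

lemma EFam.ext {g g' : EFam E X X' e} (h : ∀ m m' hm, g.v m m' hm = g'.v m m' hm) : g = g' :=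
  funext fun i => h i.1.1 i.1.2 i.2

lemma EFam.neg_v (g : EFam E X X' e) (m m' hm) : (-g).v m m' hm = -g.v m m' hm := rfl

lemma EFam.add_v (g g' : EFam E X X' e) (m m' hm) :
    (g + g').v m m' hm = g.v m m' hm + g'.v m m' hm := rfl

lemma EFam.zero_v (m m' hm) : (0 : EFam E X X' e).v m m' hm = 0 := rfl

/-- Postcomposition with a graded `E`-linear map, on the Yoneda complex. -/
def YEDeg (g : EFam E X X' e) (n n' : ℤ) (h : n + e = n') : YDeg E X n →ₗ[Λ] YDeg E X' n' where
  toFun f := YDeg.mk fun k m hm => g.v (m - e) m (by lia) ∘ₗ f.v k (m - e) (by lia)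
  map_add' f f' := YDeg.ext fun k m hm => LinearMap.comp_add _ _ _
  map_smul' b f := rfl

lemma YEDeg_v (g : EFam E X X' e) (n n' : ℤ) (h : n + e = n') (f : YDeg E X n) (k m hm) (m₀ : ℤ)
    (h₀ : m₀ + e = m) :
    (YEDeg g n n' h f).v k m hm = g.v m₀ m h₀ ∘ₗ f.v k m₀ (by lia) := by
  obtain rfl : m₀ = m - e := by lia
  rfl

/-- Postcomposition with a graded `E`-linear map, as a cochain of `Λ`-linear maps. -/
def YE (g : EFam E X X' e) : Cochain ((yonedaFun E).obj X) ((yonedaFun E).obj X') e :=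
  Cochain.mk fun n n' h => ModuleCat.ofHom (YEDeg g n n' h)

/-- The value of a cochain between Yoneda complexes on an element. -/
def yapp (z : Cochain ((yonedaFun E).obj X) ((yonedaFun E).obj X') e) (n n' : ℤ) (h : n + e = n') :
    YDeg E X n →ₗ[Λ] YDeg E X' n' := (z.v n n' h).hom

lemma yapp_ext {z z' : Cochain ((yonedaFun E).obj X) ((yonedaFun E).obj X') e}
    (h : ∀ n n' hn f k m hm, (yapp z n n' hn f).v k m hm = (yapp z' n n' hn f).v k m hm) :
    z = z' :=
  Cochain.ext _ _ fun n n' hn => ModuleCat.hom_ext <| LinearMap.ext fun f =>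
    YDeg.ext fun k m hm => h n n' hn f k m hm

lemma yapp_YE (g : EFam E X X' e) (n n' h) : yapp (YE g) n n' h = YEDeg g n n' h := rfl

lemma yapp_comp (z : Cochain ((yonedaFun E).obj X) ((yonedaFun E).obj X') e)
    (z' : Cochain ((yonedaFun E).obj X') ((yonedaFun E).obj X'') e') (h : e + e' = e'')
    (n n' n'' : ℤ) (hn : n + e = n') (hn' : n' + e' = n'') (f : YDeg E X n) :
    yapp (z.comp z' h) n n'' (by lia) f = yapp z' n' n'' hn' (yapp z n n' hn f) := by
  rw [yapp, Cochain.comp_v z z' h n n' n'' hn hn']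
  rfl

lemma yapp_add (z z' : Cochain ((yonedaFun E).obj X) ((yonedaFun E).obj X') e) (n n' h) :
    yapp (z + z') n n' h = yapp z n n' h + yapp z' n n' h := rfl

lemma yapp_units_smul (c : ℤˣ) (z : Cochain ((yonedaFun E).obj X) ((yonedaFun E).obj X') e)
    (n n' h f k m hm) :
    (yapp (c • z) n n' h f).v k m hm = c • (yapp z n n' h f).v k m hm := by
  obtain rfl | rfl := Int.units_eq_one_or c
  · rw [one_smul, one_smul]
  · rw [Units.neg_smul, one_smul, Units.neg_smul, one_smul]
    rfl

lemma yapp_theta (n : ℤ) :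
    yapp (Cochain.ofHom (theta E X)) n n (add_zero n) = thetaDeg E n := by
  rw [yapp, Cochain.ofHom_v]
  rfl

/-- The composite of graded `E`-linear maps. -/
def EFam.comp (g : EFam E X X' e) (g' : EFam E X' X'' e') (h : e + e' = e'') :
    EFam E X X'' e'' :=
  EFam.mk fun m m'' _ => g'.v (m + e) m'' (by lia) ∘ₗ g.v m (m + e) rfl

lemma EFam.comp_v (g : EFam E X X' e) (g' : EFam E X' X'' e') (h : e + e' = e'')
    (m m' m'' : ℤ) (hm : m + e = m') (hm' : m' + e' = m'') :
    (g.comp g' h).v m m'' (by lia) = g'.v m' m'' hm' ∘ₗ g.v m m' hm := by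
  subst hm
  rfl

lemma YE_comp (g : EFam E X X' e) (g' : EFam E X' X'' e') (h : e + e' = e'') :
    (YE g).comp (YE g') h = YE (g.comp g' h) := by
  refine yapp_ext fun n n' hn f k m hm => ?_
  rw [yapp_comp _ _ h n (n + e) n' rfl (by lia), yapp_YE, yapp_YE, yapp_YE,
    YEDeg_v _ _ _ _ _ _ _ _ (m - e') (by lia), YEDeg_v _ _ _ _ _ _ _ _ (m - e' - e) (by lia),
    YEDeg_v _ _ _ _ _ _ _ _ (m - e' - e) (by lia),
    EFam.comp_v g g' h (m - e' - e) (m - e') m (by lia) (by lia)]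
  rfl

lemma YE_neg (g : EFam E X X' e) : YE (-g) = -YE g := yapp_ext fun _ _ _ _ _ _ _ => rfl

lemma YE_add (g g' : EFam E X X' e) : YE (g + g') = YE g + YE g' :=
  yapp_ext fun _ _ _ _ _ _ _ => rfl

lemma YE_zero : YE (0 : EFam E X X' e) = 0 := yapp_ext fun _ _ _ _ _ _ _ => rfl

/-- The commutator of a graded `E`-linear map with the differentials. -/
def dFam (g : EFam E X X' e) (he : e + 1 = e') : EFam E X X' e' := EFam.mk fun m m' h =>
  (X'.d (m' - 1) m').hom.restrictScalars E ∘ₗ g.v m (m' - 1) (by lia) +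
    e'.negOnePow • (g.v (m + 1) m' (by lia) ∘ₗ (X.d m (m + 1)).hom.restrictScalars E)

lemma dFam_v (g : EFam E X X' e) (he : e + 1 = e') (m m' : ℤ) (h : m + e' = m') (k l : ℤ)
    (hk : m + e = k) (hl : m + 1 = l) :
    (dFam g he).v m m' h = (X'.d k m').hom.restrictScalars E ∘ₗ g.v m k hk +
      e'.negOnePow • (g.v l m' (by lia) ∘ₗ (X.d m l).hom.restrictScalars E) := by
  obtain rfl : k = m' - 1 := by lia
  subst hl
  rfl

/-- The failure of a graded `E`-linear map to be `Λ`-linear, `s a ⊗ x ↦ a g(x) - g(a x)`. -/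
def extFam (g : EFam E X X' e) (he : e + 1 = e') : EFam E (omegaCx E X) X' e' :=
  EFam.mk fun m m' h => extDiff E (g.v (m + 1) m' (by lia))

lemma extDiff_comp_thetaX {k : ℕ} {m : ℤ} {N : ModuleCat.{u} Λ} (g : X.X (m + 1) →ₗ[E] N)
    (f : T E k →ₗ[E] X.X (m + 1)) :
    (show (omegaCx E X).X m →ₗ[E] N from extDiff E g) ∘ₗ thetaX E f =
      extT E (g ∘ₗ f) - g ∘ₗ extT E f := by
  refine T.hom_ext E fun a w => ?_
  rw [LinearMap.sub_apply, extT_cons, LinearMap.comp_apply g, LinearMap.comp_apply g,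
    LinearMap.comp_apply g, extT_cons, map_sub]
  refine (congrArg (extDiff E g) (thetaX_cons E f a w)).trans ?_
  rw [extDiff_form]
  abel

lemma yoneda_d (X : CochainComplex (ModuleCat.{u} Λ) ℤ) (n : ℤ) :
    ((yonedaFun E).obj X).d n (n + 1) = ModuleCat.ofHom (yonedaD n) := yonedaObj_d E X n

lemma YDeg.units_smul_v {n : ℤ} (c : ℤˣ) (f : YDeg E X n) (k m hm) :
    (c • f).v k m hm = c • f.v k m hm := by
  obtain rfl | rfl := Int.units_eq_one_or c
  · rw [one_smul, one_smul]
  · rw [Units.neg_smul, one_smul, Units.neg_smul, one_smul]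
    rfl

lemma yapp_δ (z : Cochain ((yonedaFun E).obj X) ((yonedaFun E).obj X') e) (he : e + 1 = e')
    (n n' : ℤ) (hn : n + e = n') (hn' : n + e' = n' + 1) (h : n + 1 + e = n' + 1)
    (f : YDeg E X n) :
    yapp (δ e e' z) n (n' + 1) hn' f =
      yonedaD n' (yapp z n n' hn f) + e'.negOnePow • yapp z (n + 1) (n' + 1) h (yonedaD n f) := by
  rw [yapp, δ_v e e' he _ n (n' + 1) hn' n' (n + 1) (by lia) rfl, yoneda_d, yoneda_d]
  obtain h | h := Int.units_eq_one_or e'.negOnePow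
  · rw [h, one_smul, one_smul]
    rfl
  · rw [h, Units.neg_smul, one_smul, Units.neg_smul, one_smul]
    rfl

lemma δ_YE_sign {M N : Type u} [AddCommGroup M] [Module E M] [AddCommGroup N] [Module E N]
    {n e e' : ℤ} (he : e + 1 = e') (f g : M →ₗ[E] N) :
    (n + e + 1).negOnePow • f + e'.negOnePow • (n + 1).negOnePow • g =
      e'.negOnePow • n.negOnePow • (f - g) := by
  rw [smul_smul, smul_smul, show n + e + 1 = e' + n by lia, Int.negOnePow_add, Int.negOnePow_succ,
    mul_neg, Units.neg_smul, smul_sub, sub_eq_add_neg]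

/-- The differential of the cochain induced by a graded `E`-linear map: besides the differential
of that map there is a term measuring its failure to be `Λ`-linear. -/
lemma δ_YE (g : EFam E X X' e) (he : e + 1 = e') :
    δ e e' (YE g) = YE (dFam g he) +
      e'.negOnePow • (Cochain.ofHom (theta E X)).comp (YE (extFam g he)) (zero_add e') := by
  refine yapp_ext fun n n' hn f k m hm => ?_
  obtain rfl : n' = n + e + 1 := by lia
  have k1 : n + 1 + e = n + e + 1 := by lia
  have k2 : m - 1 + k = n + e := by lia
  have k3 : m - e' + e = m - 1 := by lia
  have k4 : m - e' + 1 + e = m := by lia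
  have k5 : m - e' + e' = m := by lia
  have k6 : m - e' + k = n := by lia
  rw [yapp_δ (YE g) he n (n + e) rfl hn k1, yapp_add, LinearMap.add_apply, YDeg.add_v,
    YDeg.add_v, YDeg.units_smul_v, yapp_units_smul,
    yapp_comp _ _ _ n n (n + e + 1) (add_zero n) hn, yapp_theta, yapp_YE, yapp_YE,
    yapp_YE, yapp_YE, yonedaD_v, YDeg.dIn_eq _ k m hm (m - 1) k2,
    YEDeg_v g n (n + e) rfl f k (m - 1) k2 (m - e') k3,
    YEDeg_v g _ _ _ _ k m hm (m - e' + 1) k4,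
    YEDeg_v (dFam g he) _ _ _ f k m hm (m - e') k5,
    YEDeg_v (extFam g he) _ _ _ _ k m hm (m - e') k5, yonedaD_v,
    YDeg.dIn_eq f k (m - e' + 1) _ (m - e') k6, dFam_v g he _ _ _ (m - 1) (m - e' + 1) k3 rfl,
    LinearMap.comp_add, smul_add, LinearMap.add_comp, units_smul_comp]
  simp only [LinearMap.comp_assoc]
  refine (add_add_add_comm _ _ _ _).trans (congrArg₂ (· + ·) rfl ?_)
  cases k with
  | zero =>
    simp only [YDeg.dEx_zero, thetaDeg_v, thetaV, LinearMap.comp_zero, smul_zero, add_zero]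
  | succ k =>
    have k8 : m + k = n + e := by push_cast at hm; lia
    have k9 : m - e' + 1 + k = n := by lia
    rw [thetaDeg_v, thetaV, YDeg.dEx_succ _ k m _ k8, YDeg.dEx_succ f k _ _ k9,
      YEDeg_v g n (n + e) rfl f k m k8 (m - e' + 1) k4, comp_units_smul, comp_units_smul,
      δ_YE_sign he]
    exact congrArg (fun f => e'.negOnePow • n.negOnePow • f)
      (extDiff_comp_thetaX (g.v (m - e' + 1) m k4) (f.v k (m - e' + 1) k9)).symm

end Graded

/-! ### Graded `Λ`-linear maps, and the split sequence `Ω_nc(M) ⟶ Λ ⊗_E M ⟶ M` -/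

section Basic

open CochainComplex CochainComplex.HomComplex

variable {Λ : Type u} [Ring Λ] {E : Subring Λ}

section LinearFam

variable {X X' X'' : CochainComplex (ModuleCat.{u} Λ) ℤ} {e e' e'' : ℤ}

variable (E) in
/-- A cochain of `Λ`-linear maps, as a graded `E`-linear map. -/
def LFam (z : Cochain X X' e) : EFam E X X' e :=
  EFam.mk fun m m' h => (z.v m m' h).hom.restrictScalars E

lemma LFam_v (z : Cochain X X' e) (m m' h) :
    (LFam E z).v m m' h = (z.v m m' h).hom.restrictScalars E := rfl

variable (E) in
/-- Postcomposition with a cochain of `Λ`-linear maps, on Yoneda complexes. -/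
def YL (z : Cochain X X' e) : Cochain ((yonedaFun E).obj X) ((yonedaFun E).obj X') e :=
  YE (LFam E z)

lemma extFam_LFam (z : Cochain X X' e) (he : e + 1 = e') : extFam (LFam E z) he = 0 := by
  refine EFam.ext fun m m' h => OmegaMod.linearMap_ext fun a x => ?_
  refine (extDiff_form E _ a x).trans ?_
  rw [LFam_v, LinearMap.restrictScalars_apply, LinearMap.restrictScalars_apply, map_smul, sub_self]
  rfl

lemma dFam_LFam (z : Cochain X X' e) (he : e + 1 = e') :
    dFam (LFam E z) he = LFam E (δ e e' z) := by
  refine EFam.ext fun m m' h => ?_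
  rw [dFam_v _ he m m' h (m + e) (m + 1) rfl rfl, LFam_v, LFam_v, LFam_v,
    δ_v e e' he z m m' h (m + e) (m + 1) (by lia) rfl]
  obtain h | h := Int.units_eq_one_or e'.negOnePow
  · rw [h, one_smul, one_smul]
    rfl
  · rw [h, Units.neg_smul, one_smul, Units.neg_smul, one_smul]
    rfl

lemma δ_YL (z : Cochain X X' e) (he : e + 1 = e') : δ e e' (YL E z) = YL E (δ e e' z) := by
  rw [YL, δ_YE _ he, extFam_LFam, YE_zero, Cochain.comp_zero, smul_zero, add_zero, dFam_LFam]
  rfl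

lemma YL_comp (z : Cochain X X' e) (z' : Cochain X' X'' e') (h : e + e' = e'') :
    (YL E z).comp (YL E z') h = YL E (z.comp z' h) := by
  refine (YE_comp (LFam E z) (LFam E z') h).trans (congrArg YE ?_)
  refine EFam.ext fun m m'' hm => ?_
  rw [EFam.comp_v _ _ h m (m + e) m'' rfl (by lia), LFam_v, LFam_v, LFam_v,
    Cochain.comp_v _ _ h m (m + e) m'' rfl (by lia)]
  rfl

lemma YL_add (z z' : Cochain X X' e) : YL E (z + z') = YL E z + YL E z' :=
  yapp_ext fun _ _ _ _ _ _ _ => rfl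

lemma YL_zero : YL E (0 : Cochain X X' e) = 0 :=
  yapp_ext fun _ _ _ _ _ _ _ => rfl

lemma YL_ofHom (f : X ⟶ X') : YL E (Cochain.ofHom f) = Cochain.ofHom ((yonedaFun E).map f) := by
  refine yapp_ext fun n n' hn g k m hm => ?_
  obtain rfl : n' = n := by lia
  rw [YL, yapp_YE, YEDeg_v _ _ _ _ _ _ _ _ m (by lia), LFam_v, Cochain.ofHom_v, yapp,
    Cochain.ofHom_v]
  rfl

end LinearFam

section IndMaps

variable {M N : Type u} [AddCommGroup M] [Module Λ M] [AddCommGroup N] [Module Λ N]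

lemma coe_smul_ind (e : E) (a : Λ) (x : M) : e • ind E a x = ind E ((e : Λ) * a) x :=
  smul_ind (e : Λ) a x

lemma IndMod.linearMap_extE {P : Type*} [AddCommGroup P] [Module E P]
    {f g : IndMod E M →ₗ[E] P} (h : ∀ a x, f (ind E a x) = g (ind E a x)) : f = g := by
  ext t
  induction t using IndMod.induction_on with
  | h0 => simp
  | ht a x => exact h a x
  | ha s t hs ht => simp [hs, ht]

variable (E M)

/-- `IndMod.sigma` as an additive map. -/
def IndMod.sigmaAdd : IndMod E M →+ OmegaMod E M :=
  IndMod.lift (formHom E) (fun a e x => form_mul E a e x)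

variable {M} in
lemma IndMod.sigmaAdd_ind (a : Λ) (x : M) : IndMod.sigmaAdd E M (ind E a x) = form E a x :=
  IndMod.lift_ind _ _ a x

/-- The `E`-linear map `a ⊗ x ↦ s a ⊗ x`. -/
def IndMod.sigma : IndMod E M →ₗ[E] OmegaMod E M where
  toFun := IndMod.sigmaAdd E M
  map_add' := map_add _
  map_smul' e t := by
    rw [RingHom.id_apply]
    induction t using IndMod.induction_on with
    | h0 => simp
    | ht a x =>
      rw [coe_smul_ind, IndMod.sigmaAdd_ind, IndMod.sigmaAdd_ind, coe_smul_form]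
    | ha s t hs ht => rw [smul_add, map_add, map_add, hs, ht, smul_add]

variable {M} in
@[simp] lemma IndMod.sigma_ind (a : Λ) (x : M) : IndMod.sigma E M (ind E a x) = form E a x :=
  IndMod.sigmaAdd_ind E a x

/-- The `E`-linear map `x ↦ 1 ⊗ x`. -/
def IndMod.eta : M →ₗ[E] IndMod E M where
  toFun := ind E 1
  map_add' := ind_add E 1
  map_smul' e x := by
    rw [RingHom.id_apply, coe_smul_ind, mul_one]
    exact (ind_mul E 1 e x).symm.trans (by rw [one_mul])

variable {M} in
@[simp] lemma IndMod.eta_apply (x : M) : IndMod.eta E M x = ind E 1 x := rfl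

/-- The `Λ`-linear map `s a ⊗ x ↦ a ⊗ x - 1 ⊗ a x`. -/
def OmegaMod.kappa : OmegaMod E M →ₗ[Λ] IndMod E M where
  toFun := IndMod.extAux 1
  map_add' := map_add _
  map_smul' b t := by
    rw [RingHom.id_apply]
    induction t using OmegaMod.induction_on with
    | h0 => simp
    | ht a x =>
      simp only [smul_form, map_sub, IndMod.extAux_form, one_mul, smul_sub, smul_ind, mul_one,
        mul_smul]
      abel
    | ha s t hs ht => rw [smul_add, map_add, map_add, hs, ht, smul_add]

variable {M} in
@[simp] lemma OmegaMod.kappa_form (a : Λ) (x : M) :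
    OmegaMod.kappa E M (form E a x) = ind E a x - ind E 1 (a • x) :=
  (IndMod.extAux_form 1 a x).trans (by rw [one_mul])

lemma IndMod.eps_kappa : IndMod.eps ∘ₗ OmegaMod.kappa E M = 0 :=
  OmegaMod.linearMap_ext fun a x => by simp

lemma IndMod.sigma_kappa :
    IndMod.sigma E M ∘ₗ (OmegaMod.kappa E M).restrictScalars E = LinearMap.id :=
  OmegaMod.linearMap_ext fun a x => by simp [form_one]

lemma IndMod.eps_eta : IndMod.eps.restrictScalars E ∘ₗ IndMod.eta E M = LinearMap.id :=
  LinearMap.ext fun x => by simp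

lemma IndMod.eta_eps_add_kappa_sigma :
    IndMod.eta E M ∘ₗ IndMod.eps.restrictScalars E +
      (OmegaMod.kappa E M).restrictScalars E ∘ₗ IndMod.sigma E M = LinearMap.id :=
  IndMod.linearMap_extE fun a x => by simp

lemma IndMod.extDiff_eta :
    extDiff E (IndMod.eta E M) = (OmegaMod.kappa E M).restrictScalars E :=
  OmegaMod.linearMap_ext fun a x => by simp [smul_ind]

lemma IndMod.extDiff_sigma :
    extDiff E (IndMod.sigma E M) = -OmegaMod.mapE (IndMod.eps.restrictScalars E) := by
  refine OmegaMod.linearMap_ext fun b t => ?_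
  rw [extDiff_form, LinearMap.neg_apply, OmegaMod.mapE_form]
  induction t using IndMod.induction_on with
  | h0 =>
    have h : form E b (0 : M) = 0 := map_zero (formHom E b)
    simp [h]
  | ht a x => simp [smul_ind, smul_form]
  | ha s t hs ht =>
    rw [smul_add, map_add, map_add, map_add, form_add, smul_add, neg_add, ← hs, ← ht]
    abel

variable {M}

lemma IndMod.sigma_map (g : M →ₗ[Λ] N) :
    IndMod.sigma E N ∘ₗ (IndMod.map g).restrictScalars E =
      (OmegaMod.map g).restrictScalars E ∘ₗ IndMod.sigma E M :=
  IndMod.linearMap_extE fun a x => by simp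

lemma IndMod.eta_comp (g : M →ₗ[Λ] N) :
    IndMod.eta E N ∘ₗ g.restrictScalars E = (IndMod.map g).restrictScalars E ∘ₗ IndMod.eta E M :=
  LinearMap.ext fun x => by simp

lemma OmegaMod.kappa_map (g : M →ₗ[Λ] N) :
    OmegaMod.kappa E N ∘ₗ OmegaMod.map g = IndMod.map g ∘ₗ OmegaMod.kappa E M :=
  OmegaMod.linearMap_ext fun a x => by simp

lemma IndMod.sigma_ext :
    IndMod.sigma E M ∘ₗ IndMod.ext.restrictScalars E =
      IndMod.eps.restrictScalars E := by
  refine IndMod.linearMap_extE fun a t => ?_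
  induction t using OmegaMod.induction_on with
  | h0 => simp [ind_zero]
  | ht b x => simp [IndMod.ext_ind, smul_form]
  | ha s t hs ht => rw [ind_add, map_add, map_add, hs, ht]

end IndMaps

end Basic

/-! ### Mapping cones and graded splittings -/

section Cones

open CochainComplex CochainComplex.HomComplex

variable {C : Type*} [Category C] [Preadditive C]
  {A B D B' N R R' : CochainComplex C ℤ}

/-- A sufficient criterion for a map out of the cone of `e` to be a homotopy equivalence: the map
`e` is split by a cochain `η` with complement `D`, suspended by `σ` and `κ`, and `θ` measures the
failure of `η` to be a cochain map. -/
lemma isIso_quotient_map_desc [HasBinaryBiproducts C] (e : A ⟶ B) (θ : B ⟶ D) (σ : Cochain A D (-1))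
    (η : Cochain B A 0) (κ : Cochain D A 1) (hσ : δ (-1) 0 (-σ) = Cochain.ofHom (e ≫ θ))
    (hη : δ 0 1 η = -(Cochain.ofHom θ).comp κ (zero_add 1)) (hκ : δ 1 2 κ = 0)
    (hκe : κ.comp (Cochain.ofHom e) (add_zero 1) = 0)
    (hκσ : κ.comp σ (add_neg_cancel 1) = Cochain.ofHom (𝟙 D))
    (hηe : η.comp (Cochain.ofHom e) (add_zero 0) = Cochain.ofHom (𝟙 B))
    (h : (Cochain.ofHom e).comp η (zero_add 0) + σ.comp κ (neg_add_cancel 1) =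
      Cochain.ofHom (𝟙 A)) :
    IsIso ((HomotopyCategory.quotient C (.up ℤ)).map (mappingCone.desc e (-σ) θ hσ)) := by
  let κ' : Cocycle D A 1 := Cocycle.mk (-κ) 2 rfl (by rw [δ_neg, hκ, neg_zero])
  have hκ' : δ 0 1 (0 : Cochain D B 0) + κ'.1.comp (Cochain.ofHom e) (add_zero 1) = 0 := by
    change _ + (-κ).comp _ _ = 0
    rw [δ_zero, zero_add, Cochain.neg_comp, hκe, neg_zero]
  have h1 : mappingCone.lift e κ' 0 hκ' ≫ mappingCone.desc e (-σ) θ hσ = 𝟙 D := by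
    apply Cochain.ofHom_injective
    rw [Cochain.ofHom_comp, mappingCone.ofHom_lift, mappingCone.ofHom_desc,
      mappingCone.liftCochain_descCochain, Cochain.zero_comp, add_zero, ← hκσ]
    change (-κ).comp (-σ) _ = _
    rw [Cochain.neg_comp, Cochain.comp_neg, neg_neg]
  have hlift : Cochain.ofHom (mappingCone.lift e κ' 0 hκ') =
      -κ.comp (mappingCone.inl e) (by lia) := by
    rw [mappingCone.ofHom_lift, mappingCone.liftCochain, Cochain.zero_comp, add_zero]
    exact Cochain.neg_comp _ _ _
  have h2 : Homotopy (𝟙 (mappingCone e))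
      (mappingCone.desc e (-σ) θ hσ ≫ mappingCone.lift e κ' 0 hκ') := by
    refine mappingCone.descHomotopy e _ _ 0 (η.comp (mappingCone.inl e) (zero_add (-1))) ?_ ?_
    · rw [Cochain.ofHom_comp, hlift, mappingCone.ofHom_desc, δ_zero, zero_add, Cochain.comp_id,
        ← Cochain.comp_assoc_of_second_is_zero_cochain,
        ← Cochain.comp_assoc_of_second_is_zero_cochain, mappingCone.inl_descCochain,
        Cochain.comp_neg, Cochain.neg_comp, neg_neg,
        ← Cochain.comp_assoc _ _ _ (neg_add_cancel 1) (by lia) (by lia), ← Cochain.add_comp, h,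
        Cochain.id_comp]
    · rw [Category.comp_id, mappingCone.inr_desc_assoc, Cochain.ofHom_comp, hlift,
        δ_zero_cochain_comp _ _ 0 (neg_add_cancel 1), mappingCone.δ_inl, Cochain.ofHom_comp,
        ← Cochain.comp_assoc_of_second_is_zero_cochain, hηe, Cochain.id_comp, hη,
        Cochain.comp_neg, Cochain.neg_comp, Int.negOnePow_neg, Int.negOnePow_one,
        Units.neg_smul, one_smul, neg_neg, Cochain.comp_assoc _ _ _ _ (add_neg_cancel 1) (by lia),
        add_assoc, add_neg_cancel, add_zero]
  refine ⟨(HomotopyCategory.quotient C (.up ℤ)).map (mappingCone.lift e κ' 0 hκ'), ?_, ?_⟩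
  · rw [← Functor.map_comp, ← HomotopyCategory.eq_of_homotopy _ _ h2, CategoryTheory.Functor.map_id]
  · rw [← Functor.map_comp, h1, CategoryTheory.Functor.map_id]

/-- Mapping cones preserve homotopy equivalences. -/
lemma isIso_quotient_map_mappingConeMap [HasBinaryBiproducts C] [HasZeroObject C]
    {A₁ B₁ A₂ B₂ : CochainComplex C ℤ} (f₁ : A₁ ⟶ B₁)
    (f₂ : A₂ ⟶ B₂) (a : A₁ ⟶ A₂) (b : B₁ ⟶ B₂) (h : f₁ ≫ b = a ≫ f₂)
    (ha : IsIso ((HomotopyCategory.quotient C (.up ℤ)).map a))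
    (hb : IsIso ((HomotopyCategory.quotient C (.up ℤ)).map b)) :
    IsIso ((HomotopyCategory.quotient C (.up ℤ)).map (mappingCone.map f₁ f₂ a b h)) := by
  rw [mappingCone.map_eq_mapOfHomotopy]
  exact Pretriangulated.isIso₃_of_isIso₁₂
    (mappingCone.trianglehMapOfHomotopy (Homotopy.ofEq h))
    (HomotopyCategory.mappingCone_triangleh_distinguished f₁)
    (HomotopyCategory.mappingCone_triangleh_distinguished f₂) ha hb

/-- A degreewise splitting `B' = B ⊕ N` of the cochain map `inc : B ⟶ B'`, in which the
differential of `B'` is that of `B ⊕ N` plus a component `∂` from `N` to `B`. -/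
structure GradedSplitting (inc : B ⟶ B') (N : CochainComplex C ℤ) where
  /-- the inclusion of the complement -/
  s : Cochain N B' 0
  /-- the projection to the complement -/
  r : Cochain B' N 0
  /-- the projection to `B` -/
  t : Cochain B' B 0
  /-- the off-diagonal component of the differential -/
  bd : Cochain N B 1
  δ_s : δ 0 1 s = bd.comp (Cochain.ofHom inc) (add_zero 1)
  s_r : s.comp r (zero_add 0) = Cochain.ofHom (𝟙 N)
  s_t : s.comp t (zero_add 0) = 0
  inc_r : (Cochain.ofHom inc).comp r (zero_add 0) = 0
  inc_t : (Cochain.ofHom inc).comp t (zero_add 0) = Cochain.ofHom (𝟙 B)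
  t_inc_add_r_s : t.comp (Cochain.ofHom inc) (zero_add 0) + r.comp s (zero_add 0) =
    Cochain.ofHom (𝟙 B')

namespace GradedSplitting

variable {inc : B ⟶ B'} (S : GradedSplitting inc N) {f : B ⟶ D} {f' : B' ⟶ D}

lemma eq_t_add_r {K : CochainComplex C ℤ} (z : Cochain B' K 1) :
    z = S.t.comp ((Cochain.ofHom inc).comp z (zero_add 1)) (zero_add 1) +
      S.r.comp (S.s.comp z (zero_add 1)) (zero_add 1) := by
  rw [← Cochain.comp_assoc_of_first_is_zero_cochain, ← Cochain.comp_assoc_of_first_is_zero_cochain,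
    ← Cochain.add_comp, S.t_inc_add_r_s, Cochain.id_comp]

lemma δ_r : δ 0 1 S.r = 0 := by
  have h1 := δ_ofHom_comp inc S.r 1
  have h2 := δ_zero_cochain_comp S.s S.r 1 (zero_add 1)
  rw [S.inc_r, δ_zero] at h1
  rw [S.s_r, δ_ofHom, Int.negOnePow_zero, one_smul, S.δ_s,
    Cochain.comp_assoc_of_second_is_zero_cochain, S.inc_r, Cochain.comp_zero, add_zero] at h2
  rw [S.eq_t_add_r (δ 0 1 S.r), ← h1, ← h2, Cochain.comp_zero, Cochain.comp_zero, add_zero]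

lemma δ_t : δ 0 1 S.t = -S.r.comp S.bd (zero_add 1) := by
  have h1 := δ_ofHom_comp inc S.t 1
  have h2 := δ_zero_cochain_comp S.s S.t 1 (zero_add 1)
  rw [S.inc_t, δ_ofHom] at h1
  rw [S.s_t, δ_zero, Int.negOnePow_zero, one_smul, S.δ_s,
    Cochain.comp_assoc_of_second_is_zero_cochain, S.inc_t, Cochain.comp_id] at h2
  rw [S.eq_t_add_r (δ 0 1 S.t), ← h1, eq_neg_of_add_eq_zero_left h2.symm, Cochain.comp_zero,
    zero_add, Cochain.comp_neg]

lemma δ_bd : δ 1 2 S.bd = 0 := by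
  have h := δ_comp_ofHom S.bd inc 2
  rw [← S.δ_s, δ_δ] at h
  rw [← Cochain.comp_id (δ 1 2 S.bd), ← S.inc_t, ← Cochain.comp_assoc_of_second_is_zero_cochain,
    ← h, Cochain.zero_comp]

/-- The cocycle `-∂`. -/
def cocycle : Cocycle N B 1 := Cocycle.mk (-S.bd) 2 rfl (by rw [δ_neg, S.δ_bd, neg_zero])

lemma cocycle_coe : S.cocycle.1 = -S.bd := rfl

lemma bd_comp (h : inc ≫ f' = f) (hs : S.s.comp (Cochain.ofHom f') (zero_add 0) = 0) :
    S.bd.comp (Cochain.ofHom f) (add_zero 1) = 0 := by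
  have h1 := δ_comp_ofHom S.s f' 1
  rw [hs, δ_zero, S.δ_s, Cochain.comp_assoc_of_second_is_zero_cochain, ← Cochain.ofHom_comp,
    h] at h1
  exact h1.symm

variable [HasBinaryBiproducts C]

/-- The map `N ⟶ Cone f` given by `-∂`. -/
def toCone (h : inc ≫ f' = f) (hs : S.s.comp (Cochain.ofHom f') (zero_add 0) = 0) :
    N ⟶ mappingCone f :=
  mappingCone.lift f S.cocycle 0 (by
    rw [δ_zero, zero_add, cocycle_coe, Cochain.neg_comp, S.bd_comp h hs, neg_zero])

variable (h : inc ≫ f' = f) (hs : S.s.comp (Cochain.ofHom f') (zero_add 0) = 0)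

lemma ofHom_toCone :
    Cochain.ofHom (S.toCone h hs) = -S.bd.comp (mappingCone.inl f) (add_neg_cancel 1) := by
  rw [toCone, mappingCone.ofHom_lift, mappingCone.liftCochain, Cochain.zero_comp, add_zero]
  exact Cochain.neg_comp _ _ _

/-- The map `Cone f ⟶ Cone f'` induced by `inc`. -/
def coneInc (h : inc ≫ f' = f) : mappingCone f ⟶ mappingCone f' :=
  mappingCone.map f f' inc (𝟙 D) (by rw [Category.comp_id, h])

lemma inl_coneInc :
    (mappingCone.inl f).comp (Cochain.ofHom (coneInc h)) (add_zero (-1)) =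
      (Cochain.ofHom inc).comp (mappingCone.inl f') (zero_add (-1)) := by
  rw [coneInc, mappingCone.map, mappingCone.inl_desc]

lemma inr_coneInc : mappingCone.inr f ≫ coneInc h = mappingCone.inr f' := by
  rw [coneInc, mappingCone.map, mappingCone.inr_desc, Category.id_comp]

/-- The map `Cone f' ⟶ Cone (N ⟶ Cone f)`. -/
def coneHom : mappingCone f' ⟶ mappingCone (S.toCone h hs) :=
  mappingCone.desc f' (S.r.comp (mappingCone.inl _) (zero_add (-1)) +
      (S.t.comp (mappingCone.inl f) (zero_add (-1))).comp (Cochain.ofHom (mappingCone.inr _))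
        (add_zero (-1)))
    (mappingCone.inr f ≫ mappingCone.inr _) (by
      have h1 : (S.t.comp (Cochain.ofHom f) (zero_add 0)) = Cochain.ofHom f' := by
        rw [← h, Cochain.ofHom_comp, ← Cochain.comp_assoc_of_second_is_zero_cochain,
          eq_sub_of_add_eq S.t_inc_add_r_s, Cochain.sub_comp, Cochain.id_comp,
          Cochain.comp_assoc_of_second_is_zero_cochain, hs, Cochain.comp_zero, sub_zero]
      rw [δ_add, δ_zero_cochain_comp _ _ 0 (neg_add_cancel 1), mappingCone.δ_inl, S.δ_r,
        Cochain.zero_comp, smul_zero, add_zero, Cochain.ofHom_comp, ofHom_toCone,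
        δ_comp_ofHom, δ_zero_cochain_comp _ _ 0 (neg_add_cancel 1), mappingCone.δ_inl, S.δ_t,
        Cochain.neg_comp, Int.negOnePow_neg, Int.negOnePow_one, Units.neg_smul, one_smul,
        Cochain.ofHom_comp, ← Cochain.comp_assoc_of_second_is_zero_cochain, h1,
        Cochain.add_comp]
      simp only [Cochain.neg_comp, Cochain.comp_neg, neg_neg, Cochain.ofHom_comp]
      rw [Cochain.comp_assoc S.r S.bd _ _ (add_neg_cancel 1) (by lia),
        Cochain.comp_assoc_of_third_is_zero_cochain S.r, add_left_comm, neg_add_cancel, add_zero,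
        Cochain.comp_assoc_of_third_is_zero_cochain])

lemma inl_coneHom :
    (mappingCone.inl f').comp (Cochain.ofHom (S.coneHom h hs)) (add_zero (-1)) =
      S.r.comp (mappingCone.inl _) (zero_add (-1)) +
        (S.t.comp (mappingCone.inl f) (zero_add (-1))).comp (Cochain.ofHom (mappingCone.inr _))
          (add_zero (-1)) := by
  rw [coneHom, mappingCone.inl_desc]

lemma inr_coneHom :
    mappingCone.inr f' ≫ S.coneHom h hs = mappingCone.inr f ≫ mappingCone.inr _ := by
  rw [coneHom, mappingCone.inr_desc]

lemma s_inl_coneHom :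
    (S.s.comp (mappingCone.inl f') (zero_add (-1))).comp (Cochain.ofHom (S.coneHom h hs))
      (add_zero (-1)) = mappingCone.inl _ := by
  rw [Cochain.comp_assoc_of_third_is_zero_cochain, inl_coneHom, Cochain.comp_add,
    ← Cochain.comp_assoc_of_first_is_zero_cochain, ← Cochain.comp_assoc_of_first_is_zero_cochain,
    ← Cochain.comp_assoc_of_first_is_zero_cochain, S.s_r, S.s_t, Cochain.id_comp,
    Cochain.zero_comp, Cochain.zero_comp, add_zero]

/-- Two maps out of a mapping cone agree if they do on both summands. -/
lemma coneHom_ext {g : B ⟶ D} {K : CochainComplex C ℤ} {a b : mappingCone g ⟶ K}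
    (h₁ : (mappingCone.inl g).comp (Cochain.ofHom a) (add_zero (-1)) =
      (mappingCone.inl g).comp (Cochain.ofHom b) (add_zero (-1)))
    (h₂ : mappingCone.inr g ≫ a = mappingCone.inr g ≫ b) : a = b := by
  apply Cochain.ofHom_injective
  rw [mappingCone.ext_cochain_from_iff g (-1) 0 (neg_add_cancel 1)]
  exact ⟨h₁, by rw [← Cochain.ofHom_comp, ← Cochain.ofHom_comp, h₂]⟩

lemma coneInc_coneHom : coneInc h ≫ S.coneHom h hs = mappingCone.inr _ := by
  refine coneHom_ext ?_ ?_
  · rw [Cochain.ofHom_comp, ← Cochain.comp_assoc_of_second_is_zero_cochain, inl_coneInc,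
      Cochain.comp_assoc_of_third_is_zero_cochain, inl_coneHom, Cochain.comp_add,
      ← Cochain.comp_assoc_of_first_is_zero_cochain,
      ← Cochain.comp_assoc_of_first_is_zero_cochain,
      ← Cochain.comp_assoc_of_first_is_zero_cochain, S.inc_r, S.inc_t, Cochain.id_comp,
      Cochain.zero_comp, zero_add]
  · rw [← Category.assoc, inr_coneInc, inr_coneHom]

/-- The inverse of `coneHom`. -/
def coneInv : mappingCone (S.toCone h hs) ⟶ mappingCone f' :=
  mappingCone.desc _ (S.s.comp (mappingCone.inl f') (zero_add (-1))) (coneInc h) (by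
    rw [δ_zero_cochain_comp _ _ 0 (neg_add_cancel 1), mappingCone.δ_inl, Cochain.ofHom_comp,
      ← Cochain.comp_assoc_of_second_is_zero_cochain, hs, Cochain.zero_comp, zero_add, S.δ_s,
      Cochain.ofHom_comp, ofHom_toCone, Cochain.neg_comp,
      Cochain.comp_assoc_of_third_is_zero_cochain, inl_coneInc,
      Cochain.comp_assoc_of_second_is_zero_cochain, Int.negOnePow_neg, Int.negOnePow_one,
      Units.neg_smul, one_smul])

lemma inr_coneInv : mappingCone.inr _ ≫ S.coneInv h hs = coneInc h := by
  rw [coneInv, mappingCone.inr_desc]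

lemma inl_coneInv : (mappingCone.inl _).comp (Cochain.ofHom (S.coneInv h hs)) (add_zero (-1)) =
    S.s.comp (mappingCone.inl f') (zero_add (-1)) := by
  rw [coneInv, mappingCone.inl_desc]

/-- `Cone f'` is the cone of `N ⟶ Cone f`. -/
lemma isIso_coneHom : IsIso (S.coneHom h hs) := by
  refine ⟨S.coneInv h hs, coneHom_ext ?_ ?_, coneHom_ext ?_ ?_⟩
  · rw [Cochain.ofHom_comp, ← Cochain.comp_assoc_of_second_is_zero_cochain, inl_coneHom,
      Cochain.add_comp, Cochain.comp_assoc_of_third_is_zero_cochain, inl_coneInv,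
      Cochain.comp_assoc_of_second_is_zero_cochain (S.t.comp _ _), ← Cochain.ofHom_comp,
      inr_coneInv, Cochain.comp_assoc_of_third_is_zero_cochain, inl_coneInc,
      ← Cochain.comp_assoc_of_first_is_zero_cochain,
      ← Cochain.comp_assoc_of_first_is_zero_cochain, add_comm, ← Cochain.add_comp,
      S.t_inc_add_r_s, Cochain.id_comp, Cochain.comp_id]
  · rw [← Category.assoc, inr_coneHom, Category.assoc, inr_coneInv, inr_coneInc,
      Category.comp_id]
  · rw [Cochain.ofHom_comp, ← Cochain.comp_assoc_of_second_is_zero_cochain, inl_coneInv,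
      s_inl_coneHom, Cochain.comp_id]
  · rw [← Category.assoc, inr_coneInv, coneInc_coneHom, Category.comp_id]

variable {φ : mappingCone f ⟶ R} {ε : N ⟶ R} (hφ : S.toCone h hs ≫ φ = ε)
  (Φ : mappingCone ε ⟶ R')

/-- The extension to `Cone f'` of a map on `Cone f`, with values in the target of a map out of the
cone of its restriction to `N`. -/
def extend : mappingCone f' ⟶ R' :=
  S.coneHom h hs ≫ mappingCone.map _ ε (𝟙 N) φ (by rw [hφ, Category.id_comp]) ≫ Φ

lemma coneInc_extend : coneInc h ≫ S.extend h hs hφ Φ = φ ≫ mappingCone.inr ε ≫ Φ := by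
  rw [extend, ← Category.assoc, coneInc_coneHom, mappingCone.map, mappingCone.inr_desc_assoc,
    Category.assoc]

lemma s_inl_extend :
    (S.s.comp (mappingCone.inl f') (zero_add (-1))).comp (Cochain.ofHom (S.extend h hs hφ Φ))
      (add_zero (-1)) = (mappingCone.inl ε).comp (Cochain.ofHom Φ) (add_zero (-1)) := by
  rw [extend, Cochain.ofHom_comp, ← Cochain.comp_assoc_of_second_is_zero_cochain, s_inl_coneHom,
    Cochain.ofHom_comp, ← Cochain.comp_assoc_of_second_is_zero_cochain, mappingCone.map,
    mappingCone.inl_desc, Cochain.id_comp]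

lemma isIso_quotient_map_extend [HasZeroObject C]
    (hi : IsIso ((HomotopyCategory.quotient C (.up ℤ)).map φ))
    (hi' : IsIso ((HomotopyCategory.quotient C (.up ℤ)).map Φ)) :
    IsIso ((HomotopyCategory.quotient C (.up ℤ)).map (S.extend h hs hφ Φ)) := by
  have := S.isIso_coneHom h hs
  have := isIso_quotient_map_mappingConeMap (S.toCone h hs) ε (𝟙 N) φ
    (by rw [hφ, Category.id_comp]) inferInstance hi
  rw [extend, Functor.map_comp, Functor.map_comp]
  infer_instance

end GradedSplitting

end Cones

/-! ### The cone of `𝒴(Λ, Λ ⊗_E M) ⟶ 𝒴(Λ, M)` -/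

section BasicCone

open CochainComplex CochainComplex.HomComplex

variable {Λ : Type u} [Ring Λ] (E : Subring Λ) (M : CochainComplex (ModuleCat.{u} Λ) ℤ)

/-- The complex `Λ ⊗_E M`. -/
def indCx : CochainComplex (ModuleCat.{u} Λ) ℤ where
  X n := (Ind E).obj (M.X n)
  d i j := (Ind E).map (M.d i j)
  shape i j h := by rw [M.shape _ _ h, Functor.map_zero]
  d_comp_d' i j k _ _ := by rw [← Functor.map_comp, M.d_comp_d, Functor.map_zero]

/-- The map `Λ ⊗_E M ⟶ M`, `a ⊗ x ↦ a x`. -/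
def indEps : indCx E M ⟶ M where
  f n := ModuleCat.ofHom IndMod.eps
  comm' i j _ := by
    ext1
    exact (IndMod.eps_map (M.d i j).hom).symm

variable {M} in
/-- The transport along an equality of degrees. -/
def castX {i j : ℤ} (h : i = j) : M.X i →ₗ[Λ] M.X j := (M.XIsoOfEq h).hom.hom

variable {M} in
lemma castX_rfl {i : ℤ} : castX (M := M) (rfl : i = i) = LinearMap.id := by
  rw [castX, HomologicalComplex.XIsoOfEq_rfl]
  rfl

/-- The component `Λ ⊗_E M^{m + 1} ⟶ Ω_nc(M)^m` of `a ⊗ x ↦ s a ⊗ x`. -/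
def sigmaX (m : ℤ) : (indCx E M).X (m + 1) →ₗ[E] (omegaCx E M).X m :=
  IndMod.sigma E (M.X (m + 1))

lemma sigmaX_d (m : ℤ) :
    ((omegaCx E M).d m (m + 1)).hom.restrictScalars E ∘ₗ sigmaX E M m =
      -(sigmaX E M (m + 1) ∘ₗ ((indCx E M).d (m + 1) (m + 1 + 1)).hom.restrictScalars E) :=
  LinearMap.ext fun t => congrArg Neg.neg
    (DFunLike.congr_fun (IndMod.sigma_map E (M.d (m + 1) (m + 1 + 1)).hom) t).symm

/-- The map `Λ ⊗_E M ⟶ Ω_nc(M)`, `a ⊗ x ↦ s a ⊗ x`, of degree `-1`. -/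
def sigmaFam : EFam E (indCx E M) (omegaCx E M) (-1) := EFam.mk fun m m' h =>
  sigmaX E M m' ∘ₗ (castX (M := indCx E M) (show m = m' + 1 by lia)).restrictScalars E

lemma sigmaFam_v (m : ℤ) (h : m + 1 + -1 = m) :
    (sigmaFam E M).v (m + 1) m h = sigmaX E M m := by
  rw [sigmaFam, EFam.mk_v, castX_rfl]
  rfl

/-- The component `M^m ⟶ Λ ⊗_E M^m` of `x ↦ 1 ⊗ x`. -/
def etaX (m : ℤ) : M.X m →ₗ[E] (indCx E M).X m := IndMod.eta E (M.X m)

lemma etaX_d (m : ℤ) :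
    ((indCx E M).d m (m + 1)).hom.restrictScalars E ∘ₗ etaX E M m =
      etaX E M (m + 1) ∘ₗ (M.d m (m + 1)).hom.restrictScalars E :=
  (IndMod.eta_comp E (M.d m (m + 1)).hom).symm

/-- The map `M ⟶ Λ ⊗_E M`, `x ↦ 1 ⊗ x`. -/
def etaFam : EFam E M (indCx E M) 0 := EFam.mk fun m m' h =>
  (castX (M := indCx E M) (show m = m' by lia)).restrictScalars E ∘ₗ etaX E M m

lemma etaFam_v (m : ℤ) (h : m + 0 = m) : (etaFam E M).v m m h = etaX E M m := by
  rw [etaFam, EFam.mk_v, castX_rfl]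
  rfl

/-- The component `Ω_nc(M)^m ⟶ Λ ⊗_E M^{m + 1}` of `s a ⊗ x ↦ a ⊗ x - 1 ⊗ a x`. -/
def kappaX (m : ℤ) : (omegaCx E M).X m ⟶ (indCx E M).X (m + 1) :=
  ModuleCat.ofHom (OmegaMod.kappa E (M.X (m + 1)))

lemma kappaX_d (m : ℤ) : kappaX E M m ≫ (indCx E M).d (m + 1) (m + 1 + 1) =
    -((omegaCx E M).d m (m + 1) ≫ kappaX E M (m + 1)) := by
  ext1
  refine LinearMap.ext fun t => ?_
  refine (DFunLike.congr_fun (OmegaMod.kappa_map E (M.d (m + 1) (m + 1 + 1)).hom) t).symm.trans ?_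
  refine (neg_neg _).symm.trans (congrArg Neg.neg ?_)
  exact (map_neg (OmegaMod.kappa E (M.X (m + 1 + 1))) _).symm

/-- The map `Ω_nc(M) ⟶ Λ ⊗_E M`, `s a ⊗ x ↦ a ⊗ x - 1 ⊗ a x`, of degree `1`. -/
def kappaCochain : Cochain (omegaCx E M) (indCx E M) 1 := Cochain.mk fun m _ h =>
  kappaX E M m ≫ ((indCx E M).XIsoOfEq h).hom

lemma kappaCochain_v (m : ℤ) : (kappaCochain E M).v m (m + 1) rfl = kappaX E M m := by
  rw [kappaCochain, Cochain.mk_v, HomologicalComplex.XIsoOfEq_rfl, Iso.refl_hom, Category.comp_id]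

lemma δ_kappaCochain : δ 1 2 (kappaCochain E M) = 0 := by
  ext m m' h : 1
  obtain rfl : m' = m + 1 + 1 := by lia
  rw [δ_v 1 2 rfl _ m _ h (m + 1) (m + 1) (by lia) rfl, kappaCochain_v, kappaCochain_v, kappaX_d,
    Int.negOnePow_even 2 even_two, one_smul, neg_add_cancel, Cochain.zero_v]

lemma kappa_comp_eps :
    (kappaCochain E M).comp (Cochain.ofHom (indEps E M)) (add_zero 1) = 0 := by
  ext m m' h : 1
  subst h
  rw [Cochain.comp_zero_cochain_v, kappaCochain_v, Cochain.ofHom_v]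
  ext1
  exact IndMod.eps_kappa E _

lemma kappa_comp_sigma :
    (LFam E (kappaCochain E M)).comp (sigmaFam E M) (add_neg_cancel 1) =
      LFam E (Cochain.ofHom (𝟙 (omegaCx E M))) := by
  refine EFam.ext fun m m' h => ?_
  obtain rfl : m' = m := by lia
  rw [EFam.comp_v _ _ _ m' (m' + 1) m' rfl (by lia), sigmaFam_v, LFam_v, LFam_v, kappaCochain_v,
    Cochain.ofHom_v]
  exact IndMod.sigma_kappa E _

lemma eta_comp_eps : (etaFam E M).comp (LFam E (Cochain.ofHom (indEps E M))) (add_zero 0) =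
      LFam E (Cochain.ofHom (𝟙 M)) := by
  refine EFam.ext fun m m' h => ?_
  obtain rfl : m' = m := by lia
  rw [EFam.comp_v _ _ _ m' m' m' (by lia) (by lia), etaFam_v, LFam_v, LFam_v, Cochain.ofHom_v,
    Cochain.ofHom_v]
  exact IndMod.eps_eta E _

lemma eps_eta_add_sigma_kappa :
    (LFam E (Cochain.ofHom (indEps E M))).comp (etaFam E M) (add_zero 0) +
      (sigmaFam E M).comp (LFam E (kappaCochain E M)) (neg_add_cancel 1) =
      LFam E (Cochain.ofHom (𝟙 (indCx E M))) := by
  refine EFam.ext fun m m' h => ?_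
  obtain rfl : m' = m := by lia
  obtain ⟨m, rfl⟩ : ∃ k, m' = k + 1 := ⟨m' - 1, by lia⟩
  rw [EFam.add_v, EFam.comp_v _ _ _ (m + 1) (m + 1) (m + 1) (by lia) (by lia),
    EFam.comp_v _ _ _ (m + 1) m (m + 1) (by lia) (by lia), etaFam_v, sigmaFam_v, LFam_v, LFam_v,
    LFam_v, kappaCochain_v, Cochain.ofHom_v, Cochain.ofHom_v]
  exact IndMod.eta_eps_add_kappa_sigma E _

lemma dFam_sigma (h : (-1 : ℤ) + 1 = 0) : dFam (sigmaFam E M) h = 0 := by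
  refine EFam.ext fun m m' hm => ?_
  obtain rfl : m' = m := by lia
  obtain ⟨m, rfl⟩ : ∃ k, m' = k + 1 := ⟨m' - 1, by lia⟩
  rw [dFam_v _ h (m + 1) (m + 1) hm m (m + 1 + 1) (by lia) rfl, sigmaFam_v, sigmaFam_v, sigmaX_d,
    Int.negOnePow_zero, one_smul, EFam.zero_v, neg_add_cancel]

variable {E M} in
/-- The map `Ω_nc(f)`. -/
def omegaMap {N : CochainComplex (ModuleCat.{u} Λ) ℤ} (f : M ⟶ N) : omegaCx E M ⟶ omegaCx E N where
  f n := (Omega E).map (f.f (n + 1))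
  comm' i j _ := by
    change (Omega E).map _ ≫ (-(Omega E).map _) = (-(Omega E).map _) ≫ (Omega E).map _
    rw [Preadditive.comp_neg, Preadditive.neg_comp, ← Functor.map_comp, ← Functor.map_comp, f.comm]

variable {E M} in
lemma thetaDeg_yonedaMapDeg {N : CochainComplex (ModuleCat.{u} Λ) ℤ} (f : M ⟶ N) (n : ℤ)
    (g : YDeg E M n) :
    yonedaMapDeg E (omegaMap f) n (thetaDeg E n g) = thetaDeg E n (yonedaMapDeg E f n g) := by
  refine YDeg.ext fun k m hm => ?_
  rw [yonedaMapDeg_v, thetaDeg_v, thetaDeg_v]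
  cases k with
  | zero => exact LinearMap.comp_zero _
  | succ k =>
    rw [thetaV, thetaV, comp_units_smul]
    congr 1
    refine T.hom_ext E fun a w => ?_
    rw [thetaX_cons]
    exact (congrArg _ (thetaX_cons E _ a w)).trans (OmegaMod.map_form _ a _)

variable {E M} in
lemma theta_naturality {N : CochainComplex (ModuleCat.{u} Λ) ℤ} (f : M ⟶ N) :
    theta E M ≫ (yonedaFun E).map (omegaMap f) = (yonedaFun E).map f ≫ theta E N :=
  HomologicalComplex.hom_ext _ _ fun n => ModuleCat.hom_ext <| LinearMap.ext fun g =>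
    thetaDeg_yonedaMapDeg f n g

lemma extFam_sigma (h : (-1 : ℤ) + 1 = 0) :
    extFam (sigmaFam E M) h = -LFam E (Cochain.ofHom (omegaMap (indEps E M))) := by
  refine EFam.ext fun m m' hm => ?_
  obtain rfl : m' = m := by lia
  rw [EFam.neg_v, LFam_v, Cochain.ofHom_v]
  exact (congrArg (extDiff E) (sigmaFam_v E M m' _)).trans (IndMod.extDiff_sigma E _)

lemma dFam_eta (h : (0 : ℤ) + 1 = 1) : dFam (etaFam E M) h = 0 := by
  refine EFam.ext fun m m' hm => ?_
  subst hm
  rw [dFam_v _ h m (m + 1) rfl m (m + 1) (by lia) rfl, etaFam_v, etaFam_v, etaX_d,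
    Int.negOnePow_one, Units.neg_smul, one_smul, EFam.zero_v, add_neg_cancel]

lemma extFam_eta (h : (0 : ℤ) + 1 = 1) : extFam (etaFam E M) h = LFam E (kappaCochain E M) := by
  refine EFam.ext fun m m' hm => ?_
  subst hm
  rw [LFam_v, kappaCochain_v]
  exact (congrArg (extDiff E) (etaFam_v E M (m + 1) _)).trans (IndMod.extDiff_eta E _)

/-- Only the failure of `a ⊗ x ↦ s a ⊗ x` to be `Λ`-linear contributes to the differential of
postcomposition with it, and this failure is `s b ⊗ (a ⊗ x) ↦ - s b ⊗ a x`. -/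
lemma δ_YE_sigma : δ (-1) 0 (-YE (sigmaFam E M)) =
    Cochain.ofHom ((yonedaFun E).map (indEps E M) ≫ theta E M) := by
  rw [δ_neg, δ_YE _ (neg_add_cancel 1), dFam_sigma, YE_zero, zero_add, extFam_sigma, YE_neg,
    Int.negOnePow_zero, one_smul, Cochain.comp_neg, neg_neg]
  change (Cochain.ofHom (theta E (indCx E M))).comp (YL E _) _ = _
  rw [YL_ofHom, ← Cochain.ofHom_comp, theta_naturality]

lemma δ_YE_eta : δ 0 1 (YE (etaFam E M)) =
    -(Cochain.ofHom (theta E M)).comp (YL E (kappaCochain E M)) (zero_add 1) := by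
  rw [δ_YE _ (zero_add 1), dFam_eta, YE_zero, zero_add, extFam_eta, Int.negOnePow_one,
    Units.neg_smul, one_smul]
  rfl

/-- The map `Cone(𝒴(Λ, Λ ⊗_E M) ⟶ 𝒴(Λ, M)) ⟶ 𝒴(Λ, Ω_nc(M))` which restricts to `θ_M` on
`𝒴(Λ, M)` and is postcomposition with `a ⊗ x ↦ - s a ⊗ x` on `𝒴(Λ, Λ ⊗_E M)`. -/
def coneIndEps : mappingCone ((yonedaFun E).map (indEps E M)) ⟶ (yonedaFun E).obj (omegaCx E M) :=
  mappingCone.desc _ (-YE (sigmaFam E M)) (theta E M) (δ_YE_sigma E M)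

lemma inl_coneIndEps : (mappingCone.inl _).comp (Cochain.ofHom (coneIndEps E M))
    (add_zero (-1)) = -YE (sigmaFam E M) := by
  rw [coneIndEps, mappingCone.inl_desc]

lemma inr_coneIndEps : mappingCone.inr _ ≫ coneIndEps E M = theta E M := by
  rw [coneIndEps, mappingCone.inr_desc]

lemma YE_LFam {X X' : CochainComplex (ModuleCat.{u} Λ) ℤ} {e : ℤ} (z : Cochain X X' e) :
    YE (LFam E z) = YL E z := rfl

/-- The map `coneIndEps` is a homotopy equivalence: `0 ⟶ Ω_nc(M) ⟶ Λ ⊗_E M ⟶ M ⟶ 0` is split over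
`E` by `a ⊗ x ↦ s a ⊗ x` and `x ↦ 1 ⊗ x`, and `𝒴(Λ, -)` is functorial in graded `E`-linear maps. -/
lemma isIso_quotient_map_coneIndEps :
    IsIso ((HomotopyCategory.quotient _ (.up ℤ)).map (coneIndEps E M)) := by
  refine isIso_quotient_map_desc _ _ _ (YE (etaFam E M)) (YL E (kappaCochain E M)) _
    (δ_YE_eta E M) ?_ ?_ ?_ ?_ ?_
  · rw [δ_YL _ (show (1 : ℤ) + 1 = 2 from rfl), δ_kappaCochain, YL_zero]
  · rw [← YL_ofHom, YL_comp, kappa_comp_eps, YL_zero]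
  · rw [← YE_LFam, YE_comp, kappa_comp_sigma, YE_LFam, YL_ofHom, CategoryTheory.Functor.map_id]
  · rw [← YL_ofHom, ← YE_LFam, YE_comp, eta_comp_eps, YE_LFam, YL_ofHom,
      CategoryTheory.Functor.map_id]
  · rw [← YL_ofHom, ← YE_LFam, ← YE_LFam, YE_comp, YE_comp, ← YE_add, eps_eta_add_sigma_kappa,
      YE_LFam, YL_ofHom, CategoryTheory.Functor.map_id]

end BasicCone

/-! ### The truncations of the bar resolution as iterated extensions -/

section BarTower

open CochainComplex CochainComplex.HomComplex

variable {Λ : Type u} [Ring Λ] (E : Subring Λ) (X : CochainComplex (ModuleCat.{u} Λ) ℤ)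

lemma Functor.map_intUnits_smul (F : ModuleCat.{u} Λ ⥤ ModuleCat.{u} Λ) [F.Additive] (c : ℤˣ)
    {A B : ModuleCat.{u} Λ} (f : A ⟶ B) : F.map (c • f) = c • F.map f := by
  obtain rfl | rfl := Int.units_eq_one_or c
  · rw [one_smul, one_smul]
  · rw [Units.neg_smul, one_smul, Units.neg_smul, one_smul, Functor.map_neg]

lemma Omega_comp_neg {A A' B C : ModuleCat.{u} Λ} {a : A ⟶ B} {b : B ⟶ C} {a' : A ⟶ A'}
    {b' : A' ⟶ C} {c : ℤˣ} (h : a ≫ b = c • (a' ≫ b')) :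
    (Omega E).map a ≫ (-(Omega E).map b) = (-c) • ((Omega E).map a' ≫ (Omega E).map b') := by
  rw [Preadditive.comp_neg, ← Functor.map_comp, ← Functor.map_comp, h, Functor.map_intUnits_smul,
    Units.neg_smul]

/-- The canonical identification of `(Λ / E)^{⊗ q} ⊗_E X^{n + q}` with `Ω_nc^q(X)^n`. -/
def powIso : ∀ (q : ℕ) (n m : ℤ), n + q = m → ((OmegaPow E q).obj (X.X m) ≅ (omegaCxPow E X q).X n)
  | 0, _, _, h => X.XIsoOfEq (by simpa using h.symm)
  | q + 1, n, m, h => (Omega E).mapIso (powIso q (n + 1) m (by push_cast at h; lia))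

lemma powIso_d : ∀ (q : ℕ) (n m : ℤ) (h : n + q = m) (h' : n + 1 + q = m + 1),
    (powIso E X q n m h).hom ≫ (omegaCxPow E X q).d n (n + 1) =
      (q : ℤ).negOnePow •
        ((OmegaPow E q).map (X.d m (m + 1)) ≫ (powIso E X q (n + 1) (m + 1) h').hom)
  | 0, n, m, h, h' => by
    obtain rfl : n = m := by simpa using h
    rw [Nat.cast_zero, Int.negOnePow_zero, one_smul, powIso, powIso,
      HomologicalComplex.XIsoOfEq_rfl, HomologicalComplex.XIsoOfEq_rfl]
    exact (Category.id_comp _).trans (Category.comp_id _).symm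
  | q + 1, n, m, h, h' => by
    have k : n + 1 + q = m := by push_cast at h; lia
    have k' : n + 1 + 1 + q = m + 1 := by lia
    rw [Nat.cast_succ, Int.negOnePow_succ]
    exact Omega_comp_neg E (powIso_d q (n + 1) m k k')

lemma powIso_inv_d (q : ℕ) (n m : ℤ) (h : n + q = m) (h' : n + 1 + q = m + 1) :
    (q : ℤ).negOnePow • ((powIso E X q n m h).inv ≫ (OmegaPow E q).map (X.d m (m + 1))) =
      (omegaCxPow E X q).d n (n + 1) ≫ (powIso E X q (n + 1) (m + 1) h').inv := by
  rw [Iso.eq_comp_inv, Linear.units_smul_comp, Category.assoc, ← Linear.comp_units_smul,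
    ← powIso_d E X q n m h h', Iso.inv_hom_id_assoc]

/-- The canonical identification of `Λ ⊗_E (Λ / E)^{⊗ q} ⊗_E X^{n + q}` with the degree `n` part
of `Λ ⊗_E Ω_nc^q(X)`. -/
def barPowIso (q : ℕ) (n m : ℤ) (h : n + q = m) :
    (BarPow E q).obj (X.X m) ≅ (indCx E (omegaCxPow E X q)).X n :=
  (Ind E).mapIso (powIso E X q n m h)

lemma barPowIso_inv_d (q : ℕ) (n m : ℤ) (h : n + q = m) (h' : n + 1 + q = m + 1) :
    (q : ℤ).negOnePow • ((barPowIso E X q n m h).inv ≫ (BarPow E q).map (X.d m (m + 1))) =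
      (indCx E (omegaCxPow E X q)).d n (n + 1) ≫ (barPowIso E X q (n + 1) (m + 1) h').inv := by
  have h1 := congrArg (Ind E).map (powIso_inv_d E X q n m h h')
  rw [Functor.map_intUnits_smul, Functor.map_comp, Functor.map_comp] at h1
  exact h1

/-- The inclusion of the summand `Λ ⊗_E Ω_nc^q(X)` of `𝔹_{≤ P} ⊗_Λ X` in degree `n`. -/
def barSV (P : ℕ∞) (q : ℕ) (hq : (q : ℕ∞) ≤ P) (n : ℤ) :
    (indCx E (omegaCxPow E X q)).X n ⟶ BarDeg E X P n :=
  (barPowIso E X q n (n + q) rfl).inv ≫ barIn E q (n + q) rfl hq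

lemma barSV_eq (P : ℕ∞) (q : ℕ) (hq : (q : ℕ∞) ≤ P) (n m : ℤ) (h : n + q = m) :
    barSV E X P q hq n = (barPowIso E X q n m h).inv ≫ barIn E q m h hq := by
  subst h
  rfl

/-- The inclusion of the summand `Λ ⊗_E Ω_nc^q(X)` of `𝔹_{≤ P} ⊗_Λ X`. -/
def barS (P : ℕ∞) (q : ℕ) (hq : (q : ℕ∞) ≤ P) :
    Cochain (indCx E (omegaCxPow E X q)) (barCx E X P) 0 :=
  Cochain.ofHoms fun n => barSV E X P q hq n

variable (M : CochainComplex (ModuleCat.{u} Λ) ℤ)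

/-- The external differential `Λ ⊗_E Ω_nc(M) ⟶ Λ ⊗_E M` of degree `1`, in degree `m`. -/
def extX (m : ℤ) : (indCx E (omegaCx E M)).X m ⟶ (indCx E M).X (m + 1) :=
  ModuleCat.ofHom (IndMod.ext (E := E) (M := M.X (m + 1)))

/-- The external differential `Λ ⊗_E Ω_nc(M) ⟶ Λ ⊗_E M`. -/
def extCochain : Cochain (indCx E (omegaCx E M)) (indCx E M) 1 := Cochain.mk fun m _ h =>
  extX E M m ≫ ((indCx E M).XIsoOfEq h).hom

lemma extCochain_v (m : ℤ) : (extCochain E M).v m (m + 1) rfl = extX E M m := by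
  rw [extCochain, Cochain.mk_v, HomologicalComplex.XIsoOfEq_rfl, Iso.refl_hom, Category.comp_id]

lemma ext_comp_sigma : (LFam E (extCochain E M)).comp (sigmaFam E M) (add_neg_cancel 1) =
    LFam E (Cochain.ofHom (indEps E (omegaCx E M))) := by
  refine EFam.ext fun m m' h => ?_
  obtain rfl : m' = m := by lia
  rw [EFam.comp_v _ _ _ m' (m' + 1) m' rfl (by lia), sigmaFam_v, LFam_v, LFam_v, extCochain_v,
    Cochain.ofHom_v]
  exact IndMod.sigma_ext E

/-- `extX` for `Ω_nc^q(X)`. -/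
def powExtX (q : ℕ) (n : ℤ) :
    (indCx E (omegaCxPow E X (q + 1))).X n ⟶ (indCx E (omegaCxPow E X q)).X (n + 1) :=
  extX E (omegaCxPow E X q) n

/-- `extCochain` for `Ω_nc^q(X)`. -/
def powExt (q : ℕ) : Cochain (indCx E (omegaCxPow E X (q + 1))) (indCx E (omegaCxPow E X q)) 1 :=
  extCochain E (omegaCxPow E X q)

lemma powExt_v (q : ℕ) (m : ℤ) : (powExt E X q).v m (m + 1) rfl = powExtX E X q m :=
  extCochain_v E _ m

lemma ext_powIso (q : ℕ) (n m : ℤ) (h : n + (q + 1 : ℕ) = m) (h' : n + 1 + q = m) :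
    (barPowIso E X (q + 1) n m h).inv ≫ (barExt E q).app (X.X m) =
      powExtX E X q n ≫ (barPowIso E X q (n + 1) m h').inv := by
  ext1
  exact IndMod.ext_map (powIso E X q (n + 1) m h').inv.hom

lemma barSV_d_in (P : ℕ∞) (q : ℕ) (hq : (q : ℕ∞) ≤ P) (n m : ℤ) (h : n + q = m)
    (h' : n + 1 + q = m + 1) :
    (barPowIso E X q n m h).inv ≫ ((q : ℤ).negOnePow •
      ((BarPow E q).map (X.d m (m + 1)) ≫ barIn E q (m + 1) h' hq)) =
      (indCx E (omegaCxPow E X q)).d n (n + 1) ≫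
        (barPowIso E X q (n + 1) (m + 1) h').inv ≫ barIn E q (m + 1) h' hq := by
  rw [Linear.comp_units_smul, ← Category.assoc, ← Linear.units_smul_comp, barPowIso_inv_d,
    Category.assoc]

lemma barSV_zero_d (P : ℕ∞) (n : ℤ) (h0 : ((0 : ℕ) : ℕ∞) ≤ P) :
    barSV E X P 0 h0 n ≫ barD E n =
      (indCx E (omegaCxPow E X 0)).d n (n + 1) ≫ barSV E X P 0 h0 (n + 1) := by
  have k : n + 1 + (0 : ℕ) = n + (0 : ℕ) + 1 := by lia
  rw [barSV_eq E X P 0 h0 n _ rfl, barSV_eq E X P 0 h0 (n + 1) _ k, Category.assoc, barD,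
    barIn_desc, barDEx, add_zero]
  exact barSV_d_in E X P 0 h0 n (n + (0 : ℕ)) rfl k

lemma barSV_succ_d (P : ℕ∞) (q : ℕ) (hq : ((q + 1 : ℕ) : ℕ∞) ≤ P) (hq' : (q : ℕ∞) ≤ P) (n : ℤ) :
    barSV E X P (q + 1) hq n ≫ barD E n =
      (indCx E (omegaCxPow E X (q + 1))).d n (n + 1) ≫ barSV E X P (q + 1) hq (n + 1) +
        powExtX E X q n ≫ barSV E X P q hq' (n + 1) := by
  have k : n + 1 + (q + 1 : ℕ) = n + (q + 1 : ℕ) + 1 := by lia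
  have k' : n + 1 + (q : ℕ) = n + (q + 1 : ℕ) := by push_cast; lia
  rw [barSV_eq E X P (q + 1) hq n _ rfl, barSV_eq E X P (q + 1) hq (n + 1) _ k,
    barSV_eq E X P q hq' (n + 1) _ k', Category.assoc, barD, barIn_desc, Preadditive.comp_add]
  refine congrArg₂ (· + ·) (barSV_d_in E X P (q + 1) hq n _ rfl k) ?_
  rw [barDEx]
  rw [← Category.assoc, ext_powIso E X q n _ rfl k', Category.assoc]

lemma barS_v (P : ℕ∞) (q : ℕ) (hq : (q : ℕ∞) ≤ P) (n : ℤ) (h : n + 0 = n) :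
    (barS E X P q hq).v n n h = barSV E X P q hq n :=
  Cochain.ofHoms_v _ n

lemma δ_barS_succ (P : ℕ∞) (q : ℕ) (hq : ((q + 1 : ℕ) : ℕ∞) ≤ P) (hq' : (q : ℕ∞) ≤ P) :
    δ 0 1 (barS E X P (q + 1) hq) = (powExt E X q).comp (barS E X P q hq') (add_zero 1) := by
  ext n n' h : 1
  subst h
  rw [δ_v 0 1 rfl _ n _ rfl n (n + 1) (by lia) rfl, Cochain.comp_zero_cochain_v, powExt_v,
    barS_v, barS_v, barS_v, Int.negOnePow_one, Units.neg_smul, one_smul, barCx_d]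
  exact add_neg_eq_of_eq_add ((barSV_succ_d E X P q hq hq' n).trans (add_comm _ _))

open Classical in
/-- The components of the projection to the summand `Λ ⊗_E Ω_nc^q(X)`. -/
def barRV (q : ℕ) (n : ℤ) (q' : ℕ) (m : ℤ) (h : n + q' = m) :
    (BarPow E q').obj (X.X m) ⟶ (indCx E (omegaCxPow E X q)).X n :=
  if e : q' = q then (barPowIso E X q' n m h).hom ≫ eqToHom (by rw [e]) else 0

lemma barRV_self (q : ℕ) (n m : ℤ) (h : n + q = m) :
    barRV E X q n q m h = (barPowIso E X q n m h).hom := by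
  rw [barRV, dif_pos rfl, eqToHom_refl, Category.comp_id]

lemma barRV_ne (q : ℕ) (n : ℤ) (q' : ℕ) (m : ℤ) (h : n + q' = m) (e : q' ≠ q) :
    barRV E X q n q' m h = 0 := dif_neg e

/-- The projection to the summand `Λ ⊗_E Ω_nc^q(X)` in degree `n`. -/
def barRDeg (P : ℕ∞) (q : ℕ) (n : ℤ) : BarDeg E X P n ⟶ (indCx E (omegaCxPow E X q)).X n :=
  barDesc E fun q' m h _ => barRV E X q n q' m h

/-- The projection to the summand `Λ ⊗_E Ω_nc^q(X)` of `𝔹_{≤ P} ⊗_Λ X`. -/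
def barR (P : ℕ∞) (q : ℕ) : Cochain (barCx E X P) (indCx E (omegaCxPow E X q)) 0 :=
  Cochain.ofHoms fun n => barRDeg E X P q n

open Classical in
/-- The components of the projection of `𝔹 ⊗_Λ X` to `𝔹_{≤ P} ⊗_Λ X`. -/
def barTV (P : ℕ∞) (n : ℤ) (q' : ℕ) (m : ℤ) (h : n + q' = m) :
    (BarPow E q').obj (X.X m) ⟶ BarDeg E X P n :=
  if hq : (q' : ℕ∞) ≤ P then barIn E q' m h hq else 0

lemma barTV_pos (P : ℕ∞) (n : ℤ) (q' : ℕ) (m : ℤ) (h : n + q' = m) (hq : (q' : ℕ∞) ≤ P) :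
    barTV E X P n q' m h = barIn E q' m h hq := dif_pos hq

lemma barTV_neg (P : ℕ∞) (n : ℤ) (q' : ℕ) (m : ℤ) (h : n + q' = m) (hq : ¬(q' : ℕ∞) ≤ P) :
    barTV E X P n q' m h = 0 := dif_neg hq

/-- The projection of `𝔹_{≤ Q} ⊗_Λ X` to `𝔹_{≤ P} ⊗_Λ X` in degree `n`. -/
def barTDeg (Q P : ℕ∞) (n : ℤ) : BarDeg E X Q n ⟶ BarDeg E X P n :=
  barDesc E fun q' m h _ => barTV E X P n q' m h

/-- The projection of `𝔹_{≤ Q} ⊗_Λ X` to `𝔹_{≤ P} ⊗_Λ X` which vanishes on the summands indexed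
by `q > P`. -/
def barT (Q P : ℕ∞) : Cochain (barCx E X Q) (barCx E X P) 0 :=
  Cochain.ofHoms fun n => barTDeg E X Q P n

lemma barR_v (P : ℕ∞) (q : ℕ) (n : ℤ) (h : n + 0 = n) :
    (barR E X P q).v n n h = barRDeg E X P q n := Cochain.ofHoms_v _ n

lemma barT_v (Q P : ℕ∞) (n : ℤ) (h : n + 0 = n) :
    (barT E X Q P).v n n h = barTDeg E X Q P n := Cochain.ofHoms_v _ n

lemma barInc_v {P Q : ℕ∞} (hPQ : P ≤ Q) (n : ℤ) (h : n + 0 = n) :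
    (Cochain.ofHom (barInc E X hPQ)).v n n h = barIncDeg E hPQ n := Cochain.ofHom_v _ n

lemma barSV_desc (P : ℕ∞) (q : ℕ) (hq : (q : ℕ∞) ≤ P) (n : ℤ) {A : ModuleCat.{u} Λ}
    (f : ∀ (q : ℕ) (m : ℤ), n + q = m → (q : ℕ∞) ≤ P → ((BarPow E q).obj (X.X m) ⟶ A)) :
    barSV E X P q hq n ≫ barDesc E f = (barPowIso E X q n _ rfl).inv ≫ f q _ rfl hq := by
  rw [barSV, Category.assoc, barIn_desc]

lemma barS_comp_barR (P : ℕ∞) (q : ℕ) (hq : (q : ℕ∞) ≤ P) :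
    (barS E X P q hq).comp (barR E X P q) (zero_add 0) = Cochain.ofHom (𝟙 _) := by
  ext n : 1
  rw [Cochain.comp_zero_cochain_v, barS_v, barR_v, Cochain.ofHom_v]
  refine (barSV_desc E X P q hq n _).trans ?_
  rw [barRV_self, Iso.inv_hom_id]
  rfl

lemma barS_comp_barT (Q P : ℕ∞) (q : ℕ) (hq : (q : ℕ∞) ≤ Q) (h : ¬(q : ℕ∞) ≤ P) :
    (barS E X Q q hq).comp (barT E X Q P) (zero_add 0) = 0 := by
  ext n : 1
  rw [Cochain.comp_zero_cochain_v, barS_v, barT_v]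
  refine (barSV_desc E X Q q hq n _).trans ?_
  rw [barTV_neg E X P n q _ _ h]
  exact comp_zero

lemma barS_comp_barInc {P Q : ℕ∞} (hPQ : P ≤ Q) (q : ℕ) (hq : (q : ℕ∞) ≤ P) :
    (barS E X P q hq).comp (Cochain.ofHom (barInc E X hPQ)) (zero_add 0) =
      barS E X Q q (hq.trans hPQ) := by
  ext n : 1
  rw [Cochain.comp_zero_cochain_v, barS_v, barS_v, barInc_v]
  exact barSV_desc E X P q hq n _

lemma barIncDeg_barRDeg {P Q : ℕ∞} (hPQ : P ≤ Q) (q : ℕ) (hq : ¬(q : ℕ∞) ≤ P) (n : ℤ) :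
    barIncDeg E hPQ n ≫ barRDeg E X Q q n = 0 := by
  refine bar_hom_ext E fun q' m h hq' => ?_
  rw [barIncDeg, barRDeg, barIn_desc_assoc, barIn_desc,
    barRV_ne E X q n q' m h (fun e => hq (e ▸ hq')), comp_zero]

lemma barInc_comp_barR {P Q : ℕ∞} (hPQ : P ≤ Q) (q : ℕ) (hq : ¬(q : ℕ∞) ≤ P) :
    (Cochain.ofHom (barInc E X hPQ)).comp (barR E X Q q) (zero_add 0) = 0 := by
  ext n : 1
  rw [Cochain.comp_zero_cochain_v, barR_v, barInc_v]
  exact barIncDeg_barRDeg E X hPQ q hq n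

lemma barIncDeg_barTDeg {P Q : ℕ∞} (hPQ : P ≤ Q) (n : ℤ) :
    barIncDeg E hPQ n ≫ barTDeg E X Q P n = 𝟙 _ := by
  refine bar_hom_ext E fun q' m h hq' => ?_
  rw [barIncDeg, barTDeg, barIn_desc_assoc, barIn_desc, barTV_pos E X P n q' m h hq',
    Category.comp_id]

lemma barInc_comp_barT {P Q : ℕ∞} (hPQ : P ≤ Q) :
    (Cochain.ofHom (barInc E X hPQ)).comp (barT E X Q P) (zero_add 0) = Cochain.ofHom (𝟙 _) := by
  ext n : 1
  rw [Cochain.comp_zero_cochain_v, barT_v, barInc_v, Cochain.ofHom_v]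
  exact barIncDeg_barTDeg E X hPQ n

lemma natCast_le_succ (p : ℕ) : (p : ℕ∞) ≤ (p + 1 : ℕ) := by exact_mod_cast Nat.le_succ p

lemma not_succ_le_natCast (p : ℕ) : ¬((p + 1 : ℕ) : ℕ∞) ≤ (p : ℕ∞) := by
  exact_mod_cast Nat.not_succ_le_self p

lemma barTDeg_barIncDeg_add (p : ℕ) (n : ℤ) :
    barTDeg E X (p + 1 : ℕ) p n ≫ barIncDeg E (natCast_le_succ p) n +
      barRDeg E X (p + 1 : ℕ) (p + 1) n ≫ barSV E X (p + 1 : ℕ) (p + 1) le_rfl n = 𝟙 _ := by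
  refine bar_hom_ext E fun q m h hq => ?_
  rw [Preadditive.comp_add, barTDeg, barRDeg, barIn_desc_assoc, barIn_desc_assoc, Category.comp_id]
  by_cases e : q = p + 1
  · subst e
    rw [barTV_neg E X p n _ m h (not_succ_le_natCast p), barRV_self, zero_comp, zero_add,
      barSV_eq E X _ (p + 1) le_rfl n m h, Iso.hom_inv_id_assoc]
  · have hq' : (q : ℕ∞) ≤ p := by
      have : q ≤ p + 1 := by exact_mod_cast hq
      exact_mod_cast (show q ≤ p by lia)
    rw [barTV_pos E X p n _ m h hq', barRV_ne E X _ n q m h e, zero_comp, add_zero, barIncDeg,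
      barIn_desc]

lemma barT_inc_add_barR_barS (p : ℕ) :
    (barT E X (p + 1 : ℕ) p).comp (Cochain.ofHom (barInc E X (natCast_le_succ p))) (zero_add 0) +
      (barR E X (p + 1 : ℕ) (p + 1)).comp (barS E X (p + 1 : ℕ) (p + 1) le_rfl) (zero_add 0) =
      Cochain.ofHom (𝟙 _) := by
  ext n : 1
  rw [Cochain.add_v, Cochain.comp_zero_cochain_v, Cochain.comp_zero_cochain_v, barT_v, barInc_v,
    barR_v, barS_v, Cochain.ofHom_v]
  exact barTDeg_barIncDeg_add E X p n

/-- The complex `𝔹_{≤ p + 1} ⊗_Λ X` is an extension of `Λ ⊗_E Ω_nc^{p + 1}(X)` by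
`𝔹_{≤ p} ⊗_Λ X`. -/
def barSplitting (p : ℕ) :
    GradedSplitting (barInc E X (natCast_le_succ p)) (indCx E (omegaCxPow E X (p + 1))) where
  s := barS E X _ (p + 1) le_rfl
  r := barR E X _ (p + 1)
  t := barT E X _ _
  bd := (powExt E X p).comp (barS E X _ p le_rfl) (add_zero 1)
  δ_s := by
    rw [δ_barS_succ E X _ p le_rfl (natCast_le_succ p),
      Cochain.comp_assoc_of_second_is_zero_cochain, barS_comp_barInc]
  s_r := barS_comp_barR E X _ _ _
  s_t := barS_comp_barT E X _ _ _ _ (not_succ_le_natCast p)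
  inc_r := barInc_comp_barR E X _ _ (not_succ_le_natCast p)
  inc_t := barInc_comp_barT E X _
  t_inc_add_r_s := barT_inc_add_barR_barS E X p

end BarTower

/-! ### The cones of `𝒴(Λ, 𝔹_{≤ p} ⊗_Λ X) ⟶ 𝒴(Λ, X)` -/

section ConeTower

open CochainComplex CochainComplex.HomComplex

variable {Λ : Type u} [Ring Λ] (E : Subring Λ) (X : CochainComplex (ModuleCat.{u} Λ) ℤ)

lemma barRDeg_barSV_zero (n : ℤ) :
    barRDeg E X (0 : ℕ) 0 n ≫ barSV E X (0 : ℕ) 0 le_rfl n = 𝟙 _ := by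
  refine bar_hom_ext E fun q m h hq => ?_
  obtain rfl : q = 0 := by
    have : q ≤ 0 := by exact_mod_cast hq
    lia
  rw [barRDeg, barIn_desc_assoc, Category.comp_id, barRV_self, barSV_eq E X _ 0 le_rfl n m h,
    Iso.hom_inv_id_assoc]

lemma barSV_barRDeg (P : ℕ∞) (q : ℕ) (hq : (q : ℕ∞) ≤ P) (n : ℤ) :
    barSV E X P q hq n ≫ barRDeg E X P q n = 𝟙 _ := by
  rw [barRDeg, barSV_desc, barRV_self, Iso.inv_hom_id]

/-- The identification of `𝔹_{≤ 0} ⊗_Λ X` with `Λ ⊗_E X`. -/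
def barZeroIso : indCx E (omegaCxPow E X 0) ≅ barCx E X (0 : ℕ) :=
  HomologicalComplex.Hom.isoOfComponents
    (fun n => ⟨barSV E X (0 : ℕ) 0 le_rfl n, barRDeg E X (0 : ℕ) 0 n,
      barSV_barRDeg E X _ 0 le_rfl n, barRDeg_barSV_zero E X n⟩) (by
    rintro n _ rfl
    rw [barCx_d]
    exact barSV_zero_d E X _ n le_rfl)

lemma ofHom_barZeroIso : Cochain.ofHom (barZeroIso E X).hom = barS E X (0 : ℕ) 0 le_rfl := by
  ext n : 1
  rw [Cochain.ofHom_v, barS_v]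
  rfl

lemma barEps_v (n : ℤ) (h : n + 0 = n) :
    (Cochain.ofHom (barEps E X)).v n n h = barEpsDeg E X n := Cochain.ofHom_v _ n

lemma barS_succ_comp_barEps (q : ℕ) (hq : ((q + 1 : ℕ) : ℕ∞) ≤ ⊤) :
    (barS E X ⊤ (q + 1) hq).comp (Cochain.ofHom (barEps E X)) (zero_add 0) = 0 := by
  ext n : 1
  rw [Cochain.comp_zero_cochain_v, barS_v, barEps_v]
  refine (barSV_desc E X ⊤ (q + 1) hq n _).trans ?_
  exact comp_zero

/-- The map `Λ ⊗_E X ⟶ X`, with `X` written as `Ω_nc^0(X)` in the source. -/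
def indEpsZero : indCx E (omegaCxPow E X 0) ⟶ X := indEps E X

lemma barSV_zero_barEpsDeg (n : ℤ) :
    barSV E X ⊤ 0 le_top n ≫ barEpsDeg E X n = (indEpsZero E X).f n := by
  have k : n + (0 : ℕ) = n := by simp
  rw [barSV_eq E X ⊤ 0 le_top n n k, barEpsDeg, Category.assoc, barIn_desc, barEpsV,
    HomologicalComplex.XIsoOfEq_rfl, barPowIso, powIso, HomologicalComplex.XIsoOfEq_rfl]
  ext1
  exact IndMod.linearMap_ext fun a x => rfl

lemma barS_zero_comp_barEps :
    (barS E X ⊤ 0 le_top).comp (Cochain.ofHom (barEps E X)) (zero_add 0) =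
      Cochain.ofHom (indEpsZero E X) := by
  ext n : 1
  rw [Cochain.comp_zero_cochain_v, barS_v, barEps_v, Cochain.ofHom_v]
  exact barSV_zero_barEpsDeg E X n

variable {E} in
/-- Graded splittings are preserved by `𝒴(Λ, -)`. -/
def GradedSplitting.yoneda {B B' N : CochainComplex (ModuleCat.{u} Λ) ℤ} {inc : B ⟶ B'}
    (S : GradedSplitting inc N) :
    GradedSplitting ((yonedaFun E).map inc) ((yonedaFun E).obj N) where
  s := YL E S.s
  r := YL E S.r
  t := YL E S.t
  bd := YL E S.bd
  δ_s := by rw [δ_YL _ (zero_add 1), S.δ_s, ← YL_ofHom, YL_comp]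
  s_r := by rw [YL_comp, S.s_r, YL_ofHom, CategoryTheory.Functor.map_id]
  s_t := by rw [YL_comp, S.s_t, YL_zero]
  inc_r := by rw [← YL_ofHom, YL_comp, S.inc_r, YL_zero]
  inc_t := by rw [← YL_ofHom, YL_comp, S.inc_t, YL_ofHom, CategoryTheory.Functor.map_id]
  t_inc_add_r_s := by
    rw [← YL_ofHom, YL_comp, YL_comp, ← YL_add, S.t_inc_add_r_s, YL_ofHom,
      CategoryTheory.Functor.map_id]

lemma ofHom_varthetaApp (p : ℕ) : Cochain.ofHom (varthetaApp E X p) =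
    YL E ((Cochain.ofHom (barInc E X (le_top : (p : ℕ∞) ≤ ⊤))).comp
      (Cochain.ofHom (barEps E X)) (zero_add 0)) := by
  rw [← Cochain.ofHom_comp, YL_ofHom, Functor.map_comp]
  rfl

/-- The map `𝒴(Λ, Λ ⊗_E Ω_nc^p(X)) ⟶ 𝒴(Λ, 𝔹_{≤ p} ⊗_Λ X)`, not compatible with differentials,
given by the inclusion of the top summand. -/
def yonedaTop (p : ℕ) : Cochain ((yonedaFun E).obj (indCx E (omegaCxPow E X p)))
    ((yonedaFun E).obj (barCx E X p)) 0 :=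
  YL E (barS E X p p le_rfl)

lemma yonedaTop_succ_comp (p : ℕ) :
    (yonedaTop E X (p + 1)).comp (Cochain.ofHom (varthetaApp E X (p + 1))) (zero_add 0) = 0 := by
  rw [yonedaTop, ofHom_varthetaApp, YL_comp, ← Cochain.comp_assoc_of_first_is_zero_cochain,
    barS_comp_barInc, barS_succ_comp_barEps, YL_zero]

lemma ofHom_map_barZeroIso :
    Cochain.ofHom ((yonedaFun E).map (barZeroIso E X).hom) = yonedaTop E X 0 := by
  rw [← YL_ofHom, ofHom_barZeroIso, yonedaTop]

lemma map_barZeroIso_comp : (yonedaFun E).map (barZeroIso E X).hom ≫ varthetaApp E X 0 =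
    (yonedaFun E).map (indEpsZero E X) := by
  apply Cochain.ofHom_injective
  rw [Cochain.ofHom_comp, ofHom_map_barZeroIso, yonedaTop, ofHom_varthetaApp, YL_comp,
    ← Cochain.comp_assoc_of_first_is_zero_cochain, ← YL_ofHom]
  refine congrArg (YL E) ?_
  refine Eq.trans ?_ (barS_zero_comp_barEps E X)
  exact congrArg (fun z => z.comp (Cochain.ofHom (barEps E X)) (zero_add 0))
    (barS_comp_barInc E X le_top 0 le_rfl)

lemma map_barZeroIso_inv_comp : varthetaApp E X 0 ≫ 𝟙 _ =
    (yonedaFun E).map (barZeroIso E X).inv ≫ (yonedaFun E).map (indEpsZero E X) := by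
  rw [← map_barZeroIso_comp, ← Functor.map_comp_assoc, Iso.inv_hom_id,
    CategoryTheory.Functor.map_id, Category.id_comp, Category.comp_id]

/-- Postcomposition with `a ⊗ x ↦ s a ⊗ x` on `𝒴(Λ, Λ ⊗_E Ω_nc^p(X))`. -/
def yonedaSigma (p : ℕ) : Cochain ((yonedaFun E).obj (indCx E (omegaCxPow E X p)))
    ((yonedaFun E).obj (omegaCxPow E X (p + 1))) (-1) :=
  YE (sigmaFam E (omegaCxPow E X p))

/-- A homotopy equivalence from the cone of `𝒴(Λ, 𝔹_{≤ p} ⊗_Λ X) ⟶ 𝒴(Λ, X)` to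
`𝒴(Λ, Ω_nc^{p + 1}(X))` with prescribed restriction to the top summand
`𝒴(Λ, Λ ⊗_E Ω_nc^p(X))`. -/
structure ConeEquiv (p : ℕ) where
  /-- the map -/
  φ : mappingCone (varthetaApp E X p) ⟶ (yonedaFun E).obj (omegaCxPow E X (p + 1))
  isIso : IsIso ((HomotopyCategory.quotient _ (.up ℤ)).map φ)
  top_comp : ((yonedaTop E X p).comp (mappingCone.inl _) (zero_add (-1))).comp
    (Cochain.ofHom φ) (add_zero (-1)) = -yonedaSigma E X p

/-- `coneIndEps` for `X`. -/
def coneIndEpsZero : mappingCone ((yonedaFun E).map (indEpsZero E X)) ⟶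
    (yonedaFun E).obj (omegaCxPow E X (0 + 1)) := coneIndEps E X

lemma inl_coneIndEpsZero : (mappingCone.inl _).comp (Cochain.ofHom (coneIndEpsZero E X))
    (add_zero (-1)) = -yonedaSigma E X 0 := inl_coneIndEps E X

lemma inr_coneIndEpsZero : mappingCone.inr _ ≫ coneIndEpsZero E X = theta E X :=
  inr_coneIndEps E X

lemma isIso_quotient_map_coneIndEpsZero :
    IsIso ((HomotopyCategory.quotient _ (.up ℤ)).map (coneIndEpsZero E X)) :=
  isIso_quotient_map_coneIndEps E X

/-- The case `p = 0`, where `𝔹_{≤ 0} ⊗_Λ X` is `Λ ⊗_E X`. -/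
def coneEquivZero : ConeEquiv E X 0 where
  φ := mappingCone.map _ _ ((yonedaFun E).map (barZeroIso E X).inv) (𝟙 _)
    (map_barZeroIso_inv_comp E X) ≫ coneIndEpsZero E X
  isIso := by
    rw [Functor.map_comp]
    have := isIso_quotient_map_coneIndEpsZero E X
    have := isIso_quotient_map_mappingConeMap _ _ ((yonedaFun E).map (barZeroIso E X).inv) (𝟙 _)
      (map_barZeroIso_inv_comp E X) inferInstance inferInstance
    infer_instance
  top_comp := by
    rw [Cochain.ofHom_comp, ← Cochain.comp_assoc_of_second_is_zero_cochain,
      Cochain.comp_assoc_of_third_is_zero_cochain (yonedaTop E X 0), mappingCone.map,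
      mappingCone.inl_desc, ← Cochain.comp_assoc_of_first_is_zero_cochain, ← ofHom_map_barZeroIso,
      ← Cochain.ofHom_comp, ← Functor.map_comp, Iso.hom_inv_id, CategoryTheory.Functor.map_id,
      Cochain.id_comp, inl_coneIndEpsZero]

lemma inr_coneEquivZero : mappingCone.inr _ ≫ (coneEquivZero E X).φ = theta E X := by
  refine (mappingCone.inr_desc_assoc _ _ _ _ (coneIndEpsZero E X)).trans ?_
  rw [Category.id_comp, inr_coneIndEpsZero]

/-- The splitting of `𝒴(Λ, 𝔹_{≤ p} ⊗_Λ X) ⟶ 𝒴(Λ, 𝔹_{≤ p + 1} ⊗_Λ X)`. -/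
def yonedaSplitting (p : ℕ) :
    GradedSplitting ((yonedaFun E).map (barInc E X (natCast_le_succ p)))
      ((yonedaFun E).obj (indCx E (omegaCxPow E X (p + 1)))) :=
  (barSplitting E X p).yoneda

lemma yonedaSplitting_bd (p : ℕ) : (yonedaSplitting E X p).bd =
    (YL E (powExt E X p)).comp (yonedaTop E X p) (add_zero 1) := (YL_comp _ _ _).symm

lemma yonedaSplitting_comp (p : ℕ) :
    (yonedaFun E).map (barInc E X (natCast_le_succ p)) ≫ varthetaApp E X (p + 1) =
      varthetaApp E X p := varthetaApp_comp E X p _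

lemma yonedaSplitting_s_comp (p : ℕ) : (yonedaSplitting E X p).s.comp
    (Cochain.ofHom (varthetaApp E X (p + 1))) (zero_add 0) = 0 := yonedaTop_succ_comp E X p

variable {E X}

lemma YL_powExt_comp_sigma (p : ℕ) :
    (YL E (powExt E X p)).comp (yonedaSigma E X p) (add_neg_cancel 1) =
      Cochain.ofHom ((yonedaFun E).map (indEps E (omegaCxPow E X (p + 1)))) := by
  rw [← YL_ofHom]
  exact (YE_comp _ _ _).trans (congrArg YE (ext_comp_sigma E (omegaCxPow E X p)))

/-- The map `𝒴(Λ, Λ ⊗_E Ω_nc^{p + 1}(X)) ⟶ Cone(𝒴(Λ, 𝔹_{≤ p} ⊗_Λ X) ⟶ 𝒴(Λ, X))` given by the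
differential of the bar resolution becomes the augmentation. -/
lemma ConeEquiv.toCone_comp {p : ℕ} (c : ConeEquiv E X p) :
    (yonedaSplitting E X p).toCone (yonedaSplitting_comp E X p) (yonedaSplitting_s_comp E X p) ≫
      c.φ = (yonedaFun E).map (indEps E (omegaCxPow E X (p + 1))) := by
  apply Cochain.ofHom_injective
  rw [Cochain.ofHom_comp, GradedSplitting.ofHom_toCone, yonedaSplitting_bd, Cochain.neg_comp,
    Cochain.comp_assoc_of_third_is_zero_cochain, Cochain.comp_assoc_of_second_is_zero_cochain,
    ← Cochain.comp_assoc_of_third_is_zero_cochain, c.top_comp, Cochain.comp_neg, neg_neg,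
    YL_powExt_comp_sigma]

/-- `coneIndEps` for `Ω_nc^{p + 1}(X)`. -/
def coneIndEpsSucc (E : Subring Λ) (X : CochainComplex (ModuleCat.{u} Λ) ℤ) (p : ℕ) :
    mappingCone ((yonedaFun E).map (indEps E (omegaCxPow E X (p + 1)))) ⟶
      (yonedaFun E).obj (omegaCxPow E X (p + 1 + 1)) := coneIndEps E (omegaCxPow E X (p + 1))

/-- From `p` to `p + 1`: the cone for `p + 1` is the cone of a map from
`𝒴(Λ, Λ ⊗_E Ω_nc^{p + 1}(X))` to the cone for `p`, and this map is identified by `toCone_comp`. -/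
def ConeEquiv.succ {p : ℕ} (c : ConeEquiv E X p) : ConeEquiv E X (p + 1) where
  φ := (yonedaSplitting E X p).extend (yonedaSplitting_comp E X p) (yonedaSplitting_s_comp E X p)
    c.toCone_comp (coneIndEpsSucc E X p)
  isIso := GradedSplitting.isIso_quotient_map_extend (yonedaSplitting E X p)
    (yonedaSplitting_comp E X p) (yonedaSplitting_s_comp E X p) c.toCone_comp
    (coneIndEpsSucc E X p) c.isIso (isIso_quotient_map_coneIndEps E _)
  top_comp := ((yonedaSplitting E X p).s_inl_extend (yonedaSplitting_comp E X p)
    (yonedaSplitting_s_comp E X p) c.toCone_comp (coneIndEpsSucc E X p)).trans (inl_coneIndEps E _)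

lemma ConeEquiv.coneInc_succ {p : ℕ} (c : ConeEquiv E X p) :
    GradedSplitting.coneInc (yonedaSplitting_comp E X p) ≫ c.succ.φ =
      c.φ ≫ theta E (omegaCxPow E X (p + 1)) :=
  ((yonedaSplitting E X p).coneInc_extend (yonedaSplitting_comp E X p)
    (yonedaSplitting_s_comp E X p) c.toCone_comp (coneIndEpsSucc E X p)).trans
    (congrArg (c.φ ≫ ·) (inr_coneIndEps E (omegaCxPow E X (p + 1))))

variable (E X)

/-- The homotopy equivalences from the cone of `𝒴(Λ, 𝔹_{≤ p} ⊗_Λ X) ⟶ 𝒴(Λ, X)` to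
`𝒴(Λ, Ω_nc^{p + 1}(X))`. -/
def coneEquiv : ∀ p, ConeEquiv E X p
  | 0 => coneEquivZero E X
  | p + 1 => (coneEquiv p).succ

lemma inr_coneEquiv_zero : mappingCone.inr _ ≫ (coneEquiv E X 0).φ = theta E X :=
  inr_coneEquivZero E X

/-- The homotopy equivalences `coneEquiv` are compatible with the structure maps. -/
lemma coneInc_coneEquiv_succ (p : ℕ) :
    GradedSplitting.coneInc (yonedaSplitting_comp E X p) ≫ (coneEquiv E X (p + 1)).φ =
      (coneEquiv E X p).φ ≫ theta E (omegaCxPow E X (p + 1)) :=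
  (coneEquiv E X p).coneInc_succ

end ConeTower

/-! ### The cone of `ϑ_X` is homotopy equivalent to `𝒮𝒴(Λ, X)` -/

section Colimits

variable {R : Type u} [Ring R] {F : ℕ ⥤ CochainComplex (ModuleCat.{u} R) ℤ} {c d : Cocone F}

/-- A map between two cocones which are colimits in each degree is an isomorphism. -/
lemma IsSeqColimCx.isIso (hc : IsSeqColimCx c) (hd : IsSeqColimCx d) (f : c.pt ⟶ d.pt)
    (h : ∀ p, c.ι.app p ≫ f = d.ι.app p) : IsIso f := by
  have h' (p : ℕ) (n : ℤ) (y : (F.obj p).X n) : f.f n ((c.ι.app p).f n y) = (d.ι.app p).f n y := by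
    rw [← h]
    rfl
  have (n : ℤ) : IsIso (f.f n) := by
    refine (ConcreteCategory.isIso_iff_bijective _).2 ⟨?_, fun z => ?_⟩
    · refine (injective_iff_map_eq_zero (f.f n).hom).2 fun x hx => ?_
      obtain ⟨p, y, rfl⟩ := hc.exists_rep x
      obtain ⟨q, hq, hy⟩ := hd.exists_zero y ((h' p n y).symm.trans hx)
      rw [← seqCx_ι_map c hq, hy, map_zero]
    · obtain ⟨p, y, rfl⟩ := hd.exists_rep z
      exact ⟨(c.ι.app p).f n y, h' p n y⟩
  exact HomologicalComplex.Hom.isIso_of_components f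

lemma IsSeqColimCx.nonempty_isColimit (hc : IsSeqColimCx c) : Nonempty (IsColimit c) := by
  have : IsIso ((colimit.isColimit F).desc c) :=
    (IsSeqColimCx.of_isColimit (colimit.isColimit F)).isIso hc _ fun p =>
      (colimit.isColimit F).fac c p
  exact ⟨IsColimit.ofPointIso (colimit.isColimit F)⟩

/-- The shift `p ↦ p + 1` on the poset of natural numbers. -/
def succFunctor : ℕ ⥤ ℕ := (Monotone.functor (f := Nat.succ) fun _ _ => Nat.succ_le_succ)

lemma IsSeqColimCx.whisker_succ (hc : IsSeqColimCx c) : IsSeqColimCx (c.whisker succFunctor) := by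
  refine fun n => ⟨fun x => ?_, fun p y hy => ?_⟩
  · obtain ⟨p, y, rfl⟩ := hc.exists_rep x
    exact ⟨p, (F.map (homOfLE (Nat.le_succ p))).f n y, seqCx_ι_map c _ y⟩
  · obtain ⟨q, hq, h⟩ := hc.exists_zero (p := p + 1) y hy
    refine ⟨q, (Nat.le_succ p).trans hq, ?_⟩
    refine (seqCx_map_map (F := F) hq (Nat.le_succ q) y).symm.trans ?_
    rw [h, map_zero]
    rfl

end Colimits

section ConeColimit

open CochainComplex

variable {Λ : Type u} [Ring Λ] (E : Subring Λ) (X : CochainComplex (ModuleCat.{u} Λ) ℤ)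

/-- The constant sequence `𝒴(Λ, X)`. -/
abbrev constSeq : ℕ ⥤ CochainComplex (ModuleCat.{u} Λ) ℤ :=
  (Functor.const ℕ).obj ((yonedaFun E).obj X)

/-- The constant cocone. -/
def constCocone : Cocone (constSeq E X) where
  pt := (yonedaFun E).obj X
  ι := 𝟙 _

lemma isSeqColimCx_constCocone : IsSeqColimCx (constCocone E X) :=
  fun _ => ⟨fun x => ⟨0, x, rfl⟩, fun p _ hy => ⟨p, le_rfl, hy⟩⟩

/-- The maps `𝒴(Λ, 𝔹_{≤ p} ⊗_Λ X) ⟶ 𝒴(Λ, X)` as a morphism of sequences. -/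
def varthetaNat : yonedaBarSeq E X ⟶ constSeq E X :=
  NatTrans.ofSequence (fun p => varthetaApp E X p) (fun p => by
    erw [Functor.ofSequence_map_homOfLE_succ]
    exact (varthetaApp_comp E X p _).trans (Category.comp_id _).symm)

lemma ι_vartheta (p : ℕ) :
    (varthetaNat E X).app p ≫ (constCocone E X).ι.app p =
      (colimit.cocone (yonedaBarSeq E X)).ι.app p ≫ vartheta E X :=
  (Category.comp_id _).trans (colimit.ι_desc
    { pt := (yonedaFun E).obj X, ι := varthetaNat E X : Cocone (yonedaBarSeq E X) } p).symm

/-- The cone of `ϑ_X`, as a cocone on the cones of `𝒴(Λ, 𝔹_{≤ p} ⊗_Λ X) ⟶ 𝒴(Λ, X)`. -/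
def varthetaCocone : Cocone (coneSeq (varthetaNat E X)) :=
  coneCocone (varthetaNat E X) (colimit.cocone (yonedaBarSeq E X)) (constCocone E X) (vartheta E X)
    (ι_vartheta E X)

lemma isSeqColimCx_varthetaCocone : IsSeqColimCx (varthetaCocone E X) :=
  (IsSeqColimCx.of_isColimit (colimit.isColimit (yonedaBarSeq E X))).cone
    (isSeqColimCx_constCocone E X) (varthetaNat E X) (vartheta E X) (ι_vartheta E X)

lemma singularSeq_map_succ (p : ℕ) :
    (singularSeq E X).map (homOfLE (Nat.le_add_right p 1)) = theta E (omegaCxPow E X p) :=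
  Functor.ofSequence_map_homOfLE_succ _ p

lemma yonedaBarSeq_map_succ (p : ℕ) :
    (yonedaBarSeq E X).map (homOfLE (Nat.le_add_right p 1)) =
      (yonedaFun E).map (barInc E X (natCast_le_succ p)) :=
  Functor.ofSequence_map_homOfLE_succ _ p

/-- The transition maps of the sequence of cones are those of the graded splittings. -/
lemma coneSeq_map_succ (p : ℕ) :
    (coneSeq (varthetaNat E X)).map (homOfLE (Nat.le_add_right p 1)) =
      GradedSplitting.coneInc (yonedaSplitting_comp E X p) := by
  have h (f : (yonedaFun E).obj (barCx E X p) ⟶ (yonedaFun E).obj (barCx E X (p + 1 : ℕ)))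
      (hf : f = (yonedaFun E).map (barInc E X (natCast_le_succ p)))
      (hc : varthetaApp E X p ≫ 𝟙 _ = f ≫ varthetaApp E X (p + 1)) :
      mappingCone.map (varthetaApp E X p) (varthetaApp E X (p + 1)) f (𝟙 _) hc =
        GradedSplitting.coneInc (yonedaSplitting_comp E X p) := by
    subst hf
    rfl
  exact h _ (yonedaBarSeq_map_succ E X p)
    ((varthetaNat E X).naturality (homOfLE (Nat.le_add_right p 1))).symm

/-- The homotopy equivalences `coneEquiv` as a morphism of sequences. -/
def coneNat : coneSeq (varthetaNat E X) ⟶ succFunctor ⋙ singularSeq E X :=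
  NatTrans.ofSequence (fun p => (coneEquiv E X p).φ) fun p => by
    rw [coneSeq_map_succ]
    exact (coneInc_coneEquiv_succ E X p).trans
      (congrArg ((coneEquiv E X p).φ ≫ ·) (singularSeq_map_succ E X (p + 1)).symm)

/-- The map `Cone(ϑ_X) ⟶ 𝒮𝒴(Λ, X)` induced by the homotopy equivalences `coneEquiv`. -/
def coneToSingular : mappingCone (vartheta E X) ⟶ singularYoneda E X :=
  (isSeqColimCx_varthetaCocone E X).nonempty_isColimit.some.desc
    ((Cocone.precompose (coneNat E X)).obj
      ((colimit.cocone (singularSeq E X)).whisker succFunctor))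

lemma ι_coneToSingular (p : ℕ) :
    (coneNat E X).app p ≫ ((colimit.cocone (singularSeq E X)).whisker succFunctor).ι.app p =
      (varthetaCocone E X).ι.app p ≫ coneToSingular E X :=
  ((isSeqColimCx_varthetaCocone E X).nonempty_isColimit.some.fac
    ((Cocone.precompose (coneNat E X)).obj
      ((colimit.cocone (singularSeq E X)).whisker succFunctor)) p).symm

lemma inr_map {C : Type*} [Category C] [Preadditive C] [HasBinaryBiproducts C]
    {K L K' L' : CochainComplex C ℤ} (f : K ⟶ L) (f' : K' ⟶ L') (a : K ⟶ K') (b : L ⟶ L')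
    (h : f ≫ b = a ≫ f') :
    mappingCone.inr f ≫ mappingCone.map f f' a b h = b ≫ mappingCone.inr f' := by
  rw [mappingCone.map, mappingCone.inr_desc]

/-- On `𝒴(Λ, X)`, the map `coneToSingular` is `f ↦ [f; 0]`. -/
lemma inr_coneToSingular :
    mappingCone.inr (vartheta E X) ≫ coneToSingular E X = toSingular E X := by
  have h1 : mappingCone.inr (varthetaApp E X 0) ≫ (varthetaCocone E X).ι.app 0 =
      mappingCone.inr (vartheta E X) :=
    (inr_map (varthetaApp E X 0) (vartheta E X) _ _ (ι_vartheta E X 0)).trans (Category.id_comp _)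
  have h2 := congrArg (mappingCone.inr (varthetaApp E X 0) ≫ ·) (ι_coneToSingular E X 0)
  refine (congrArg (· ≫ coneToSingular E X) h1).symm.trans ((Category.assoc _ _ _).trans
    (h2.symm.trans ((Category.assoc _ _ _).symm.trans ?_)))
  refine (congrArg (· ≫ _) (inr_coneEquiv_zero E X)).trans ?_
  refine (congrArg (· ≫ _) (singularSeq_map_succ E X 0).symm).trans ?_
  exact (colimit.cocone (singularSeq E X)).w _

variable [IsSemisimpleRing E]

lemma injective_yonedaObj (X : CochainComplex (ModuleCat.{u} Λ) ℤ) :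
    IsInjComplex ((yonedaFun E).obj X) := fun n =>
  (Module.injective_iff_injective_object Λ _).1 (yoneda_injective E X n)

variable [IsNoetherianRing Λ]

lemma injective_colimYonedaBar : IsInjComplex (colimYonedaBar E X) := fun n =>
  (Module.injective_iff_injective_object Λ _).1
    ((IsSeqColimCx.of_isColimit (colimit.isColimit (yonedaBarSeq E X))).injective n
      fun _ => yoneda_injective E _ n)

lemma injective_singularYoneda : IsInjComplex (singularYoneda E X) := fun n =>
  (Module.injective_iff_injective_object Λ _).1
    ((IsSeqColimCx.of_isColimit (colimit.isColimit (singularSeq E X))).injective n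
      fun _ => yoneda_injective E _ n)

/-- The complex `𝒮𝒴(Λ, X)` is homotopy equivalent to the cone of `ϑ_X`. -/
lemma isIso_quotient_map_coneToSingular :
    IsIso ((HomotopyCategory.quotient _ (.up ℤ)).map (coneToSingular E X)) :=
  (isSeqColimCx_varthetaCocone E X).isIso_quotient_map
    (IsSeqColimCx.of_isColimit (colimit.isColimit (singularSeq E X))).whisker_succ
    (coneNat E X) (coneToSingular E X) (ι_coneToSingular E X)
    (fun _ n => injective_cone _ (yoneda_injective E _) (yoneda_injective E _) n)
    (fun _ n => yoneda_injective E _ n) fun p => (coneEquiv E X p).isIso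

end ConeColimit

/-! ### The complex `𝒮𝒴(Λ, X)` is acyclic -/

section Acyclic

variable {Λ : Type u} [Ring Λ] (E : Subring Λ)

variable {E} in
/-- An element of `Λ = (Λ / E)^{⊗ 0} ⊗_E Λ`, as an element of the ring. -/
def T.toRing (x : T E 0) : Λ := x

/-- The unit of `Λ = (Λ / E)^{⊗ 0} ⊗_E Λ`. -/
def T.one : T E 0 := (1 : Λ)

lemma T.toRing_smul_one (x : T E 0) : T.toRing x • T.one E = x := mul_one (M := Λ) x

/-- The map `s a₁ ⊗ ⋯ ⊗ s a_p ⊗ x ↦ s a₁ ⊗ ⋯ ⊗ s a_p ⊗ s x ⊗ 1`. -/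
def appendOne : ∀ p : ℕ, T E p →ₗ[E] T E (p + 1)
  | 0 =>
    { toFun := fun x => T.cons (T.toRing x) (T.one E)
      map_add' := fun x y => form_add_left E (T.toRing x) (T.toRing y) (T.one E)
      map_smul' := fun e x => (coe_smul_form e (T.toRing x) (T.one E)).symm }
  | p + 1 => OmegaMod.mapE (appendOne p)

lemma appendOne_zero (x : T E 0) : appendOne E 0 x = T.cons (T.toRing x) (T.one E) := rfl

lemma appendOne_cons (p : ℕ) (a : Λ) (w : T E p) :
    appendOne E (p + 1) (T.cons a w) = T.cons a (appendOne E p w) :=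
  OmegaMod.mapE_form (appendOne E p) a w

lemma smul_cons {p : ℕ} (b a : Λ) (w : T E p) :
    b • (T.cons a w : T E (p + 1)) = T.cons (b * a) w - T.cons b (a • w) := smul_form b a w

lemma cons_sub {p : ℕ} (a : Λ) (w w' : T E p) :
    (T.cons a (w - w') : T E (p + 1)) = T.cons a w - T.cons a w' := form_sub E a w w'

lemma cons_neg {p : ℕ} (a : Λ) (w : T E p) :
    (T.cons a (-w) : T E (p + 1)) = -T.cons a w := form_neg E a w

lemma cons_units_smul {p : ℕ} (a : Λ) (c : ℤˣ) (w : T E p) :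
    (T.cons a (c • w) : T E (p + 1)) = c • T.cons a w := by
  obtain rfl | rfl := Int.units_eq_one_or c
  · rw [one_smul, one_smul]
  · rw [Units.neg_smul, one_smul, Units.neg_smul, one_smul, cons_neg]

lemma T.induction_on {p : ℕ} {P : T E (p + 1) → Prop} (t : T E (p + 1)) (h0 : P 0)
    (hc : ∀ a w, P (T.cons a w)) (ha : ∀ s t, P s → P t → P (s + t)) : P t :=
  OmegaMod.induction_on (P := P) t h0 hc ha

/-- The map `appendOne` is not `Λ`-linear; its failure to be so is the identity, up to sign. -/
lemma appendOne_smul : ∀ (p : ℕ) (a : Λ) (w : T E p),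
    appendOne E p (a • w) - a • appendOne E p w = (p : ℤ).negOnePow • T.cons a w
  | 0, a, w => by
    have h : T.toRing (a • w) = a * T.toRing w := rfl
    rw [appendOne_zero, appendOne_zero, smul_cons, h, T.toRing_smul_one, sub_sub_cancel,
      Nat.cast_zero, Int.negOnePow_zero, one_smul]
  | p + 1, a, w => by
    induction w using T.induction_on with
    | h0 =>
      have h : (T.cons a (0 : T E (p + 1)) : T E (p + 2)) = 0 := map_zero (formHom E a)
      rw [smul_zero, map_zero, smul_zero, h, smul_zero, sub_zero]
    | hc b w =>
      rw [smul_cons, map_sub, appendOne_cons, appendOne_cons, appendOne_cons, smul_cons,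
        sub_sub_sub_cancel_left, ← cons_sub, ← neg_sub, appendOne_smul p b w]
      push_cast
      rw [Int.negOnePow_succ, Units.neg_smul, cons_neg, cons_units_smul]
    | ha s t hs ht =>
      have h : (T.cons a (s + t) : T E (p + 2)) = T.cons a s + T.cons a t := form_add E a s t
      rw [smul_add, map_add, map_add, smul_add, h, smul_add, ← hs, ← ht]
      abel

/-- Up to sign, precomposition with `appendOne` is a contracting homotopy for `extT`. -/
lemma extT_comp_appendOne {p : ℕ} {M : ModuleCat.{u} Λ} (f : T E (p + 1) →ₗ[E] M) :
    extT E (f ∘ₗ appendOne E p) =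
      extT E f ∘ₗ appendOne E (p + 1) - (p : ℤ).negOnePow • f := by
  refine T.hom_ext E fun a w => ?_
  have h := congrArg f (appendOne_smul E p a w)
  rw [map_sub] at h
  have h' : f ((p : ℤ).negOnePow • T.cons a w) = ((p : ℤ).negOnePow • f) (T.cons a w) := by
    obtain h | h := Int.units_eq_one_or (p : ℤ).negOnePow
    · rw [h, one_smul, one_smul]
    · rw [h, Units.neg_smul, one_smul, Units.neg_smul, one_smul, map_neg]
      rfl
  rw [LinearMap.sub_apply, ← h', ← h, extT_cons, LinearMap.comp_apply, LinearMap.comp_apply,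
    LinearMap.comp_apply, appendOne_cons, extT_cons]
  abel

variable {E} {X : CochainComplex (ModuleCat.{u} Λ) ℤ}

/-- A cocycle of `𝒴(Λ, X)` whose component of filtration-degree `0` vanishes is a coboundary. -/
lemma exists_primitive {n : ℤ} (f : YDeg E X (n + 1)) (hf : yonedaD (n + 1) f = 0)
    (h0 : ∀ m hm, f.v 0 m hm = 0) : ∃ g : YDeg E X n, yonedaD n g = f := by
  let g : YDeg E X n := YDeg.mk fun p m hm =>
    (n + p).negOnePow • (f.v (p + 1) m (by omega) ∘ₗ appendOne E p)
  have hg (p m hm hm') : g.v p m hm =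
    (n + p).negOnePow • (f.v (p + 1) m hm' ∘ₗ appendOne E p) := rfl
  have hf' (p m hm) : f.dIn p m hm + f.dEx p m hm = 0 := by
    rw [← yonedaD_v, hf, YDeg.zero_v]
  refine ⟨g, YDeg.ext fun p m hm => ?_⟩
  have k1 : m - 1 + p = n := by omega
  have k2 : m - 1 + (p + 1 : ℕ) = n + 1 := by omega
  have k3 : m + (p + 1 : ℕ) = n + 1 + 1 := by omega
  have h1 : g.dIn p m hm = (n + p).negOnePow • (f.dIn (p + 1) m k3 ∘ₗ appendOne E p) := by
    rw [YDeg.dIn_eq _ p m hm _ k1, YDeg.dIn_eq _ _ m k3 _ k2, hg p _ k1 k2, comp_units_smul,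
      LinearMap.comp_assoc]
  rw [yonedaD_v, h1, eq_neg_of_add_eq_zero_left (hf' (p + 1) m k3)]
  cases p with
  | zero =>
    rw [YDeg.dEx_succ f 0 m k3 hm, h0, extT_zero, YDeg.dEx_zero, smul_zero, neg_zero,
      LinearMap.zero_comp, smul_zero, add_zero]
  | succ p =>
    have k4 : m + p = n := by omega
    rw [YDeg.dEx_succ f (p + 1) m k3 hm, YDeg.dEx_succ g p m hm k4, hg p m k4 hm,
      extT_units_smul, extT_comp_appendOne, LinearMap.neg_comp, units_smul_comp, smul_neg,
      smul_smul, smul_smul, smul_sub, smul_smul, ← Int.negOnePow_add, ← Int.negOnePow_add,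
      ← Int.negOnePow_add]
    have e1 : (n + (p + 1 : ℕ) + (n + 1 + 1)).negOnePow = (n + 1 + (n + p)).negOnePow :=
      (Int.negOnePow_eq_iff _ _).2 ⟨1, by push_cast; ring⟩
    have e2 : (n + 1 + (n + p) + p).negOnePow = -1 := by
      rw [show n + 1 + (n + p) + p = (n + p) + (n + p) + 1 by ring, Int.negOnePow_succ,
        Int.negOnePow_even _ ⟨_, rfl⟩]
    rw [e1, e2, Units.neg_smul, one_smul, sub_neg_eq_add, neg_add_cancel_left]

/-- The map `θ_X` sends cocycles to coboundaries. -/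
lemma exists_primitive_theta (n : ℤ) (f : ((yonedaFun E).obj X).X (n + 1))
    (hf : ((yonedaFun E).obj X).d (n + 1) (n + 1 + 1) f = 0) :
    ∃ g : ((yonedaFun E).obj (omegaCx E X)).X n,
      ((yonedaFun E).obj (omegaCx E X)).d n (n + 1) g = (theta E X).f (n + 1) f := by
  rw [yoneda_d] at hf ⊢
  refine exists_primitive (thetaDeg E (n + 1) f) ?_ fun m hm => rfl
  exact (thetaDeg_d E (n + 1) f).trans ((congrArg (thetaDeg E (n + 1 + 1)) hf).trans (map_zero _))

variable (E X)

/-- The complex `𝒮𝒴(Λ, X)` is acyclic: the transition maps `θ` send cocycles to coboundaries. -/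
lemma acyclic_singularYoneda : (singularYoneda E X).Acyclic := fun n => by
  obtain ⟨n, rfl⟩ : ∃ k, n = k + 1 := ⟨n - 1, by lia⟩
  rw [HomologicalComplex.exactAt_iff' _ n (n + 1) (n + 1 + 1) (by simp) (by simp),
    ShortComplex.moduleCat_exact_iff]
  intro x hx
  have hc := IsSeqColimCx.of_isColimit (colimit.isColimit (singularSeq E X))
  obtain ⟨p, y, hy, rfl⟩ := hc.exists_cocycle x hx
  obtain ⟨z, hz⟩ := exists_primitive_theta n y hy
  refine ⟨((colimit.cocone (singularSeq E X)).ι.app (p + 1)).f n z, ?_⟩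
  refine (hom_f_d _ _).symm.trans ?_
  refine (congrArg _ hz).trans ?_
  have h := seqCx_ι_map (colimit.cocone (singularSeq E X)) (Nat.le_add_right p 1) y
  rwa [singularSeq_map_succ] at h

end Acyclic

/-! ### The triangle of `ϑ_X` -/

section Triangle

open CochainComplex HomotopyCategory

variable {Λ : Type u} [Ring Λ]

/-- A morphism of complexes is a quasi-isomorphism if its cone is homotopy equivalent to an
acyclic complex. -/
lemma quasiIso_of_cone {C : Type*} [Category C] [Abelian C] {K L M : CochainComplex C ℤ}
    (φ : K ⟶ L) (c : mappingCone φ ⟶ M) (hc : IsIso ((quotient C (.up ℤ)).map c))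
    (hM : M.Acyclic) : _root_.QuasiIso φ := by
  rw [← HomologicalComplex.mem_quasiIso_iff, ← HomotopyCategory.quotient_map_mem_quasiIso_iff,
    quasiIso_eq_trW_subcategoryAcyclic]
  exact ((subcategoryAcyclic C).trW_iff_of_distinguished _
    (mappingCone_triangleh_distinguished φ)).2 ((subcategoryAcyclic C).prop_of_iso
      (asIso ((quotient C (.up ℤ)).map c)).symm
      ((quotient_obj_mem_subcategoryAcyclic_iff_acyclic M).2 hM))

/-- A pair of composable morphisms extends to an exact triangle if its image under a fully
faithful exact functor does so, up to isomorphism. -/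
lemma exists_distinguished_of_map {C D : Type*} [Category C] [Category D] [HasZeroObject C]
    [HasZeroObject D] [HasShift C ℤ] [HasShift D ℤ] [Preadditive C] [Preadditive D]
    [∀ n : ℤ, (CategoryTheory.shiftFunctor C n).Additive]
    [∀ n : ℤ, (CategoryTheory.shiftFunctor D n).Additive] [Pretriangulated C] [Pretriangulated D]
    (F : C ⥤ D) [F.CommShift ℤ] [F.IsTriangulated] [F.Full] [F.Faithful] {K L Z : C} (f : K ⟶ L)
    (g : L ⟶ Z) (T : Pretriangulated.Triangle D)
    (hT : T ∈ CategoryTheory.Pretriangulated.distinguishedTriangles) (a : T.obj₁ ≅ F.obj K)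
    (b : T.obj₂ ≅ F.obj L) (c : T.obj₃ ≅ F.obj Z) (h₁ : T.mor₁ ≫ b.hom = a.hom ≫ F.map f)
    (h₂ : T.mor₂ ≫ c.hom = b.hom ≫ F.map g) :
    ∃ w : Z ⟶ K⟦(1 : ℤ)⟧, Pretriangulated.Triangle.mk f g w ∈
      CategoryTheory.Pretriangulated.distinguishedTriangles := by
  have h₃ : T.mor₃ ≫ a.hom⟦(1 : ℤ)⟧' = c.hom ≫
      F.map (F.preimage (c.inv ≫ T.mor₃ ≫ a.hom⟦(1 : ℤ)⟧' ≫ (F.commShiftIso (1 : ℤ)).inv.app K)) ≫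
        (F.commShiftIso (1 : ℤ)).hom.app K := by
    simp
  exact ⟨F.preimage (c.inv ≫ T.mor₃ ≫ a.hom⟦(1 : ℤ)⟧' ≫ (F.commShiftIso (1 : ℤ)).inv.app K),
    (F.map_distinguished_iff _).1 (CategoryTheory.Pretriangulated.isomorphic_distinguished T hT _
      (Iso.symm (Pretriangulated.Triangle.isoMk _ _ a b c h₁ h₂ h₃)))⟩

/-- If `Z` is homotopy equivalent to the cone of `f : K ⟶ L`, then `K ⟶ L ⟶ Z` extends to an
exact triangle in `𝐊(Λ-Inj)`. -/
lemma exists_distinguished {K L Z : CochainComplex (ModuleCat.{u} Λ) ℤ} (f : K ⟶ L) (g : L ⟶ Z)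
    (hK : IsInjComplex K) (hL : IsInjComplex L) (hZ : IsInjComplex Z)
    (c : mappingCone f ⟶ Z) (hc : IsIso ((quotient _ (.up ℤ)).map c))
    (hg : mappingCone.inr f ≫ c = g) :
    ∃ w : quotKInj.obj (toInj Z hZ) ⟶ (quotKInj.obj (toInj K hK))⟦(1 : ℤ)⟧,
      Pretriangulated.Triangle.mk (quotKInj.map (toInjMap f hK hL))
        (quotKInj.map (toInjMap g hL hZ)) w ∈
          CategoryTheory.Pretriangulated.distinguishedTriangles (C := KInj Λ) := by
  let e := asIso ((quotient _ (.up ℤ)).map c)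
  refine exists_distinguished_of_map
    ((InjectiveObject.ι (ModuleCat.{u} Λ)).mapHomotopyCategory (.up ℤ)) _ _
    (mappingCone.triangleh f) (mappingCone_triangleh_distinguished f)
    (Iso.refl ((quotient _ (.up ℤ)).obj K)) (Iso.refl ((quotient _ (.up ℤ)).obj L))
    e ?_ ?_
  · exact (Category.comp_id _).trans (Category.id_comp _).symm
  · refine Eq.trans ?_ (Category.id_comp _).symm
    exact ((quotient _ (.up ℤ)).map_comp _ _).symm.trans (congrArg (quotient _ (.up ℤ)).map hg)

end Triangle

end SingYoneda

end

theorem mainTheorem5 {Λ : Type u} [Ring Λ] [IsNoetherianRing Λ] (E : Subring Λ)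
    [IsSemisimpleRing E] (X : CochainComplex (ModuleCat.{u} Λ) ℤ) :
    QuasiIso (SingYoneda.vartheta E X) ∧
    (∃ (hB : SingYoneda.IsInjComplex (SingYoneda.colimYonedaBar E X))
        (hY : SingYoneda.IsInjComplex ((SingYoneda.yonedaFun E).obj X))
        (hS : SingYoneda.IsInjComplex (SingYoneda.singularYoneda E X))
        (w : SingYoneda.quotKInj.obj (SingYoneda.toInj (SingYoneda.singularYoneda E X) hS) ⟶
          (SingYoneda.quotKInj.obj
            (SingYoneda.toInj (SingYoneda.colimYonedaBar E X) hB))⟦(1 : ℤ)⟧),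
      Pretriangulated.Triangle.mk
        (SingYoneda.quotKInj.map (SingYoneda.toInjMap (SingYoneda.vartheta E X) hB hY))
        (SingYoneda.quotKInj.map (SingYoneda.toInjMap (SingYoneda.toSingular E X) hY hS)) w ∈
          Pretriangulated.distinguishedTriangles (C := SingYoneda.KInj Λ)) ∧
    Nonempty (HomotopyEquiv (SingYoneda.singularYoneda E X)
      (CochainComplex.mappingCone (SingYoneda.vartheta E X))) := by
  have hc := SingYoneda.isIso_quotient_map_coneToSingular E X
  refine ⟨SingYoneda.quasiIso_of_cone (SingYoneda.vartheta E X) (SingYoneda.coneToSingular E X) hc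
      (SingYoneda.acyclic_singularYoneda E X),
    ⟨SingYoneda.injective_colimYonedaBar E X, SingYoneda.injective_yonedaObj E X,
      SingYoneda.injective_singularYoneda E X, ?_⟩, ?_⟩
  · exact SingYoneda.exists_distinguished _ _ _ _ _ (SingYoneda.coneToSingular E X) hc
      (SingYoneda.inr_coneToSingular E X)
  · obtain ⟨e, -⟩ :=
      (HomologicalComplex.isIso_quotient_map_iff_homotopyEquivalences _).1 hc
    exact ⟨e.symm⟩
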